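/- **Setting.** There are $N\ge 1$ user pairs $(\mathrm T_{A,n},\mathrm T_{B,n})$ and a relay with $M$ antennas. The channel vectors $\mathbf g_{AR,n}\sim\mathcal{CN}(\mathbf 0,\beta_{AR,n}\mathbf I_M)$ and $\mathbf g_{RB,n}\sim\mathcal{CN}(\mathbf 0,\beta_{RB,n}\mathbf I_M)$, $\beta_{AR,n},\beta_{RB,n}>0$, are the columns of $\mathbf G_{AR},\mathbf G_{RB}\in\mathbb C^{M\times N}$; write $\mathbf g_{BR,n}=\mathbf g_{RB,n}$. Pilot matrices $\boldsymbol\Phi_A,\boldsymbol\Phi_B\in\mathbb C^{\tau_p\times N}$ satisfy $\boldsymbol\Phi_A^T\boldsymbol\Phi_A^*=\boldsymbol\Phi_B^T\boldsymbol\Phi_B^*=\mathbf I_N$ and $\boldsymbol\Phi_A^T\boldsymbol\Phi_B^*=\mathbf 0$. The relay receives $\mathbf Y_p=\sqrt{\tau_pp_p}\,(\mathbf G_{AR}\boldsymbol\Phi_A^T+\mathbf G_{RB}\boldsymbol\Phi_B^T)+\mathbf N_p$, where $\mathbf N_p$ has i.i.d. $\mathcal{CN}(0,1)$ entries and $\mathbf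 G_{AR},\mathbf G_{RB},\mathbf N_p$ have jointly independent entries, and it forms the MMSE estimates $\hat{\mathbf G}_{AR}=(\tau_pp_p)^{-1/2}\mathbf Y_p\boldsymbol\Phi_A^*\big(\tfrac1{\tau_pp_p}\mathbf D_{AR}^{-1}+\mathbf I\big)^{-1}$ with $\mathbf D_{AR}=\mathrm{diag}(\beta_{AR,n})$, and similarly $\hat{\mathbf G}_{RB}$ (with $\boldsymbol\Phi_B$, $\mathbf D_{RB}$). Their columns are $\hat{\mathbf g}_{AR,n},\hat{\mathbf g}_{RB,n}$; write $\hat{\mathbf g}_{BR,n}=\hat{\mathbf g}_{RB,n}$, $\mathbf e=\mathbf g-\hat{\mathbf g}$, and $\sigma_{AR,n}^2=\frac{\tau_pp_p\beta_{AR,n}^2}{1+\tau_pp_p\beta_{AR,n}}$, $\sigma_{RB,n}^2=\frac{\tau_pp_p\beta_{RB,n}^2}{1+\tau_pp_p\beta_{RB,n}}$. **Spectral efficiency.** All users transmit with power $p_u$, the relay with power $p_r$. For $\mathbf v\in\mathbb C^M$ put $q_i(\mathbf v)=|\hat{\mathbf g}_{AR,i}^H\mathbf v|^2+|\hat{\mathbf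 g}_{RB,i}^H\mathbf v|^2$, and let $A_i=p_u q_i(\hat{\mathbf g}_{AR,i})$, $B_i=p_uq_i(\hat{\mathbf g}_{RB,i})$, $C_i=p_u(q_i(\mathbf e_{AR,i})+q_i(\mathbf e_{RB,i}))$, $D_i=p_u\sum_{j\ne i}(q_i(\mathbf g_{AR,j})+q_i(\mathbf g_{RB,j}))$, $E_i=\|\hat{\mathbf g}_{AR,i}\|^2+\|\hat{\mathbf g}_{RB,i}\|^2$. For $S\in\{A_i+B_i,\,A_i,\,B_i\}$ let $$R(S)=\tfrac12\,\mathbb E\Big[\log_2\Big(1+\frac{S}{\mathbb E[C_i+D_i+E_i\mid\hat{\mathbf G}_{AR},\hat{\mathbf G}_{RB}]}\Big)\Big],$$ and let $R_{1,i}^{DF}=R(A_i+B_i)$, $R_{AR,i}^{DF}=R(A_i)$, $R_{BR,i}^{DF}=R(B_i)$. For $X\in\{A,B\}$, with $\bar X$ the other letter, let $R_{RX,i}^{DF}=\frac12\log_2(1+\mathrm{SINR}_{RX,i})$, $$\mathrm{SINR}_{RX,i}=\frac{|\mathbb E\{\mathbf g_{XR,i}^T\hat{\mathbf g}_{XR,i}^*\}|^2}{\mathrm{Var}(\mathbf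 g_{XR,i}^T\hat{\mathbf g}_{XR,i}^*)+\mathrm{Var}(\mathbf g_{XR,i}^T\hat{\mathbf g}_{\bar XR,i}^*)+\sum_{j\ne i}\big(\mathbb E|\mathbf g_{XR,i}^T\hat{\mathbf g}_{RB,j}^*|^2+\mathbb E|\mathbf g_{XR,i}^T\hat{\mathbf g}_{AR,j}^*|^2\big)+\rho^{-2}},$$ where $\rho^2=p_r/\mathbb E\big(\|\hat{\mathbf G}_{AR}\|_F^2+\|\hat{\mathbf G}_{RB}\|_F^2\big)$. The ergodic spectral efficiency of pair $i$ under decode-and-forward is $$R_i^{DF}=\min\big(R_{1,i}^{DF},\ \min(R_{AR,i}^{DF},R_{RB,i}^{DF})+\min(R_{BR,i}^{DF},R_{RA,i}^{DF})\big).$$ **Theorem 8.** Fix $p_p,E_u,E_r>0$, and let $p_u=E_u/M^\alpha$, $p_r=E_r/M^\beta$ with $\alpha\ge0$, $\beta\ge0$ and ($\alpha>0$ or $\beta>\frac12$). Then, as $M\to\infty$, $$R_i^{DF}-\min\big(\bar R_{1,i}^{DF},\bar R_{2,i}^{DF}\big)\longrightarrow 0,$$ where $$\bar R_{1,i}^{DF}=\tfrac12\log_2\Big(1+\frac{E_u}{M^{\alpha-1}}\,\frac{\sigma_{AR,i}^4+\sigma_{RB,i}^4}{\sigma_{AR,i}^2+\sigma_{RB,i}^2}\Big),\qquad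 \bar R_{2,i}^{DF}=\min\big(\bar R_{AR,i}^{DF},\bar R_{RB,i}^{DF}\big)+\min\big(\bar R_{BR,i}^{DF},\bar R_{RA,i}^{DF}\big),$$ $$\bar R_{AR,i}^{DF}=\tfrac12\log_2\Big(1+\frac{E_u}{M^{\alpha-1}}\,\frac{\sigma_{AR,i}^4}{\sigma_{AR,i}^2+\sigma_{RB,i}^2}\Big),\qquad \bar R_{RA,i}^{DF}=\tfrac12\log_2\Big(1+\frac{E_r}{M^{\beta-1}}\,\frac{\sigma_{AR,i}^4}{\sum_{j=1}^N(\sigma_{AR,j}^2+\sigma_{RB,j}^2)}\Big),$$ and $\bar R_{BR,i}^{DF}$, $\bar R_{RB,i}^{DF}$ are obtained from $\bar R_{AR,i}^{DF}$, $\bar R_{RA,i}^{DF}$ by exchanging the subscripts $AR$ and $RB$. -/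

import Mathlib

open MeasureTheory ProbabilityTheory Filter Topology
open scoped Matrix

noncomputable section

namespace TwoWayRelay

/-- The circularly symmetric complex Gaussian law `CN(0, v)`: independent real and imaginary parts,
each real Gaussian with mean `0` and variance `v / 2`. -/
def complexGaussian (v : ℝ) : Measure ℂ :=
  ((gaussianReal 0 (v / 2).toNNReal).prod (gaussianReal 0 (v / 2).toNNReal)).map
    Complex.measurableEquivRealProd.symm

/-- Uncorrelated Rayleigh fading together with the noise of the pilot phase, for `M` relay antennas,
`N` user pairs and pilot sequences of length `τp`.  The entries of the channel matrices `GA`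
(relay to the users `A`) and `GB` (relay to the users `B`) and of the pilot noise `Np` are jointly
independent; column `n` of `GA` is `CN(0, bA n • I)`, column `n` of `GB` is `CN(0, bB n • I)`,
and the entries of `Np` are `CN(0, 1)`. -/
structure IsChannelModel {Ω : Type*} [MeasurableSpace Ω] (P : Measure Ω) {M N τp : ℕ}
    (bA bB : Fin N → ℝ) (GA GB : Ω → Matrix (Fin M) (Fin N) ℂ)
    (Np : Ω → Matrix (Fin M) (Fin τp) ℂ) : Prop where
  measurable_GA : ∀ m n, Measurable fun ω => GA ω m n
  measurable_GB : ∀ m n, Measurable fun ω => GB ω m n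
  measurable_Np : ∀ m t, Measurable fun ω => Np ω m t
  law_GA : ∀ m n, P.map (fun ω => GA ω m n) = complexGaussian (bA n)
  law_GB : ∀ m n, P.map (fun ω => GB ω m n) = complexGaussian (bB n)
  law_Np : ∀ m t, P.map (fun ω => Np ω m t) = complexGaussian 1
  indep : iIndepFun
    (fun (k : (Fin M × Fin N) ⊕ (Fin M × Fin N) ⊕ (Fin M × Fin τp)) (ω : Ω) =>
      Sum.elim (fun a : Fin M × Fin N => GA ω a.1 a.2)
        (Sum.elim (fun a : Fin M × Fin N => GB ω a.1 a.2)
          (fun a : Fin M × Fin τp => Np ω a.1 a.2)) k) P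

/-- Mutually orthogonal pilot sequences (the columns of `ΦA` and `ΦB`):
`ΦAᵀ ΦA^* = I`, `ΦBᵀ ΦB^* = I`, `ΦAᵀ ΦB^* = 0`. -/
structure IsPilot {τp N : ℕ} (ΦA ΦB : Matrix (Fin τp) (Fin N) ℂ) : Prop where
  orthonormal_A : ΦAᵀ * ΦA.map star = 1
  orthonormal_B : ΦBᵀ * ΦB.map star = 1
  orthogonal : ΦAᵀ * ΦB.map star = 0

/-- The received pilot matrix `√(τp pp) GA ΦAᵀ + √(τp pp) GB ΦBᵀ + Np`. -/
def receivedPilot {M N τp : ℕ} (pp : ℝ) (ΦA ΦB : Matrix (Fin τp) (Fin N) ℂ)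
    (GA GB : Matrix (Fin M) (Fin N) ℂ) (Np : Matrix (Fin M) (Fin τp) ℂ) :
    Matrix (Fin M) (Fin τp) ℂ :=
  ((Real.sqrt (τp * pp) : ℝ) : ℂ) • (GA * ΦAᵀ) + ((Real.sqrt (τp * pp) : ℝ) : ℂ) • (GB * ΦBᵀ) + Np

/-- The MMSE channel estimate `(τp pp)^(-1/2) Y Φ^* D̃` from the received pilot matrix `Y`, where
`D̃ = ((τp pp)⁻¹ D⁻¹ + I)⁻¹` and `D` is the diagonal matrix of the large-scale coefficients `b`. -/
def mmseEstimate {M N τp : ℕ} (pp : ℝ) (b : Fin N → ℝ) (Φ : Matrix (Fin τp) (Fin N) ℂ)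
    (Y : Matrix (Fin M) (Fin τp) ℂ) : Matrix (Fin M) (Fin N) ℂ :=
  ((1 / Real.sqrt (τp * pp) : ℝ) : ℂ) •
    (Y * Φ.map star * Matrix.diagonal fun n => (((1 / (τp * pp) * (b n)⁻¹ + 1)⁻¹ : ℝ) : ℂ))

/-- `|x^H y|²`. -/
def absSqH {M : ℕ} (x y : Fin M → ℂ) : ℝ := ‖star x ⬝ᵥ y‖ ^ 2

section FirstPhase

variable {M N : ℕ} (pA pB : Fin N → ℝ) (GA GB HA HB : Matrix (Fin M) (Fin N) ℂ) (i : Fin N)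

/-- Power of the signal of user `A` of pair `i` after combining; `HA`, `HB` are the estimates. -/
def powerA : ℝ :=
  pA i * (absSqH (HA.col i) (HA.col i) + absSqH (HB.col i) (HA.col i))

/-- Power of the signal of user `B` of pair `i` after combining. -/
def powerB : ℝ :=
  pB i * (absSqH (HA.col i) (HB.col i) + absSqH (HB.col i) (HB.col i))

/-- Power due to the estimation errors `GA - HA` and `GB - HB`. -/
def powerError : ℝ :=
  pA i * (absSqH (HA.col i) ((GA - HA).col i) + absSqH (HB.col i) ((GA - HA).col i)) +
    pB i * (absSqH (HA.col i) ((GB - HB).col i) + absSqH (HB.col i) ((GB - HB).col i))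

/-- Power of the interference from the other user pairs. -/
def powerInterference : ℝ :=
  ∑ j ∈ Finset.univ.erase i,
    (pA j * (absSqH (HA.col i) (GA.col j) + absSqH (HB.col i) (GA.col j)) +
      pB j * (absSqH (HA.col i) (GB.col j) + absSqH (HB.col i) (GB.col j)))

/-- Power of the noise after combining, `‖ĝ_{AR,i}‖² + ‖ĝ_{RB,i}‖²`. -/
def powerNoise : ℝ := ∑ m, ‖HA m i‖ ^ 2 + ∑ m, ‖HB m i‖ ^ 2

/-- Total power of estimation error, inter-pair interference and noise. -/
def powerImpairment : ℝ :=
  powerError pA pB GA GB HA HB i + powerInterference pA pB GA GB HA HB i + powerNoise HA HB i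

end FirstPhase

section Rates

variable {Ω : Type*} [MeasurableSpace Ω] (P : Measure Ω) {M N : ℕ}

/-- The σ-algebra generated by the two channel estimates. -/
@[reducible]
def estimateSigma (HA HB : Ω → Matrix (Fin M) (Fin N) ℂ) : MeasurableSpace Ω :=
  MeasurableSpace.comap
    (fun ω => ((fun m n => HA ω m n, fun m n => HB ω m n) :
      (Fin M → Fin N → ℂ) × (Fin M → Fin N → ℂ))) inferInstance

/-- First-phase ergodic rate with signal power `S`:
`(1/2) E[log₂(1 + S / E[impairment | estimates])]`. -/
def firstPhaseRate (pA pB : Fin N → ℝ) (GA GB HA HB : Ω → Matrix (Fin M) (Fin N) ℂ) (i : Fin N)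
    (S : Ω → ℝ) : ℝ :=
  1 / 2 * ∫ ω, Real.logb 2 (1 + S ω /
    (P[fun ω' => powerImpairment pA pB (GA ω') (GB ω') (HA ω') (HB ω') i |
      estimateSigma HA HB]) ω) ∂P

/-- Variance of a complex random variable. -/
def complexVar (Z : Ω → ℂ) : ℝ := ∫ ω, ‖Z ω - ∫ ω', Z ω' ∂P‖ ^ 2 ∂P

/-- The normalization `ρ = √(p_r / E‖J‖_F²)` of the maximum-ratio precoder `J = [HB, HA]^*`. -/
def rho (pr : ℝ) (HA HB : Ω → Matrix (Fin M) (Fin N) ℂ) : ℝ :=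
  Real.sqrt (pr / ∫ ω, (∑ m, ∑ n, (‖HB ω m n‖ ^ 2 + ‖HA ω m n‖ ^ 2)) ∂P)

/-- The effective gain `g_iᵀ ĥ_j^*`. -/
def gain (G H : Ω → Matrix (Fin M) (Fin N) ℂ) (i j : Fin N) (ω : Ω) : ℂ :=
  (G ω).col i ⬝ᵥ star ((H ω).col j)

/-- Broadcast rate to the user of pair `i` whose channel is `GX`, with estimate `HX`; `HY` is the
estimate of the channels on the other side. -/
def broadcastRate (pr : ℝ) (GX HX HY : Ω → Matrix (Fin M) (Fin N) ℂ) (i : Fin N) : ℝ :=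
  1 / 2 * Real.logb 2 (1 + ‖∫ ω, gain GX HX i i ω ∂P‖ ^ 2 /
    (complexVar P (gain GX HX i i) + complexVar P (gain GX HY i i) +
      ∑ j ∈ Finset.univ.erase i,
        ((∫ ω, ‖gain GX HY i j ω‖ ^ 2 ∂P) + ∫ ω, ‖gain GX HX i j ω‖ ^ 2 ∂P) +
      1 / rho P pr HX HY ^ 2))

/-- The ergodic spectral efficiency of pair `i` under decode-and-forward, as a function of the
channels `GA`, `GB` and of their estimates `HA`, `HB`. -/
def pairRate (pA pB : Fin N → ℝ) (pr : ℝ) (GA GB HA HB : Ω → Matrix (Fin M) (Fin N) ℂ)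
    (i : Fin N) : ℝ :=
  min
    (firstPhaseRate P pA pB GA GB HA HB i
      fun ω => powerA pA (HA ω) (HB ω) i + powerB pB (HA ω) (HB ω) i)
    (min (firstPhaseRate P pA pB GA GB HA HB i fun ω => powerA pA (HA ω) (HB ω) i)
        (broadcastRate P pr GB HB HA i) +
      min (firstPhaseRate P pA pB GA GB HA HB i fun ω => powerB pB (HA ω) (HB ω) i)
        (broadcastRate P pr GA HA HB i))

/-- The spectral efficiency `R_i^DF` when the relay uses the MMSE estimates obtained from the pilot
phase; `pA`, `pB`, `pr`, `pp` are the transmit powers of the users, the relay and each pilot. -/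
def spectralEfficiencyDF {τp : ℕ} (bA bB pA pB : Fin N → ℝ) (pr pp : ℝ)
    (ΦA ΦB : Matrix (Fin τp) (Fin N) ℂ) (GA GB : Ω → Matrix (Fin M) (Fin N) ℂ)
    (Np : Ω → Matrix (Fin M) (Fin τp) ℂ) (i : Fin N) : ℝ :=
  pairRate P pA pB pr GA GB
    (fun ω => mmseEstimate pp bA ΦA (receivedPilot pp ΦA ΦB (GA ω) (GB ω) (Np ω)))
    (fun ω => mmseEstimate pp bB ΦB (receivedPilot pp ΦA ΦB (GA ω) (GB ω) (Np ω))) i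

end Rates

/-- The variance `σ² = τp pp b² / (1 + τp pp b)` of the entries of a channel estimate. -/
def sigmaSq (τp : ℕ) (pp b : ℝ) : ℝ := τp * pp * b ^ 2 / (1 + τp * pp * b)

section Limits

variable (Eu Er α β : ℝ) {N : ℕ} (sA sB : Fin N → ℝ) (i : Fin N) (M : ℕ)

/-- `R̄_{1,i}`; here and below `sA n = σ_{AR,n}²` and `sB n = σ_{RB,n}²`. -/
def barR1 : ℝ :=
  1 / 2 * Real.logb 2 (1 + Eu / (M : ℝ) ^ (α - 1) * ((sA i ^ 2 + sB i ^ 2) / (sA i + sB i)))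

/-- `R̄_{AR,i}`. -/
def barRAR : ℝ :=
  1 / 2 * Real.logb 2 (1 + Eu / (M : ℝ) ^ (α - 1) * (sA i ^ 2 / (sA i + sB i)))

/-- `R̄_{BR,i}`. -/
def barRBR : ℝ :=
  1 / 2 * Real.logb 2 (1 + Eu / (M : ℝ) ^ (α - 1) * (sB i ^ 2 / (sB i + sA i)))

/-- `R̄_{RA,i}`. -/
def barRRA : ℝ :=
  1 / 2 * Real.logb 2 (1 + Er / (M : ℝ) ^ (β - 1) * (sA i ^ 2 / ∑ j, (sA j + sB j)))

/-- `R̄_{RB,i}`. -/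
def barRRB : ℝ :=
  1 / 2 * Real.logb 2 (1 + Er / (M : ℝ) ^ (β - 1) * (sB i ^ 2 / ∑ j, (sB j + sA j)))

/-- `R̄_{2,i}`. -/
def barR2 : ℝ :=
  min (barRAR Eu α sA sB i M) (barRRB Er β sA sB i M) +
    min (barRBR Eu α sA sB i M) (barRRA Er β sA sB i M)

end Limits

end TwoWayRelay

end

/-! The channels and the pilot noise are independent circular Gaussians, and the MMSE estimate and
its error are linear combinations of them with orthogonal coefficients. For jointly Gaussian
circular variables orthogonality is independence (`iIndepFun_linearCombination`), so all entries of
the estimates and of the errors are independent and centered, with moments that do not depend on `M`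
(`IsChannelModel.isEstimateModel`). Everything afterwards uses only this moment information.

First phase. Conditioning on the estimates averages out the errors. With `a`, `b` the squared norms
of the two estimated channels of the pair, `x` their squared inner product and `T` the interference
among estimates, the impairment becomes `(1 + p c) (a + b) + p T` (`condExp_powerImpairment`), and
the signal-to-impairment ratio is `p M` times a `ratio` of normalized statistics. These concentrate:
`a / M` and `b / M` are within order `M^(-1/2)` of the variances in mean, `x / M²` has mean of order
`1 / M`, and `p T / M` and `p c` have means of order `p`. Since `p M` may diverge, the logarithm is
controlled by a bound uniform in that factor where the statistics are close to their limits, and by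
a crude bound of order `log M` elsewhere (`exists_abs_log_ratio_sub_le`). Powers of `M` beat `log
M`, so for `α > 0` the first-phase rates approach their limits (`tendsto_meanLog_sub`).

Broadcast phase. The SINR is deterministic. Its squared mean gain is of order `M²`, and variances
and interference contribute `M κ` with `κ` bounded (`broadcastRate_eq`). Against the noise term `M S
/ p_r` they are negligible once `p_r → 0`, that is for `β > 0`.

At the boundary one phase is not approximated, but then it is not the bottleneck. For `α = 0` the
first-phase rates, true and approximate, grow like `log M` at least (up to the factor `1 / (2 log
2)`), while each broadcast rate grows at most like `max (1 - β) 0` times that; the outer minimum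
involves the sum of two of them, whence `β > 1/2`. For `β = 0` and `α > 0` the inner minima select
the first-phase rates. `tendsto_pairRate_sub` combines the cases. -/

noncomputable section

namespace TwoWayRelay

/-! ### Moments of the circularly symmetric Gaussian law. -/

section ComplexGaussian

/-- The measurable identification of the plane with `ℂ` is also a continuous linear one, and linear
images of Gaussian measures are Gaussian. -/
instance isGaussian_complexGaussian (v : ℝ) : IsGaussian (complexGaussian v) :=
  inferInstanceAs (IsGaussian
    (((gaussianReal 0 (v / 2).toNNReal).prod (gaussianReal 0 (v / 2).toNNReal)).map
      Complex.equivRealProdCLM.symm))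

lemma integral_complexGaussian {E : Type*} [NormedAddCommGroup E] [NormedSpace ℝ E]
    (v : ℝ) (f : ℂ → E) :
    ∫ z, f z ∂complexGaussian v =
      ∫ x : ℝ × ℝ, f ⟨x.1, x.2⟩ ∂((gaussianReal 0 (v / 2).toNNReal).prod
        (gaussianReal 0 (v / 2).toNNReal)) := by
  rw [complexGaussian, integral_map_equiv]
  rfl

lemma integral_sq_gaussianReal (v : NNReal) : ∫ x, x ^ 2 ∂gaussianReal 0 v = v := by
  have h := variance_fun_id_gaussianReal (μ := 0) (v := v)
  have h' : Var[id; gaussianReal 0 v] = v := variance_id_gaussianReal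
  rw [variance_eq_sub (memLp_id_gaussianReal 2)] at h'
  simpa using h'

lemma integral_id_complexGaussian (v : ℝ) : ∫ z, z ∂complexGaussian v = 0 := by
  have hint : Integrable (fun z : ℂ => z) (complexGaussian v) :=
    (IsGaussian.memLp_id (complexGaussian v) 1 (by simp)).integrable le_rfl
  apply Complex.ext
  · rw [← Complex.reCLM_apply, ← ContinuousLinearMap.integral_comp_comm _ hint]
    rw [integral_complexGaussian]
    simp only [Complex.reCLM_apply]
    rw [integral_fun_fst (fun x : ℝ => x)]
    simp
  · rw [← Complex.imCLM_apply, ← ContinuousLinearMap.integral_comp_comm _ hint]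
    rw [integral_complexGaussian]
    simp only [Complex.imCLM_apply]
    rw [integral_fun_snd (fun x : ℝ => x)]
    simp

lemma integrable_sq_gaussianReal (v : NNReal) : Integrable (fun x => x ^ 2) (gaussianReal 0 v) :=
  (memLp_id_gaussianReal (μ := 0) (v := v) 2).integrable_sq

/-- Circular symmetry: the real and imaginary parts have equal variance and are uncorrelated. This
vanishing pseudo-variance is what later reduces real covariances to Hermitian ones. -/
lemma integral_sq_complexGaussian (v : ℝ) : ∫ z, z ^ 2 ∂complexGaussian v = 0 := by
  have hint : Integrable (fun z : ℂ => z ^ 2) (complexGaussian v) := by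
    refine ((IsGaussian.memLp_id (complexGaussian v) 2 (by simp)).integrable_norm_pow
      (by simp)).mono' (by fun_prop) (ae_of_all _ fun z => by simp)
  have h2 := integrable_sq_gaussianReal (v / 2).toNNReal
  apply Complex.ext
  · rw [← Complex.reCLM_apply, ← ContinuousLinearMap.integral_comp_comm _ hint]
    rw [integral_complexGaussian]
    simp only [pow_two, Complex.reCLM_apply, Complex.mul_re, Complex.zero_re]
    rw [integral_sub, integral_fun_fst (fun x : ℝ => x * x), integral_fun_snd (fun x : ℝ => x * x)]
    · simp
    · simpa [pow_two] using h2.comp_fst _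
    · simpa [pow_two] using h2.comp_snd _
  · rw [← Complex.imCLM_apply, ← ContinuousLinearMap.integral_comp_comm _ hint]
    rw [integral_complexGaussian]
    simp only [pow_two, Complex.imCLM_apply, Complex.mul_im, Complex.zero_im]
    have : ∀ x : ℝ × ℝ, x.1 * x.2 + x.2 * x.1 = (2 * x.1) * x.2 := fun x => by ring
    simp_rw [this]
    rw [integral_prod_mul (fun x : ℝ => 2 * x) (fun x : ℝ => x)]
    simp

lemma integral_normSq_complexGaussian {v : ℝ} (hv : 0 ≤ v) :
    ∫ z, ‖z‖ ^ 2 ∂complexGaussian v = v := by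
  have h2 := integrable_sq_gaussianReal (v / 2).toNNReal
  rw [integral_complexGaussian]
  simp only [Complex.sq_norm, Complex.normSq_mk]
  simp only [← pow_two]
  rw [integral_add (h2.comp_fst _) (h2.comp_snd _), integral_fun_fst (fun x : ℝ => x ^ 2),
    integral_fun_snd (fun x : ℝ => x ^ 2), integral_sq_gaussianReal]
  simp only [probReal_univ, one_smul, Real.coe_toNNReal _ (by positivity : 0 ≤ v / 2)]
  ring

end ComplexGaussian

/-! ### Complex linear combinations of independent circular Gaussians. -/

section LinearCombinations

variable {Ω : Type*} [MeasurableSpace Ω] {P : Measure Ω}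

/-- A finite family of independent circularly symmetric complex Gaussian variables. -/
structure IsIndepComplexGaussian {κ : Type*} (P : Measure Ω) (W : κ → Ω → ℂ) (v : κ → ℝ) :
    Prop where
  measurable : ∀ k, Measurable (W k)
  law : ∀ k, P.map (W k) = complexGaussian (v k)
  nonneg : ∀ k, 0 ≤ v k
  indep : iIndepFun W P

namespace IsIndepComplexGaussian

variable {κ ι : Type*} [Fintype κ] [Fintype ι] {W : κ → Ω → ℂ} {v : κ → ℝ}

omit [Fintype κ] in
lemma hasGaussianLaw (h : IsIndepComplexGaussian P W v) (k : κ) : HasGaussianLaw (W k) P :=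
  ⟨by rw [h.law k]; infer_instance⟩

/-- The joint law of the whole family is needed, not only the marginals: uncorrelated Gaussian
variables are independent only when they are jointly Gaussian. -/
lemma hasGaussianLaw_linearCombination (h : IsIndepComplexGaussian P W v) (c : ι → κ → ℂ) :
    HasGaussianLaw (fun ω l => ∑ k, c l k * W k ω) P := by
  classical
  exact ((h.indep.hasGaussianLaw h.hasGaussianLaw).map_fun
    (ContinuousLinearMap.pi fun l => ∑ k, (ContinuousLinearMap.mul ℝ ℂ (c l k)).comp
      (ContinuousLinearMap.proj k))) |>.congr (ae_of_all _ fun ω => by ext l; simp)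

omit [Fintype κ] in
lemma integral_eq_zero (h : IsIndepComplexGaussian P W v) (k : κ) : ∫ ω, W k ω ∂P = 0 := by
  have := integral_map (h.measurable k).aemeasurable
    (f := fun z : ℂ => z) (by fun_prop) (μ := P)
  rw [← this, h.law, integral_id_complexGaussian]

omit [Fintype κ] in
lemma integral_mul_eq_zero (h : IsIndepComplexGaussian P W v) (k l : κ) :
    ∫ ω, W k ω * W l ω ∂P = 0 := by
  by_cases hkl : k = l
  · subst hkl
    have := integral_map (h.measurable k).aemeasurable
      (f := fun z : ℂ => z ^ 2) (by fun_prop) (μ := P)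
    simp_rw [← pow_two]
    rw [← this, h.law, integral_sq_complexGaussian]
  · rw [(h.indep.indepFun hkl).integral_fun_mul_eq_mul_integral
      (h.measurable k).aestronglyMeasurable (h.measurable l).aestronglyMeasurable,
      h.integral_eq_zero, zero_mul]

omit [Fintype κ] in
lemma integral_mul_star [DecidableEq κ] (h : IsIndepComplexGaussian P W v) (k l : κ) :
    ∫ ω, W k ω * star (W l ω) ∂P = if k = l then (v k : ℂ) else 0 := by
  split_ifs with hkl
  · subst hkl
    have := integral_map (h.measurable k).aemeasurable
      (f := fun z : ℂ => ‖z‖ ^ 2) (by fun_prop) (μ := P)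
    rw [h.law, integral_normSq_complexGaussian (h.nonneg k)] at this
    rw [this, ← integral_complex_ofReal]
    refine integral_congr_ae (ae_of_all _ fun ω => ?_)
    simp [Complex.mul_conj, Complex.normSq_eq_norm_sq]
  · have hi := (h.indep.indepFun hkl).comp measurable_id continuous_star.measurable
    have := hi.integral_fun_mul_eq_mul_integral (h.measurable k).aestronglyMeasurable
      (continuous_star.measurable.comp (h.measurable l)).aestronglyMeasurable
    simp only [Function.comp_def, id] at this
    rw [this, h.integral_eq_zero, zero_mul]

omit [Fintype κ] in
lemma memLp (h : IsIndepComplexGaussian P W v) (k : κ) : MemLp (W k) 2 P :=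
  (h.hasGaussianLaw k).memLp_two

lemma integral_linearCombination (h : IsIndepComplexGaussian P W v) (a : κ → ℂ) :
    ∫ ω, ∑ k, a k * W k ω ∂P = 0 := by
  rw [integral_finsetSum _ fun k _ => ((h.hasGaussianLaw k).integrable).const_mul _]
  simp [integral_const_mul, h.integral_eq_zero]

lemma integral_linearCombination_mul (h : IsIndepComplexGaussian P W v) (a b : κ → ℂ) :
    ∫ ω, (∑ k, a k * W k ω) * (∑ l, b l * W l ω) ∂P = 0 := by
  simp_rw [Finset.sum_mul_sum]
  have hi : ∀ k l, Integrable (fun ω => a k * W k ω * (b l * W l ω)) P := fun k l =>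
    ((h.memLp k).const_mul _).integrable_mul ((h.memLp l).const_mul _)
  rw [integral_finsetSum _ fun k _ => integrable_finsetSum _ fun l _ => hi k l]
  refine Finset.sum_eq_zero fun k _ => ?_
  rw [integral_finsetSum _ fun l _ => hi k l]
  refine Finset.sum_eq_zero fun l _ => ?_
  simp_rw [mul_mul_mul_comm _ _ (b l)]
  rw [integral_const_mul, h.integral_mul_eq_zero, mul_zero]

lemma integral_linearCombination_mul_star (h : IsIndepComplexGaussian P W v) (a b : κ → ℂ) :
    ∫ ω, (∑ k, a k * W k ω) * star (∑ l, b l * W l ω) ∂P = ∑ k, a k * star (b k) * v k := by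
  classical
  simp_rw [star_sum, star_mul', Finset.sum_mul_sum]
  have hi : ∀ k l, Integrable (fun ω => a k * W k ω * (star (b l) * star (W l ω))) P := fun k l =>
    ((h.memLp k).const_mul _).integrable_mul ((h.memLp l).star.const_mul _)
  rw [integral_finsetSum _ fun k _ => integrable_finsetSum _ fun l _ => hi k l]
  refine Finset.sum_congr rfl fun k _ => ?_
  rw [integral_finsetSum _ fun l _ => hi k l]
  simp_rw [mul_mul_mul_comm (a k) _ (star (b _)), integral_const_mul, h.integral_mul_star]
  simp

/-- Complex linear combinations of circularly symmetric Gaussian variables that are orthogonal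
in `L²` are independent. -/
lemma iIndepFun_linearCombination (h : IsIndepComplexGaussian P W v) (c : ι → κ → ℂ)
    (horth : ∀ l l', l ≠ l' → ∑ k, c l k * star (c l' k) * v k = 0) :
    iIndepFun (fun l ω => ∑ k, c l k * W k ω) P := by
  have := h.indep.isProbabilityMeasure
  have hG := h.hasGaussianLaw_linearCombination c
  refine hG.iIndepFun_of_covariance_inner fun l l' hl x y => ?_
  have hm : ∀ l, MemLp (fun ω => ∑ k, c l k * W k ω) 2 P := fun l => (hG.eval l).memLp_two
  have hmi : ∀ (l) (x : ℂ), MemLp (fun ω => inner ℝ x (∑ k, c l k * W k ω)) 2 P := fun l x =>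
    (hm l).const_inner x
  have h0 : ∀ (l) (x : ℂ), ∫ ω, inner ℝ x (∑ k, c l k * W k ω) ∂P = 0 := fun l x => by
    rw [integral_inner ((hm l).integrable (by norm_num)), h.integral_linearCombination]
    simp
  rw [covariance_eq_sub (hmi l x) (hmi l' y), h0, h0]
  simp only [Pi.mul_apply, mul_zero, sub_zero]
  -- A product of two real functionals splits into a part in `z * w`, whose mean vanishes by
  -- circularity, and a part in `z * star w`, whose mean vanishes by `horth`.
  have key : ∀ z w : ℂ, inner ℝ x z * inner ℝ y w =
      ((star x * star y / 2) * (z * w) + (star x * y / 2) * (z * star w)).re := fun z w => by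
    simp [Complex.inner, Complex.mul_re, Complex.mul_im]
    ring
  simp_rw [key]
  have i1 : Integrable (fun ω => (star x * star y / 2) *
      ((∑ k, c l k * W k ω) * (∑ k, c l' k * W k ω))) P :=
    ((hm l).integrable_mul (hm l')).const_mul _
  have i2 : Integrable (fun ω => (star x * y / 2) *
      ((∑ k, c l k * W k ω) * star (∑ k, c l' k * W k ω))) P :=
    ((hm l).integrable_mul (hm l').star).const_mul _
  have i3 : Integrable (fun ω => (star x * star y / 2) *
      ((∑ k, c l k * W k ω) * (∑ k, c l' k * W k ω)) + (star x * y / 2) *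
      ((∑ k, c l k * W k ω) * star (∑ k, c l' k * W k ω))) P := i1.add i2
  simp_rw [← Complex.reCLM_apply]
  rw [ContinuousLinearMap.integral_comp_comm Complex.reCLM i3, integral_add i1 i2,
    integral_const_mul, integral_const_mul, h.integral_linearCombination_mul,
    h.integral_linearCombination_mul_star, horth l l' hl]
  simp

lemma memLp_linearCombination (h : IsIndepComplexGaussian P W v) (a : κ → ℂ) :
    MemLp (fun ω => ∑ k, a k * W k ω) 4 P :=
  ((h.hasGaussianLaw_linearCombination (fun _ : Unit => a)).eval ()).memLp (by simp)

lemma integral_norm_sq_linearCombination (h : IsIndepComplexGaussian P W v) (a : κ → ℂ) :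
    ∫ ω, ‖∑ k, a k * W k ω‖ ^ 2 ∂P = ∑ k, ‖a k‖ ^ 2 * v k := by
  have := h.integral_linearCombination_mul_star a a
  have e : ∀ z : ℂ, z * star z = ((‖z‖ ^ 2 : ℝ) : ℂ) := fun z => by
    simp [Complex.mul_conj, Complex.normSq_eq_norm_sq]
  simp_rw [e, integral_complex_ofReal] at this
  exact_mod_cast this

/-- The real and imaginary parts of a linear combination `Z` of circularly symmetric Gaussian
variables are centered Gaussian with variance `E|Z|² / 2`. -/
lemma map_inner_linearCombination (h : IsIndepComplexGaussian P W v) (a : κ → ℂ) {u : ℂ}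
    (hu : star u * u = 1) :
    P.map (fun ω => inner ℝ u (∑ k, a k * W k ω)) =
      gaussianReal 0 ((∑ k, ‖a k‖ ^ 2 * v k) / 2).toNNReal := by
  have := h.indep.isProbabilityMeasure
  have hG := (h.hasGaussianLaw_linearCombination (fun _ : Unit => a)).eval ()
  have hm := hG.memLp_two
  have hG' := hG.map_fun (innerSL ℝ u)
  have h0 : ∫ ω, inner ℝ u (∑ k, a k * W k ω) ∂P = 0 := by
    rw [integral_inner (hm.integrable (by norm_num)), h.integral_linearCombination]
    simp
  have hV : Var[fun ω => inner ℝ u (∑ k, a k * W k ω); P] = (∑ k, ‖a k‖ ^ 2 * v k) / 2 := by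
    rw [variance_eq_sub (hm.const_inner u), h0, ← h.integral_norm_sq_linearCombination]
    -- For a unit vector `u` the squared projection is half the squared modulus plus a multiple of
    -- `z * z`, which has mean zero; hence the variance is half the second moment for every
    -- direction.
    have key : ∀ z : ℂ, inner ℝ u z ^ 2 = (star u ^ 2 / 2 * (z * z)).re + ‖z‖ ^ 2 / 2 := fun z => by
      have h1 : u.re * u.re + u.im * u.im = 1 := by
        have := congrArg Complex.re hu
        simpa [Complex.mul_re] using this
      have h2 : ‖z‖ ^ 2 = (u.re * u.re + u.im * u.im) * (z.re * z.re + z.im * z.im) := by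
        rw [h1, one_mul, Complex.sq_norm, Complex.normSq_apply]
      rw [h2]
      simp [Complex.inner, Complex.mul_re, Complex.mul_im, pow_two]
      ring
    simp only [Pi.pow_apply, key]
    have i1 : Integrable (fun ω => star u ^ 2 / 2 *
        ((∑ k, a k * W k ω) * (∑ k, a k * W k ω))) P := (hm.integrable_mul hm).const_mul _
    have i2 : Integrable (fun ω => ‖∑ k, a k * W k ω‖ ^ 2 / 2) P :=
      (hm.integrable_norm_pow (by norm_num)).div_const 2
    simp_rw [← Complex.reCLM_apply]
    rw [integral_add (Complex.reCLM.integrable_comp i1) i2,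
      ContinuousLinearMap.integral_comp_comm Complex.reCLM i1, integral_const_mul,
      h.integral_linearCombination_mul, integral_div]
    simp
  have := hG'.map_eq_gaussianReal
  simp only [innerSL_apply_apply] at this
  rw [this, h0, hV]

/-- The fourth moment of a linear combination of circularly symmetric Gaussian variables is
bounded in terms of its second moment. -/
lemma integral_norm_pow_four_linearCombination_le (h : IsIndepComplexGaussian P W v)
    (a : κ → ℂ) {s : ℝ} (hs : ∑ k, ‖a k‖ ^ 2 * v k = s) :
    ∫ ω, ‖∑ k, a k * W k ω‖ ^ 4 ∂P ≤ 4 * ∫ x, x ^ 4 ∂gaussianReal 0 (s / 2).toNNReal := by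
  have hm := h.memLp_linearCombination a
  have hmeas : Measurable fun ω => ∑ k, a k * W k ω :=
    Finset.measurable_sum _ fun k _ => (h.measurable k).const_mul _
  have key : ∀ u : ℂ, star u * u = 1 → Integrable (fun ω => inner ℝ u (∑ k, a k * W k ω) ^ 4) P ∧
      ∫ ω, inner ℝ u (∑ k, a k * W k ω) ^ 4 ∂P =
        ∫ x, x ^ 4 ∂gaussianReal 0 (s / 2).toNNReal := fun u hu => by
    have hi : MemLp (fun ω => inner ℝ u (∑ k, a k * W k ω)) 4 P := hm.const_inner u
    constructor
    · refine (hi.integrable_norm_pow (by norm_num)).congr (ae_of_all _ fun ω => ?_)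
      simp only [Real.norm_eq_abs, Even.pow_abs (by decide : Even 4)]
    · have := integral_map (μ := P) (φ := fun ω => inner ℝ u (∑ k, a k * W k ω))
        (hmeas.const_inner).aemeasurable (f := fun x : ℝ => x ^ 4) (by fun_prop)
      rw [← this, h.map_inner_linearCombination a hu, hs]
  obtain ⟨i1, e1⟩ := key 1 (by simp)
  obtain ⟨i2, e2⟩ := key Complex.I (by simp)
  -- The directions `1` and `Complex.I` give the real and imaginary parts, and `(r² + s²)² ≤ 2 r⁴ +
  -- 2 s⁴`.
  have hle : ∀ z : ℂ, ‖z‖ ^ 4 ≤ 2 * inner ℝ 1 z ^ 4 + 2 * inner ℝ Complex.I z ^ 4 := fun z => by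
    have : ‖z‖ ^ 4 = (z.re * z.re + z.im * z.im) ^ 2 := by
      rw [← Complex.normSq_apply, ← Complex.sq_norm]; ring
    rw [this]
    simp [Complex.inner, Complex.mul_re]
    nlinarith [sq_nonneg (z.re ^ 2 - z.im ^ 2)]
  calc ∫ ω, ‖∑ k, a k * W k ω‖ ^ 4 ∂P
      ≤ ∫ ω, (2 * inner ℝ 1 (∑ k, a k * W k ω) ^ 4 +
          2 * inner ℝ Complex.I (∑ k, a k * W k ω) ^ 4) ∂P :=
        integral_mono_of_nonneg (ae_of_all _ fun ω => by positivity)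
          ((i1.const_mul 2).add (i2.const_mul 2)) (ae_of_all _ fun ω => hle _)
    _ = 4 * ∫ x, x ^ 4 ∂gaussianReal 0 (s / 2).toNNReal := by
        rw [integral_add (i1.const_mul 2) (i2.const_mul 2), integral_const_mul,
          integral_const_mul, e1, e2]
        ring

end IsIndepComplexGaussian

end LinearCombinations

/-! ### The MMSE estimates and their errors as independent families. -/

section EstimateModel

variable {Ω : Type*} [MeasurableSpace Ω]

/-- Channel estimates `H` (columns indexed by `J`) and estimation errors `E` with jointly
independent centered entries, with column-wise second moments `sH`, `sE` and fourth moments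
bounded by `K`. -/
structure IsEstimateModel {M : ℕ} {J : Type*} (P : Measure Ω) (H E : Ω → Matrix (Fin M) J ℂ)
    (sH sE : J → ℝ) (K : ℝ) : Prop where
  measurable_H : ∀ m j, Measurable fun ω => H ω m j
  measurable_E : ∀ m j, Measurable fun ω => E ω m j
  indep : iIndepFun (fun (k : Bool × Fin M × J) ω => bif k.1 then H ω k.2.1 k.2.2
    else E ω k.2.1 k.2.2) P
  memLp_H : ∀ m j, MemLp (fun ω => H ω m j) 4 P
  memLp_E : ∀ m j, MemLp (fun ω => E ω m j) 4 P
  integral_H : ∀ m j, ∫ ω, H ω m j ∂P = 0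
  integral_E : ∀ m j, ∫ ω, E ω m j ∂P = 0
  secondMoment_H : ∀ m j, ∫ ω, ‖H ω m j‖ ^ 2 ∂P = sH j
  secondMoment_E : ∀ m j, ∫ ω, ‖E ω m j‖ ^ 2 ∂P = sE j
  fourthMoment_H : ∀ m j, ∫ ω, ‖H ω m j‖ ^ 4 ∂P ≤ K

/-- The shrinkage factor `((τp pp b)⁻¹ + 1)⁻¹` of the MMSE estimate. -/
def shrinkage (τp : ℕ) (pp b : ℝ) : ℝ := (1 / (τp * pp) * b⁻¹ + 1)⁻¹

/-- The variance `b - σ²` of the entries of the estimation error. -/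
def errorSq (τp : ℕ) (pp b : ℝ) : ℝ := b - sigmaSq τp pp b

/-- Placing the two pilot matrices side by side turns the orthogonality relations into one Gram
identity, so that both sides of all pairs form a single family indexed by `Fin N ⊕ Fin N`. -/
lemma IsPilot.gram {τp N : ℕ} {ΦA ΦB : Matrix (Fin τp) (Fin N) ℂ} (hΦ : IsPilot ΦA ΦB) :
    (Matrix.fromCols ΦA ΦB)ᵀ * (Matrix.fromCols ΦA ΦB).map star = 1 := by
  have hBA : ΦBᵀ * ΦA.map star = 0 := by
    have := congrArg Matrix.conjTranspose hΦ.orthogonal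
    rw [Matrix.conjTranspose_mul, Matrix.conjTranspose_zero] at this
    convert this using 2
    · ext i j; simp
    · ext i j; simp
  have hmap : (Matrix.fromCols ΦA ΦB).map star = Matrix.fromCols (ΦA.map star) (ΦB.map star) := by
    ext i (j | j) <;> simp
  rw [hmap, Matrix.transpose_fromCols, Matrix.fromRows_mul_fromCols, hΦ.orthonormal_A,
    hΦ.orthonormal_B, hΦ.orthogonal, hBA, Matrix.fromBlocks_one]

/-- With no pilot symbols the diagonal entry `1` of the Gram matrix would be an empty sum. -/
lemma IsPilot.pos {τp N : ℕ} {ΦA ΦB : Matrix (Fin τp) (Fin N) ℂ} (hΦ : IsPilot ΦA ΦB)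
    (i : Fin N) : 0 < τp := by
  rcases Nat.eq_zero_or_pos τp with rfl | h
  · have := congrFun (congrFun hΦ.orthonormal_A i) i
    simp [Matrix.mul_apply] at this
  · exact h

lemma receivedPilot_eq {M N τp : ℕ} (pp : ℝ) (ΦA ΦB : Matrix (Fin τp) (Fin N) ℂ)
    (GA GB : Matrix (Fin M) (Fin N) ℂ) (Np : Matrix (Fin M) (Fin τp) ℂ) :
    receivedPilot pp ΦA ΦB GA GB Np = ((Real.sqrt (τp * pp) : ℝ) : ℂ) •
      (Matrix.fromCols GA GB * (Matrix.fromCols ΦA ΦB)ᵀ) + Np := by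
  rw [receivedPilot, Matrix.transpose_fromCols, Matrix.fromCols_mul_fromRows, smul_add]

lemma fromCols_mmseEstimate {M N τp : ℕ} (pp : ℝ) (bA bB : Fin N → ℝ)
    (ΦA ΦB : Matrix (Fin τp) (Fin N) ℂ) (Y : Matrix (Fin M) (Fin τp) ℂ) (m : Fin M)
    (j : Fin N ⊕ Fin N) :
    Matrix.fromCols (mmseEstimate pp bA ΦA Y) (mmseEstimate pp bB ΦB Y) m j =
      ((1 / Real.sqrt (τp * pp) : ℝ) : ℂ) * ((Y * (Matrix.fromCols ΦA ΦB).map star) m j *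
        (shrinkage τp pp (Sum.elim bA bB j) : ℝ)) := by
  rcases j with j | j <;>
  simp [mmseEstimate, shrinkage, Matrix.mul_apply, Matrix.diagonal]

/-- Correlation with the conjugate pilots removes every other user by the Gram identity. What
remains is the shrunken channel entry and a linear form in the matching row of the noise. -/
lemma mmseEstimate_receivedPilot {M N τp : ℕ} {pp : ℝ} (hpp : 0 < τp * pp) (bA bB : Fin N → ℝ)
    {ΦA ΦB : Matrix (Fin τp) (Fin N) ℂ} (hΦ : IsPilot ΦA ΦB)
    (GA GB : Matrix (Fin M) (Fin N) ℂ) (Np : Matrix (Fin M) (Fin τp) ℂ) (m : Fin M)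
    (j : Fin N ⊕ Fin N) :
    Matrix.fromCols (mmseEstimate pp bA ΦA (receivedPilot pp ΦA ΦB GA GB Np))
        (mmseEstimate pp bB ΦB (receivedPilot pp ΦA ΦB GA GB Np)) m j =
      (shrinkage τp pp (Sum.elim bA bB j) : ℝ) * (Matrix.fromCols GA GB m j) +
      ∑ t, ((shrinkage τp pp (Sum.elim bA bB j) / Real.sqrt (τp * pp) : ℝ) : ℂ) *
        star (Matrix.fromCols ΦA ΦB t j) * Np m t := by
  have hs : ((Real.sqrt (τp * pp) : ℝ) : ℂ) ≠ 0 := by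
    exact_mod_cast (Real.sqrt_pos.2 hpp).ne'
  rw [fromCols_mmseEstimate, receivedPilot_eq, Matrix.add_mul, Matrix.smul_mul, Matrix.mul_assoc,
    hΦ.gram, Matrix.mul_one, Matrix.add_apply, Matrix.smul_apply, smul_eq_mul, Matrix.mul_apply]
  simp only [mul_assoc, ← Finset.mul_sum, Matrix.map_apply]
  push_cast
  rw [Finset.sum_congr rfl fun t _ => mul_comm _ (Np m t)]
  field_simp

/-- The independent Gaussian variables that generate the model. -/
def source {M N τp : ℕ} (GA GB : Ω → Matrix (Fin M) (Fin N) ℂ)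
    (Np : Ω → Matrix (Fin M) (Fin τp) ℂ)
    (k : (Fin M × (Fin N ⊕ Fin N)) ⊕ (Fin M × Fin τp)) (ω : Ω) : ℂ :=
  Sum.elim (fun a => Matrix.fromCols (GA ω) (GB ω) a.1 a.2) (fun a => Np ω a.1 a.2) k

lemma IsChannelModel.isIndepComplexGaussian_source {P : Measure Ω} {M N τp : ℕ}
    {bA bB : Fin N → ℝ} (hbA : ∀ n, 0 < bA n) (hbB : ∀ n, 0 < bB n)
    {GA GB : Ω → Matrix (Fin M) (Fin N) ℂ} {Np : Ω → Matrix (Fin M) (Fin τp) ℂ}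
    (h : IsChannelModel P bA bB GA GB Np) :
    IsIndepComplexGaussian P (source GA GB Np)
      (Sum.elim (fun a => Sum.elim bA bB a.2) fun _ => 1) where
  measurable := by
    rintro (⟨m, n | n⟩ | ⟨m, t⟩)
    · exact h.measurable_GA m n
    · exact h.measurable_GB m n
    · exact h.measurable_Np m t
  law := by
    rintro (⟨m, n | n⟩ | ⟨m, t⟩)
    · exact h.law_GA m n
    · exact h.law_GB m n
    · exact h.law_Np m t
  nonneg := by
    rintro (⟨m, n | n⟩ | ⟨m, t⟩)
    · exact (hbA n).le
    · exact (hbB n).le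
    · exact zero_le_one
  indep := by
    let g : (Fin M × (Fin N ⊕ Fin N)) ⊕ (Fin M × Fin τp) →
        (Fin M × Fin N) ⊕ (Fin M × Fin N) ⊕ (Fin M × Fin τp) :=
      Sum.elim (fun a => Sum.elim (fun n => Sum.inl (a.1, n)) (fun n => Sum.inr (Sum.inl (a.1, n)))
        a.2) fun a => Sum.inr (Sum.inr a)
    have hg : Function.Injective g := by
      rintro (⟨m, n | n⟩ | ⟨m, t⟩) (⟨m', n' | n'⟩ | ⟨m', t'⟩) <;> simp [g]
    have := h.indep.precomp hg
    convert this using 1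
    funext k ω
    rcases k with ⟨m, n | n⟩ | ⟨m, t⟩ <;> rfl

/-- The coefficients of the estimates (`true`) and of the errors (`false`) with respect to
`source`. -/
def estimateCoeff {M τp : ℕ} {J : Type*} [DecidableEq J] (u w : J → ℝ)
    (Φ : Matrix (Fin τp) J ℂ) (m : Fin M) (j : J) :
    (Fin M × J) ⊕ (Fin M × Fin τp) → ℂ :=
  Sum.elim (fun a => if a.1 = m then if a.2 = j then (u j : ℂ) else 0 else 0)
    (fun a => if a.1 = m then (w j : ℂ) * star (Φ a.2 j) else 0)

lemma sum_estimateCoeff_mul {M τp : ℕ} {J : Type*} [Fintype J] [DecidableEq J] (u w : J → ℝ)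
    (Φ : Matrix (Fin τp) J ℂ) (m : Fin M) (j : J) (W : (Fin M × J) ⊕ (Fin M × Fin τp) → ℂ) :
    ∑ k, estimateCoeff u w Φ m j k * W k =
      u j * W (Sum.inl (m, j)) + ∑ t, w j * star (Φ t j) * W (Sum.inr (m, t)) := by
  simp [estimateCoeff, Fintype.sum_sum_type, Fintype.sum_prod_type, ite_mul,
    Finset.sum_ite_irrel]

/-- Entries in different rows use disjoint sources, and in the same row the Gram identity decouples
the noise parts of different columns. Only the correlation at a common entry survives. -/
lemma sum_estimateCoeff_mul_star {M τp : ℕ} {J : Type*} [Fintype J] [DecidableEq J]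
    (u w u' w' : J → ℝ) {Φ : Matrix (Fin τp) J ℂ} (hΦ : Φᵀ * Φ.map star = 1) (b : J → ℝ)
    (m m' : Fin M) (j j' : J) :
    ∑ k, estimateCoeff u w Φ m j k * star (estimateCoeff u' w' Φ m' j' k) *
        ((Sum.elim (fun a => b a.2) (fun _ => 1) k : ℝ) : ℂ) =
      if m = m' ∧ j = j' then ((u j * u' j * b j + w j * w' j : ℝ) : ℂ) else 0 := by
  have hg : ∑ t, star (Φ t j) * Φ t j' = if j = j' then 1 else 0 := by
    have := congrFun (congrFun hΦ j') j
    simp only [Matrix.mul_apply, Matrix.transpose_apply, Matrix.map_apply, Matrix.one_apply] at this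
    rw [if_congr eq_comm rfl rfl, ← this]
    exact Finset.sum_congr rfl fun t _ => mul_comm _ _
  simp_rw [mul_assoc]
  rw [sum_estimateCoeff_mul]
  by_cases hm : m = m'
  · subst hm
    have : ∀ t, (w j : ℂ) * (star (Φ t j) * (star ((w' j' : ℂ) * star (Φ t j')) * ((1 : ℝ) : ℂ))) =
        (w j * w' j') * (star (Φ t j) * Φ t j') := fun t => by
      simp; ring
    simp only [estimateCoeff, Sum.elim_inl, Sum.elim_inr, if_true, mul_assoc]
    simp_rw [this, ← Finset.mul_sum, hg]
    by_cases hj : j = j'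
    · subst hj; simp
    · simp [hj]
  · simp [estimateCoeff, hm]

lemma shrinkage_eq {τp : ℕ} {pp b : ℝ} (h : 0 < τp * pp) (hb : 0 < b) :
    shrinkage τp pp b = τp * pp * b / (1 + τp * pp * b) := by
  have hne : (1 + τp * pp * b) ≠ 0 := by positivity
  rw [shrinkage, eq_div_iff hne, inv_mul_eq_iff_eq_mul₀ (by positivity)]
  generalize (τp * pp : ℝ) = x at *
  field_simp

/-- Linear combinations of independent Gaussian variables with orthogonal coefficients form an
estimate model. -/
theorem IsIndepComplexGaussian.isEstimateModel {P : Measure Ω} {M τp : ℕ} {J : Type*}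
    [Fintype J] [DecidableEq J] {W : (Fin M × J) ⊕ (Fin M × Fin τp) → Ω → ℂ} {b : J → ℝ}
    (hW : IsIndepComplexGaussian P W (Sum.elim (fun a => b a.2) fun _ => 1))
    {Φ : Matrix (Fin τp) J ℂ} (hΦ : Φᵀ * Φ.map star = 1) {u w u' w' sH sE : J → ℝ}
    (hvH : ∀ j, u j * u j * b j + w j * w j = sH j)
    (hvE : ∀ j, u' j * u' j * b j + w' j * w' j = sE j)
    (hvHE : ∀ j, u j * u' j * b j + w j * w' j = 0)
    {H E : Ω → Matrix (Fin M) J ℂ}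
    (hH : ∀ ω m j, H ω m j = ∑ k, estimateCoeff u w Φ m j k * W k ω)
    (hE : ∀ ω m j, E ω m j = ∑ k, estimateCoeff u' w' Φ m j k * W k ω) :
    IsEstimateModel P H E sH sE
      (∑ j, 4 * ∫ x, x ^ 4 ∂gaussianReal 0 (sH j / 2).toNNReal) := by
  have hnorm : ∀ (u w : J → ℝ) (m : Fin M) j, ∑ k, ‖estimateCoeff u w Φ m j k‖ ^ 2 *
      (Sum.elim (fun a => b a.2) (fun _ => 1) k : ℝ) = u j * u j * b j + w j * w j := by
    intro u w m j
    have := sum_estimateCoeff_mul_star u w u w hΦ b m m j j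
    simp only [and_self, if_true] at this
    have e : ∀ z : ℂ, z * star z = ((‖z‖ ^ 2 : ℝ) : ℂ) := fun z => by
      simp [Complex.mul_conj, Complex.normSq_eq_norm_sq]
    simp_rw [e] at this
    exact_mod_cast this
  -- Distinct entries are orthogonal by the diagonal form of the weighted inner products; the
  -- estimate and the error of one entry are orthogonal by `hvHE`.
  have hindep := hW.iIndepFun_linearCombination (fun k : Bool × Fin M × J =>
      bif k.1 then estimateCoeff u w Φ k.2.1 k.2.2 else estimateCoeff u' w' Φ k.2.1 k.2.2) <| by
    rintro ⟨_ | _, m, j⟩ ⟨_ | _, m', j'⟩ hne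
    · refine (sum_estimateCoeff_mul_star _ _ _ _ hΦ b m m' j j').trans (if_neg ?_)
      rintro ⟨rfl, rfl⟩; exact hne rfl
    · refine (sum_estimateCoeff_mul_star _ _ _ _ hΦ b m m' j j').trans ?_
      rw [mul_comm (u' j), mul_comm (w' j), hvHE]; simp
    · refine (sum_estimateCoeff_mul_star _ _ _ _ hΦ b m m' j j').trans ?_
      rw [hvHE]; simp
    · refine (sum_estimateCoeff_mul_star _ _ _ _ hΦ b m m' j j').trans (if_neg ?_)
      rintro ⟨rfl, rfl⟩; exact hne rfl
  refine ⟨fun m j => ?_, fun m j => ?_, ?_, fun m j => ?_, fun m j => ?_, fun m j => ?_,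
    fun m j => ?_, fun m j => ?_, fun m j => ?_, fun m j => ?_⟩
  · simp_rw [hH]
    exact Finset.measurable_sum _ fun k _ => (hW.measurable k).const_mul _
  · simp_rw [hE]
    exact Finset.measurable_sum _ fun k _ => (hW.measurable k).const_mul _
  · convert hindep using 1
    funext k ω
    rcases k with ⟨_ | _, m, j⟩
    · exact hE ω m j
    · exact hH ω m j
  · simp_rw [hH]; exact hW.memLp_linearCombination _
  · simp_rw [hE]; exact hW.memLp_linearCombination _
  · simp_rw [hH]; exact hW.integral_linearCombination _
  · simp_rw [hE]; exact hW.integral_linearCombination _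
  · simp_rw [hH]; rw [hW.integral_norm_sq_linearCombination, ← hvH, ← hnorm u w m j]
  · simp_rw [hE]; rw [hW.integral_norm_sq_linearCombination, ← hvE, ← hnorm u' w' m j]
  · simp_rw [hH]
    refine (hW.integral_norm_pow_four_linearCombination_le (estimateCoeff u w Φ m j)
      ((hnorm u w m j).trans (hvH j))).trans (Finset.single_le_sum
      (f := fun j => 4 * ∫ x, x ^ 4 ∂gaussianReal 0 (sH j / 2).toNNReal)
      (fun j _ => ?_) (Finset.mem_univ j))
    exact mul_nonneg (by norm_num) (integral_nonneg fun x => by positivity)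

/-- In the channel model the MMSE estimates and their errors form an estimate model. -/
theorem IsChannelModel.isEstimateModel {P : Measure Ω} {M N τp : ℕ}
    {bA bB : Fin N → ℝ} (hbA : ∀ n, 0 < bA n) (hbB : ∀ n, 0 < bB n)
    {GA GB : Ω → Matrix (Fin M) (Fin N) ℂ} {Np : Ω → Matrix (Fin M) (Fin τp) ℂ}
    (h : IsChannelModel P bA bB GA GB Np) {ΦA ΦB : Matrix (Fin τp) (Fin N) ℂ}
    (hΦ : IsPilot ΦA ΦB) {pp : ℝ} (hpp : 0 < τp * pp)
    {H : Ω → Matrix (Fin M) (Fin N ⊕ Fin N) ℂ} (hH : ∀ ω, H ω = Matrix.fromCols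
      (mmseEstimate pp bA ΦA (receivedPilot pp ΦA ΦB (GA ω) (GB ω) (Np ω)))
      (mmseEstimate pp bB ΦB (receivedPilot pp ΦA ΦB (GA ω) (GB ω) (Np ω)))) :
    IsEstimateModel P H (fun ω => Matrix.fromCols (GA ω) (GB ω) - H ω)
      (fun j => sigmaSq τp pp (Sum.elim bA bB j)) (fun j => errorSq τp pp (Sum.elim bA bB j))
      (∑ j, 4 * ∫ x, x ^ 4 ∂gaussianReal 0 (sigmaSq τp pp (Sum.elim bA bB j) / 2).toNNReal) := by
  have hW := h.isIndepComplexGaussian_source hbA hbB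
  have hb : ∀ j, 0 < Sum.elim bA bB j := by rintro (j | j); exacts [hbA j, hbB j]
  have hsq : Real.sqrt (τp * pp) * Real.sqrt (τp * pp) = τp * pp := Real.mul_self_sqrt hpp.le
  have hw : ∀ j, shrinkage τp pp (Sum.elim bA bB j) / Real.sqrt (τp * pp) *
      (shrinkage τp pp (Sum.elim bA bB j) / Real.sqrt (τp * pp)) =
      shrinkage τp pp (Sum.elim bA bB j) ^ 2 / (τp * pp) := fun j => by
    rw [div_mul_div_comm, hsq, pow_two]
  -- The pair `(u, w)` weighs the channel and the noise in the estimate; subtracting the estimate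
  -- from the channel gives the weights `(1 - u, -w)` of the error.
  refine hW.isEstimateModel hΦ.gram
    (u := fun j => shrinkage τp pp (Sum.elim bA bB j))
    (w := fun j => shrinkage τp pp (Sum.elim bA bB j) / Real.sqrt (τp * pp))
    (u' := fun j => 1 - shrinkage τp pp (Sum.elim bA bB j))
    (w' := fun j => -(shrinkage τp pp (Sum.elim bA bB j) / Real.sqrt (τp * pp)))
    (fun j => ?_) (fun j => ?_) (fun j => ?_) (fun ω m j => ?_) (fun ω m j => ?_)
  · rw [hw, shrinkage_eq hpp (hb j), sigmaSq]
    generalize (τp * pp : ℝ) = x at *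
    have := hb j
    generalize Sum.elim bA bB j = y at *
    field_simp
    ring
  · rw [neg_mul_neg, hw, shrinkage_eq hpp (hb j), errorSq, sigmaSq]
    generalize (τp * pp : ℝ) = x at *
    have := hb j
    generalize Sum.elim bA bB j = y at *
    field_simp
    ring
  -- The orthogonality principle, which is where the MMSE value of the shrinkage `s` matters: with
  -- `y` the channel variance, `s (1 - s) y = s² / (τp pp)`.
  · rw [mul_neg, hw, shrinkage_eq hpp (hb j)]
    generalize (τp * pp : ℝ) = x at *
    have := hb j
    generalize Sum.elim bA bB j = y at *
    field_simp
    ring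
  · rw [sum_estimateCoeff_mul, hH]
    exact mmseEstimate_receivedPilot hpp bA bB hΦ (GA ω) (GB ω) (Np ω) m j
  · rw [sum_estimateCoeff_mul, Matrix.sub_apply, hH, mmseEstimate_receivedPilot hpp bA bB hΦ]
    simp only [Complex.ofReal_neg, neg_mul, Finset.sum_neg_distrib, source, Sum.elim_inl,
      Sum.elim_inr]
    push_cast
    ring

end EstimateModel

/-! ### Conditioning on independent variables and second moments of inner products. -/

section Moments

variable {Ω : Type*} [MeasurableSpace Ω] {P : Measure Ω}

lemma indepFun_pi_of_iIndepFun {ι α β : Type*} [Fintype α] [Fintype β] {f : ι → Ω → ℂ}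
    (h : iIndepFun f P) (hf : ∀ i, Measurable (f i)) (g : α → ι) (g' : β → ι)
    (hd : ∀ a b, g a ≠ g' b) :
    IndepFun (fun ω a => f (g a) ω) (fun ω b => f (g' b) ω) P := by
  classical
  have hST : Disjoint (Finset.univ.image g) (Finset.univ.image g') := by
    rw [Finset.disjoint_left]
    simp only [Finset.mem_image, Finset.mem_univ, true_and]
    rintro _ ⟨a, rfl⟩ ⟨b, hb⟩
    exact hd a b hb.symm
  have := h.indepFun_finset _ _ hST hf
  exact this.comp
    (φ := fun t a => t ⟨g a, Finset.mem_image_of_mem g (Finset.mem_univ a)⟩)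
    (ψ := fun t b => t ⟨g' b, Finset.mem_image_of_mem g' (Finset.mem_univ b)⟩)
    (measurable_pi_lambda _ fun a => measurable_pi_apply _)
    (measurable_pi_lambda _ fun a => measurable_pi_apply _)

/-- Conditioning a function of two independent variables on the first one integrates out the
second one. -/
lemma condExp_of_indepFun [IsProbabilityMeasure P] {α β : Type*} [mα : MeasurableSpace α]
    [MeasurableSpace β] [StandardBorelSpace β] [Nonempty β] {X : Ω → α} {Y : Ω → β}
    (hX : Measurable X) (hY : Measurable Y) (h : IndepFun X Y P) {F : α × β → ℝ}
    (hF : Measurable F) (hint : Integrable (fun ω => F (X ω, Y ω)) P) :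
    P[fun ω => F (X ω, Y ω) | mα.comap X] =ᵐ[P] fun ω => ∫ ω', F (X ω, Y ω') ∂P := by
  have h1 := condExp_prod_ae_eq_integral_condDistrib hX hY.aemeasurable hF.stronglyMeasurable hint
  have h2 : condDistrib Y X P =ᵐ[P.map X] Kernel.const α (P.map Y) := by
    have := Measure.isProbabilityMeasure_map (μ := P) hY.aemeasurable
    refine condDistrib_ae_eq_of_measure_eq_compProd X hY.aemeasurable ?_
    rw [Measure.compProd_const]
    exact (indepFun_iff_map_prod_eq_prod_map_map hX.aemeasurable hY.aemeasurable).1 h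
  filter_upwards [h1, ae_of_ae_map hX.aemeasurable h2] with ω e1 e2
  rw [e1, e2, Kernel.const_apply, integral_map hY.aemeasurable]
  exact (hF.comp measurable_prodMk_left).aestronglyMeasurable

lemma integral_of_indepFun [IsProbabilityMeasure P] {α β : Type*} [mα : MeasurableSpace α]
    [MeasurableSpace β] [StandardBorelSpace β] [Nonempty β] {X : Ω → α} {Y : Ω → β}
    (hX : Measurable X) (hY : Measurable Y) (h : IndepFun X Y P) {F : α × β → ℝ}
    (hF : Measurable F) (hint : Integrable (fun ω => F (X ω, Y ω)) P) :
    ∫ ω, F (X ω, Y ω) ∂P = ∫ ω, ∫ ω', F (X ω, Y ω') ∂P ∂P := by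
  rw [← integral_condExp hX.comap_le]
  exact integral_congr_ae (condExp_of_indepFun hX hY h hF hint)

/-- Centered uncorrelated square integrable complex variables with common second moment `t`. -/
structure IsWhite {μ : Type*} (P : Measure Ω) (Y : Ω → μ → ℂ) (t : ℝ) : Prop where
  memLp : ∀ m, MemLp (fun ω => Y ω m) 2 P
  integral_eq_zero : ∀ m, ∫ ω, Y ω m ∂P = 0
  secondMoment : ∀ m, ∫ ω, ‖Y ω m‖ ^ 2 ∂P = t
  orthogonal : ∀ m m', m ≠ m' → ∫ ω, Y ω m * star (Y ω m') ∂P = 0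

lemma integral_mul_star_eq_zero_of_indepFun {X Y : Ω → ℂ} (hX : Measurable X) (hY : Measurable Y)
    (h : IndepFun X Y P) (h0 : ∫ ω, X ω ∂P = 0) : ∫ ω, X ω * star (Y ω) ∂P = 0 := by
  have hi := h.comp measurable_id continuous_star.measurable
  have := hi.integral_fun_mul_eq_mul_integral hX.aestronglyMeasurable
    (continuous_star.measurable.comp hY).aestronglyMeasurable
  simp only [Function.comp_def, id] at this
  rw [this, h0, zero_mul]

lemma mul_star_self_eq (z : ℂ) : z * star z = ((‖z‖ ^ 2 : ℝ) : ℂ) := by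
  simp [Complex.mul_conj, Complex.normSq_eq_norm_sq]

variable {M : ℕ}

lemma IsWhite.memLp_dotProduct {Y : Ω → Fin M → ℂ} {t : ℝ} (h : IsWhite P Y t)
    (a : Fin M → ℂ) : MemLp (fun ω => a ⬝ᵥ Y ω) 2 P :=
  memLp_finsetSum _ fun m _ => (h.memLp m).const_mul _

lemma IsWhite.integral_norm_sq_dotProduct {Y : Ω → Fin M → ℂ} {t : ℝ} (h : IsWhite P Y t)
    (a : Fin M → ℂ) : ∫ ω, ‖a ⬝ᵥ Y ω‖ ^ 2 ∂P = t * ∑ m, ‖a m‖ ^ 2 := by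
  have e : ∫ ω, (a ⬝ᵥ Y ω) * star (a ⬝ᵥ Y ω) ∂P = ∑ m, (t * ‖a m‖ ^ 2 : ℂ) := by
    simp_rw [dotProduct, star_sum, star_mul', Finset.sum_mul_sum]
    have hi : ∀ k l, Integrable (fun ω => a k * Y ω k * (star (a l) * star (Y ω l))) P := fun k l =>
      ((h.memLp k).const_mul _).integrable_mul ((h.memLp l).star.const_mul _)
    rw [integral_finsetSum _ fun k _ => integrable_finsetSum _ fun l _ => hi k l]
    refine Finset.sum_congr rfl fun k _ => ?_
    rw [integral_finsetSum _ fun l _ => hi k l]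
    simp_rw [mul_mul_mul_comm (a k) _ (star (a _)), integral_const_mul]
    rw [Finset.sum_eq_single k]
    · simp_rw [mul_star_self_eq]
      rw [integral_complex_ofReal, h.secondMoment]
      push_cast; ring
    · intro l _ hl
      rw [h.orthogonal k l hl.symm, mul_zero]
    · simp
  simp_rw [mul_star_self_eq] at e
  rw [integral_complex_ofReal, ← Finset.mul_sum] at e
  exact_mod_cast e

lemma IsWhite.integral_dotProduct {Y : Ω → Fin M → ℂ} {t : ℝ} [IsFiniteMeasure P]
    (h : IsWhite P Y t) (a : Fin M → ℂ) : ∫ ω, a ⬝ᵥ Y ω ∂P = 0 := by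
  simp_rw [dotProduct]
  rw [integral_finsetSum _ fun k _ => ((h.memLp k).integrable (by norm_num)).const_mul _]
  simp [integral_const_mul, h.integral_eq_zero]

lemma IsWhite.integrable_absSqH_add {Y : Ω → Fin M → ℂ} {t : ℝ} [IsFiniteMeasure P]
    (h : IsWhite P Y t) (a v : Fin M → ℂ) : Integrable (fun ω => absSqH a (v + Y ω)) P := by
  simp_rw [absSqH, dotProduct_add]
  have : MemLp (fun ω => star a ⬝ᵥ v + star a ⬝ᵥ Y ω) 2 P :=
    (memLp_const (star a ⬝ᵥ v)).add (h.memLp_dotProduct (star a))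
  exact this.integrable_norm_pow two_ne_zero

/-- The cross term is linear in the centered vector `Y`, so only the two squares contribute. -/
lemma IsWhite.integral_absSqH_add {Y : Ω → Fin M → ℂ} {t : ℝ} [IsProbabilityMeasure P]
    (h : IsWhite P Y t) (a v : Fin M → ℂ) :
    ∫ ω, absSqH a (v + Y ω) ∂P = absSqH a v + t * ∑ m, ‖a m‖ ^ 2 := by
  have hY := h.memLp_dotProduct (star a)
  simp_rw [absSqH, dotProduct_add]
  have e : ∀ z w : ℂ, ‖z + w‖ ^ 2 = ‖z‖ ^ 2 + (2 * star z * w).re + ‖w‖ ^ 2 := fun z w => by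
    simp only [Complex.sq_norm, Complex.normSq_apply]
    simp [Complex.mul_re]
    ring
  simp_rw [e]
  have i1 : Integrable (fun ω => 2 * star (star a ⬝ᵥ v) * star a ⬝ᵥ Y ω) P :=
    (hY.integrable (by norm_num)).const_mul _
  have i2 : Integrable (fun ω => ‖star a ⬝ᵥ Y ω‖ ^ 2) P := hY.integrable_norm_pow (by norm_num)
  have i3 : Integrable (fun ω => (2 * star (star a ⬝ᵥ v) * star a ⬝ᵥ Y ω).re) P := i1.re
  have i4 : Integrable (fun ω => ‖star a ⬝ᵥ v‖ ^ 2 +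
      (2 * star (star a ⬝ᵥ v) * star a ⬝ᵥ Y ω).re) P := (integrable_const _).add i3
  rw [integral_add i4 i2, integral_add (integrable_const _) i3,
    h.integral_norm_sq_dotProduct]
  simp_rw [← Complex.reCLM_apply]
  rw [ContinuousLinearMap.integral_comp_comm Complex.reCLM i1, integral_const_mul,
    h.integral_dotProduct]
  simp

lemma measurable_absSqH {μ : Type*} [MeasurableSpace μ] {x y : μ → Fin M → ℂ}
    (hx : ∀ m, Measurable fun ω => x ω m) (hy : ∀ m, Measurable fun ω => y ω m) :
    Measurable fun ω => absSqH (x ω) (y ω) := by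
  have hx' : ∀ m, Measurable fun ω => star (x ω m) := fun m =>
    continuous_star.measurable.comp (hx m)
  simp only [absSqH, dotProduct, Pi.star_apply]
  fun_prop

/-- Hölder with exponents 4 and 4: fourth moments of the entries make inner products square
integrable without any independence, so that the case `x = y` is covered as well. -/
lemma memLp_star_dotProduct {x y : Ω → Fin M → ℂ}
    (hx : ∀ m, MemLp (fun ω => x ω m) 4 P) (hy : ∀ m, MemLp (fun ω => y ω m) 4 P) :
    MemLp (fun ω => star (x ω) ⬝ᵥ y ω) 2 P := by
  have : ENNReal.HolderTriple 4 4 2 := ⟨by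
    rw [← two_mul, ← ENNReal.toReal_eq_toReal_iff' (by finiteness) (by simp)]
    norm_num⟩
  exact memLp_finsetSum _ fun m _ => MemLp.mul (hy m) (hx m).star

lemma integrable_absSqH {x y : Ω → Fin M → ℂ}
    (hx : ∀ m, MemLp (fun ω => x ω m) 4 P) (hy : ∀ m, MemLp (fun ω => y ω m) 4 P) :
    Integrable (fun ω => absSqH (x ω) (y ω)) P :=
  (memLp_star_dotProduct hx hy).integrable_norm_pow (by norm_num)

/-- The mean power `E|xᴴ y|²` for independent `x`, `y` when `y` is white. -/
lemma integral_absSqH_of_indepFun [IsProbabilityMeasure P] {x y : Ω → Fin M → ℂ}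
    (hxm : ∀ m, Measurable fun ω => x ω m) (hym : ∀ m, Measurable fun ω => y ω m)
    (hx : ∀ m, MemLp (fun ω => x ω m) 4 P) (hy : ∀ m, MemLp (fun ω => y ω m) 4 P)
    (hxy : IndepFun x y P) {s t : ℝ} (hs : ∀ m, ∫ ω, ‖x ω m‖ ^ 2 ∂P = s) (ht : IsWhite P y t) :
    ∫ ω, absSqH (x ω) (y ω) ∂P = M * (s * t) := by
  have hint := integrable_absSqH hx hy
  have hF : Measurable fun p : (Fin M → ℂ) × (Fin M → ℂ) => absSqH p.1 p.2 :=
    measurable_absSqH (fun m => by fun_prop) (fun m => by fun_prop)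
  rw [integral_of_indepFun (measurable_pi_lambda _ hxm) (measurable_pi_lambda _ hym) hxy hF hint]
  have : ∀ a : Fin M → ℂ, ∫ ω, absSqH a (y ω) ∂P = t * ∑ m, ‖a m‖ ^ 2 := fun a =>
    ht.integral_norm_sq_dotProduct (star a) |>.trans (by simp)
  simp_rw [this]
  rw [integral_const_mul, integral_finsetSum]
  · simp [hs]; ring
  · exact fun m _ => ((hx m).mono_exponent (by norm_num)).integrable_norm_pow (p := 2) (by norm_num)

/-- Mean square deviation of the squared norm of a vector with independent entries. -/
lemma integral_sq_sum_norm_sq_sub_le [IsProbabilityMeasure P] {x : Ω → Fin M → ℂ}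
    (hx : ∀ m, MemLp (fun ω => x ω m) 4 P)
    (hind : Pairwise fun m m' => IndepFun (fun ω => x ω m) (fun ω => x ω m') P) {s K : ℝ}
    (hs : ∀ m, ∫ ω, ‖x ω m‖ ^ 2 ∂P = s) (hK : ∀ m, ∫ ω, ‖x ω m‖ ^ 4 ∂P ≤ K) :
    MemLp (fun ω => ∑ m, ‖x ω m‖ ^ 2) 2 P ∧ ∫ ω, (∑ m, ‖x ω m‖ ^ 2 - M * s) ^ 2 ∂P ≤ M * K := by
  have h2 : ∀ m, MemLp (fun ω => ‖x ω m‖ ^ 2) 2 P := fun m => by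
    have := (hx m).norm_rpow_div 2
    refine (memLp_congr_ae (ae_of_all _ fun ω => ?_)).1
      ((hx m).norm_rpow_div 2 |> fun h => by
        rwa [show (4 : ENNReal) / 2 = 2 by
          rw [← ENNReal.toReal_eq_toReal_iff' (by finiteness) (by simp)]; norm_num] at h)
    simp
  have hsum : MemLp (fun ω => ∑ m, ‖x ω m‖ ^ 2) 2 P := memLp_finsetSum _ fun m _ => h2 m
  refine ⟨hsum, ?_⟩
  have hmean : ∫ ω, ∑ m, ‖x ω m‖ ^ 2 ∂P = M * s := by
    rw [integral_finsetSum _ fun m _ => (h2 m).integrable (by norm_num)]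
    simp [hs]
  -- Independence makes the variances add, so the squared norm deviates from its mean by order `√M`
  -- while the mean itself is of order `M`.
  have hvar : Var[∑ m, fun ω => ‖x ω m‖ ^ 2; P] = ∑ m, Var[fun ω => ‖x ω m‖ ^ 2; P] :=
    IndepFun.variance_sum (fun m _ => h2 m) fun m _ m' _ hne =>
      (hind hne).comp (φ := fun z : ℂ => ‖z‖ ^ 2) (ψ := fun z : ℂ => ‖z‖ ^ 2)
        (by fun_prop) (by fun_prop)
  have e : ∑ m, (fun ω => ‖x ω m‖ ^ 2) = fun ω => ∑ m, ‖x ω m‖ ^ 2 := by ext ω; simp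
  rw [e, variance_eq_integral hsum.aemeasurable, hmean] at hvar
  rw [hvar]
  calc ∑ m, Var[fun ω => ‖x ω m‖ ^ 2; P] ≤ ∑ m : Fin M, K := Finset.sum_le_sum fun m _ => by
        refine le_trans ?_ (hK m)
        rw [variance_eq_sub (h2 m)]
        have : (fun ω => ‖x ω m‖ ^ 2) ^ 2 = fun ω => ‖x ω m‖ ^ 4 := by
          ext ω; simp [← pow_mul]
        rw [this]
        exact sub_le_self _ (sq_nonneg _)
    _ = M * K := by simp

/-- The inequality `(E|X|)² ≤ E X²` is the nonnegativity of the variance of `|X|`. -/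
lemma integral_abs_le_sqrt [IsProbabilityMeasure P] {X : Ω → ℝ} (hX : MemLp X 2 P) {c : ℝ}
    (hc : ∫ ω, X ω ^ 2 ∂P ≤ c) : ∫ ω, |X ω| ∂P ≤ Real.sqrt c := by
  apply Real.le_sqrt_of_sq_le
  refine le_trans ?_ hc
  have := variance_nonneg (fun ω => |X ω|) P
  rw [variance_eq_sub (by simpa using hX.norm)] at this
  have e : (fun ω => |X ω|) ^ 2 = fun ω => X ω ^ 2 := by ext ω; simp
  rw [e] at this
  linarith

end Moments

/-! ### Independence, power and fluctuation of the effective gains. -/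

section EstimateModelMoments

variable {Ω : Type*} [MeasurableSpace Ω] {P : Measure Ω} {M : ℕ} {J : Type*}
  {H E : Ω → Matrix (Fin M) J ℂ} {sH sE : J → ℝ} {K : ℝ}

namespace IsEstimateModel

lemma isProbabilityMeasure (h : IsEstimateModel P H E sH sE K) : IsProbabilityMeasure P :=
  h.indep.isProbabilityMeasure

lemma measurable_entry (h : IsEstimateModel P H E sH sE K) (k : Bool × Fin M × J) :
    Measurable fun ω => bif k.1 then H ω k.2.1 k.2.2 else E ω k.2.1 k.2.2 := by
  rcases k with ⟨_ | _, m, j⟩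
  · exact h.measurable_E m j
  · exact h.measurable_H m j

lemma indepFun_pi (h : IsEstimateModel P H E sH sE K) {α β : Type*} [Fintype α] [Fintype β]
    (g : α → Bool × Fin M × J) (g' : β → Bool × Fin M × J) (hd : ∀ a b, g a ≠ g' b) :
    IndepFun (fun ω a => bif (g a).1 then H ω (g a).2.1 (g a).2.2 else E ω (g a).2.1 (g a).2.2)
      (fun ω b => bif (g' b).1 then H ω (g' b).2.1 (g' b).2.2 else E ω (g' b).2.1 (g' b).2.2) P :=
  indepFun_pi_of_iIndepFun h.indep h.measurable_entry g g' hd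

lemma indepFun_H_H (h : IsEstimateModel P H E sH sE K) {m m' : Fin M} {j j' : J}
    (hne : (m, j) ≠ (m', j')) : IndepFun (fun ω => H ω m j) (fun ω => H ω m' j') P :=
  h.indep.indepFun (i := (true, m, j)) (j := (true, m', j')) (by simpa using hne)

lemma indepFun_E_E (h : IsEstimateModel P H E sH sE K) {m m' : Fin M} {j j' : J}
    (hne : (m, j) ≠ (m', j')) : IndepFun (fun ω => E ω m j) (fun ω => E ω m' j') P :=
  h.indep.indepFun (i := (false, m, j)) (j := (false, m', j')) (by simpa using hne)

lemma indepFun_H_E (h : IsEstimateModel P H E sH sE K) (m m' : Fin M) (j j' : J) :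
    IndepFun (fun ω => H ω m j) (fun ω => E ω m' j') P :=
  h.indep.indepFun (i := (true, m, j)) (j := (false, m', j')) (by simp)

lemma indepFun_col_H_H (h : IsEstimateModel P H E sH sE K) {j j' : J} (hne : j ≠ j') :
    IndepFun (fun ω => (H ω).col j) (fun ω => (H ω).col j') P :=
  h.indepFun_pi (fun m => (true, m, j)) (fun m => (true, m, j')) (by simp [hne])

lemma indepFun_col_H_E (h : IsEstimateModel P H E sH sE K) (j j' : J) :
    IndepFun (fun ω => (H ω).col j) (fun ω => (E ω).col j') P :=
  h.indepFun_pi (fun m => (true, m, j)) (fun m => (false, m, j')) (by simp)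

lemma indepFun_col_H_add (h : IsEstimateModel P H E sH sE K) {j j' : J} (hne : j ≠ j') :
    IndepFun (fun ω => (H ω).col j) (fun ω => (H ω + E ω).col j') P :=
  (h.indepFun_pi (fun m => (true, m, j)) (fun p : Bool × Fin M => (p.1, p.2, j'))
    (by simp [hne])).comp (φ := id)
    (ψ := fun (t : Bool × Fin M → ℂ) (m : Fin M) => t (true, m) + t (false, m))
    measurable_id (measurable_pi_lambda _ fun m => by fun_prop)

lemma indepFun_add_add (h : IsEstimateModel P H E sH sE K) {m m' : Fin M} (hne : m ≠ m') (j : J) :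
    IndepFun (fun ω => (H ω + E ω) m j) (fun ω => (H ω + E ω) m' j) P :=
  (h.indepFun_pi (fun b : Bool => (b, m, j)) (fun b : Bool => (b, m', j))
    (by simp [hne])).comp (φ := fun t : Bool → ℂ => t true + t false)
    (ψ := fun t : Bool → ℂ => t true + t false)
    (by fun_prop) (by fun_prop)

lemma memLp_two_H (h : IsEstimateModel P H E sH sE K) (m : Fin M) (j : J) :
    MemLp (fun ω => H ω m j) 2 P := by
  have := h.isProbabilityMeasure
  exact (h.memLp_H m j).mono_exponent (by norm_num)

lemma memLp_two_E (h : IsEstimateModel P H E sH sE K) (m : Fin M) (j : J) :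
    MemLp (fun ω => E ω m j) 2 P := by
  have := h.isProbabilityMeasure
  exact (h.memLp_E m j).mono_exponent (by norm_num)

lemma isWhite_H (h : IsEstimateModel P H E sH sE K) (j : J) :
    IsWhite P (fun ω => (H ω).col j) (sH j) where
  memLp m := h.memLp_two_H m j
  integral_eq_zero m := h.integral_H m j
  secondMoment m := h.secondMoment_H m j
  orthogonal m m' hne := integral_mul_star_eq_zero_of_indepFun (h.measurable_H m j)
    (h.measurable_H m' j) (h.indepFun_H_H (by simpa using hne)) (h.integral_H m j)

lemma isWhite_E (h : IsEstimateModel P H E sH sE K) (j : J) :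
    IsWhite P (fun ω => (E ω).col j) (sE j) where
  memLp m := h.memLp_two_E m j
  integral_eq_zero m := h.integral_E m j
  secondMoment m := h.secondMoment_E m j
  orthogonal m m' hne := integral_mul_star_eq_zero_of_indepFun (h.measurable_E m j)
    (h.measurable_E m' j) (h.indepFun_E_E (by simpa using hne)) (h.integral_E m j)

lemma integral_H_mul_star_E (h : IsEstimateModel P H E sH sE K) (m m' : Fin M) (j j' : J) :
    ∫ ω, H ω m j * star (E ω m' j') ∂P = 0 :=
  integral_mul_star_eq_zero_of_indepFun (h.measurable_H m j) (h.measurable_E m' j')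
    (h.indepFun_H_E m m' j j') (h.integral_H m j)

/-- The channel is the sum of its estimate and its error; these are uncorrelated, so their second
moments add. -/
lemma isWhite_add (h : IsEstimateModel P H E sH sE K) (j : J) :
    IsWhite P (fun ω => (H ω + E ω).col j) (sH j + sE j) := by
  have := h.isProbabilityMeasure
  have h0 : ∀ m, ∫ ω, (H ω + E ω) m j ∂P = 0 := fun m => by
    simp_rw [Matrix.add_apply]
    rw [integral_add ((h.memLp_two_H m j).integrable (by norm_num))
      ((h.memLp_two_E m j).integrable (by norm_num)), h.integral_H, h.integral_E, add_zero]
  refine ⟨fun m => (h.memLp_two_H m j).add (h.memLp_two_E m j), h0, fun m => ?_,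
    fun m m' hne => integral_mul_star_eq_zero_of_indepFun
      ((h.measurable_H m j).add (h.measurable_E m j))
      ((h.measurable_H m' j).add (h.measurable_E m' j)) (h.indepFun_add_add hne j) (h0 m)⟩
  have e : ∀ z w : ℂ, ‖z + w‖ ^ 2 = ‖z‖ ^ 2 + (2 * (z * star w)).re + ‖w‖ ^ 2 := fun z w => by
    simp only [Complex.sq_norm, Complex.normSq_apply]
    simp [Complex.mul_re]
    ring
  simp_rw [Matrix.col_apply, Matrix.add_apply, e]
  have i1 : Integrable (fun ω => 2 * (H ω m j * star (E ω m j))) P :=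
    ((h.memLp_two_H m j).integrable_mul (h.memLp_two_E m j).star).const_mul 2
  have i2 := (h.memLp_two_H m j).integrable_norm_pow two_ne_zero
  have i3 := (h.memLp_two_E m j).integrable_norm_pow two_ne_zero
  have i4 : Integrable (fun ω => (2 * (H ω m j * star (E ω m j))).re) P := i1.re
  have i5 : Integrable (fun ω => ‖H ω m j‖ ^ 2 + (2 * (H ω m j * star (E ω m j))).re) P :=
    i2.add i4
  rw [integral_add i5 i3, integral_add i2 i4]
  simp_rw [← Complex.reCLM_apply]
  rw [ContinuousLinearMap.integral_comp_comm Complex.reCLM i1, integral_const_mul,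
    h.integral_H_mul_star_E, h.secondMoment_H, h.secondMoment_E]
  simp

lemma memLp_add (h : IsEstimateModel P H E sH sE K) (m : Fin M) (j : J) :
    MemLp (fun ω => (H ω + E ω) m j) 4 P := (h.memLp_H m j).add (h.memLp_E m j)

lemma measurable_add (h : IsEstimateModel P H E sH sE K) (m : Fin M) (j : J) :
    Measurable (fun ω => (H ω + E ω) m j) := (h.measurable_H m j).add (h.measurable_E m j)

lemma integral_absSqH_H_H (h : IsEstimateModel P H E sH sE K) {j j' : J} (hne : j ≠ j') :
    ∫ ω, absSqH ((H ω).col j) ((H ω).col j') ∂P = M * (sH j * sH j') := by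
  have := h.isProbabilityMeasure
  exact integral_absSqH_of_indepFun (fun m => h.measurable_H m j) (fun m => h.measurable_H m j')
    (fun m => h.memLp_H m j) (fun m => h.memLp_H m j') (h.indepFun_col_H_H hne)
    (fun m => h.secondMoment_H m j) (h.isWhite_H j')

lemma integral_absSqH_H_E (h : IsEstimateModel P H E sH sE K) (j j' : J) :
    ∫ ω, absSqH ((H ω).col j) ((E ω).col j') ∂P = M * (sH j * sE j') := by
  have := h.isProbabilityMeasure
  exact integral_absSqH_of_indepFun (fun m => h.measurable_H m j) (fun m => h.measurable_E m j')
    (fun m => h.memLp_H m j) (fun m => h.memLp_E m j') (h.indepFun_col_H_E j j')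
    (fun m => h.secondMoment_H m j) (h.isWhite_E j')

lemma integral_absSqH_H_add (h : IsEstimateModel P H E sH sE K) {j j' : J} (hne : j ≠ j') :
    ∫ ω, absSqH ((H ω).col j) ((H ω + E ω).col j') ∂P = M * (sH j * (sH j' + sE j')) := by
  have := h.isProbabilityMeasure
  exact integral_absSqH_of_indepFun (fun m => h.measurable_H m j) (fun m => h.measurable_add m j')
    (fun m => h.memLp_H m j) (fun m => h.memLp_add m j') (h.indepFun_col_H_add hne)
    (fun m => h.secondMoment_H m j) (h.isWhite_add j')

lemma integral_sum_norm_sq (h : IsEstimateModel P H E sH sE K) (j : J) :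
    ∫ ω, ∑ m, ‖H ω m j‖ ^ 2 ∂P = M * sH j := by
  rw [integral_finsetSum _ fun m _ => (h.memLp_two_H m j).integrable_norm_pow two_ne_zero]
  simp [h.secondMoment_H]

lemma memLp_sum_norm_sq (h : IsEstimateModel P H E sH sE K) (j : J) :
    MemLp (fun ω => ∑ m, ‖H ω m j‖ ^ 2) 2 P := by
  have := h.isProbabilityMeasure
  exact (integral_sq_sum_norm_sq_sub_le (x := fun ω => (H ω).col j) (fun m => h.memLp_H m j)
    (fun m m' hne => h.indepFun_H_H (by simpa using hne)) (fun m => h.secondMoment_H m j)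
    (fun m => h.fourthMoment_H m j)).1

lemma integral_sq_sum_norm_sq_sub_le (h : IsEstimateModel P H E sH sE K) (j : J) :
    ∫ ω, (∑ m, ‖H ω m j‖ ^ 2 - M * sH j) ^ 2 ∂P ≤ M * K := by
  have := h.isProbabilityMeasure
  exact (TwoWayRelay.integral_sq_sum_norm_sq_sub_le (x := fun ω => (H ω).col j)
    (fun m => h.memLp_H m j) (fun m m' hne => h.indepFun_H_H (by simpa using hne))
    (fun m => h.secondMoment_H m j) (fun m => h.fourthMoment_H m j)).2

lemma integral_abs_sum_norm_sq_sub_le (h : IsEstimateModel P H E sH sE K) (j : J) :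
    ∫ ω, |∑ m, ‖H ω m j‖ ^ 2 - M * sH j| ∂P ≤ Real.sqrt (M * K) := by
  have := h.isProbabilityMeasure
  exact integral_abs_le_sqrt ((h.memLp_sum_norm_sq j).sub (memLp_const _))
    (h.integral_sq_sum_norm_sq_sub_le j)

lemma star_dotProduct_self (x : Fin M → ℂ) : star x ⬝ᵥ x = ((∑ m, ‖x m‖ ^ 2 : ℝ) : ℂ) := by
  simp only [dotProduct, Pi.star_apply, Complex.ofReal_sum]
  refine Finset.sum_congr rfl fun m _ => ?_
  rw [mul_comm, mul_star_self_eq]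

/-- The mean effective gain of a channel column combined with its own estimate. -/
lemma integral_star_dotProduct_add (h : IsEstimateModel P H E sH sE K) (j : J) :
    ∫ ω, star ((H ω).col j) ⬝ᵥ (H ω + E ω).col j ∂P = (M * sH j : ℝ) := by
  have := h.isProbabilityMeasure
  have e : ∀ ω, star ((H ω).col j) ⬝ᵥ (H ω + E ω).col j =
      ((∑ m, ‖H ω m j‖ ^ 2 : ℝ) : ℂ) + ∑ m, star (H ω m j * star (E ω m j)) := fun ω => by
    have e1 : (H ω + E ω).col j = (H ω).col j + (E ω).col j := rfl
    rw [e1, dotProduct_add, star_dotProduct_self]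
    simp [dotProduct]
  have i : ∀ m, Integrable (fun ω => star (H ω m j * star (E ω m j))) P := fun m =>
    (memLp_one_iff_integrable.1 (memLp_one_iff_integrable.2
      ((h.memLp_two_H m j).integrable_mul (h.memLp_two_E m j).star)).star)
  simp_rw [e]
  have i1 : Integrable (fun ω => ((∑ m, ‖H ω m j‖ ^ 2 : ℝ) : ℂ)) P :=
    ((h.memLp_sum_norm_sq j).integrable (by norm_num)).ofReal
  have i2 : Integrable (fun ω => ∑ m, star (H ω m j * star (E ω m j))) P :=
    integrable_finsetSum _ fun m _ => i m
  rw [integral_add i1 i2, integral_complex_ofReal, h.integral_sum_norm_sq,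
    integral_finsetSum _ fun m _ => i m]
  have : ∀ m, ∫ ω, star (H ω m j * star (E ω m j)) ∂P = 0 := fun m => by
    have := integral_conj (μ := P) (f := fun ω => H ω m j * star (E ω m j))
    rw [h.integral_H_mul_star_E] at this
    simpa using this
  rw [Finset.sum_eq_zero fun m _ => this m, add_zero]

/-- The gain is the squared norm of the estimate plus the inner product of estimate and error. The
first part fluctuates with variance at most `M K` and the second has power `M sH sE`, so the
variance is of order `M` against a squared mean of order `M²`. -/
lemma complexVar_star_dotProduct_add_le (h : IsEstimateModel P H E sH sE K) (j : J) :
    complexVar P (fun ω => star ((H ω).col j) ⬝ᵥ (H ω + E ω).col j) ≤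
      M * (2 * K + 2 * (sH j * sE j)) := by
  have := h.isProbabilityMeasure
  rw [complexVar, h.integral_star_dotProduct_add]
  have e : ∀ ω, ‖star ((H ω).col j) ⬝ᵥ (H ω + E ω).col j - (M * sH j : ℝ)‖ ^ 2 ≤
      2 * (∑ m, ‖H ω m j‖ ^ 2 - M * sH j) ^ 2 + 2 * absSqH ((H ω).col j) ((E ω).col j) := by
    intro ω
    have e1 : (H ω + E ω).col j = (H ω).col j + (E ω).col j := rfl
    rw [e1, dotProduct_add, star_dotProduct_self, absSqH]
    have := norm_add_le (((∑ m, ‖H ω m j‖ ^ 2 - M * sH j : ℝ) : ℂ))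
      (star ((H ω).col j) ⬝ᵥ (E ω).col j)
    rw [Complex.norm_real, Real.norm_eq_abs] at this
    have e2 : ((∑ m, ‖(H ω).col j m‖ ^ 2 : ℝ) : ℂ) + star ((H ω).col j) ⬝ᵥ (E ω).col j -
        (M * sH j : ℝ) = ((∑ m, ‖H ω m j‖ ^ 2 - M * sH j : ℝ) : ℂ) +
        star ((H ω).col j) ⬝ᵥ (E ω).col j := by
      simp; ring
    rw [e2]
    refine (pow_le_pow_left₀ (norm_nonneg _) this 2).trans ?_
    rw [← sq_abs (∑ m, ‖H ω m j‖ ^ 2 - M * sH j)]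
    nlinarith [sq_nonneg (|∑ m, ‖H ω m j‖ ^ 2 - M * sH j| -
      ‖star ((H ω).col j) ⬝ᵥ (E ω).col j‖)]
  have i1 : Integrable (fun ω => 2 * (∑ m, ‖H ω m j‖ ^ 2 - M * sH j) ^ 2) P :=
    (((h.memLp_sum_norm_sq j).sub (memLp_const _)).integrable_sq).const_mul 2
  have i2 : Integrable (fun ω => 2 * absSqH ((H ω).col j) ((E ω).col j)) P :=
    (integrable_absSqH (fun m => h.memLp_H m j) (fun m => h.memLp_E m j)).const_mul 2
  refine (integral_mono_of_nonneg (ae_of_all _ fun ω => by positivity) (i1.add i2)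
    (ae_of_all _ e)).trans ?_
  simp only [Pi.add_apply]
  rw [integral_add i1 i2, integral_const_mul, integral_const_mul, h.integral_absSqH_H_E]
  nlinarith [h.integral_sq_sum_norm_sq_sub_le j]

/-- Different columns are independent and centered, so the gain has mean zero and its variance is
its power. -/
lemma complexVar_star_dotProduct_add_le_of_ne (h : IsEstimateModel P H E sH sE K) {j j' : J}
    (hne : j ≠ j') : complexVar P (fun ω => star ((H ω).col j) ⬝ᵥ (H ω + E ω).col j') ≤
      M * (sH j * (sH j' + sE j')) := by
  have := h.isProbabilityMeasure
  rw [← h.integral_absSqH_H_add hne, complexVar]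
  have hm : MemLp (fun ω => star ((H ω).col j) ⬝ᵥ (H ω + E ω).col j') 2 P :=
    memLp_star_dotProduct (fun m => h.memLp_H m j) (fun m => h.memLp_add m j')
  have hzero : ∫ ω, star ((H ω).col j) ⬝ᵥ (H ω + E ω).col j' ∂P = 0 := by
    simp_rw [dotProduct]
    rw [integral_finsetSum]
    · refine Finset.sum_eq_zero fun m _ => ?_
      have hi : IndepFun (fun ω => (H ω + E ω) m j') (fun ω => H ω m j) P :=
        ((h.indepFun_col_H_add hne).comp (measurable_pi_apply m) (measurable_pi_apply m)).symm
      have := integral_mul_star_eq_zero_of_indepFun (h.measurable_add m j') (h.measurable_H m j) hi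
        ((h.isWhite_add j').integral_eq_zero m)
      rw [← this]
      exact integral_congr_ae (ae_of_all _ fun ω => mul_comm _ _)
    · exact fun m _ => (h.memLp_two_H m j).star.integrable_mul
        ((h.memLp_two_H m j').add (h.memLp_two_E m j'))
  rw [hzero]
  simp [absSqH]

end IsEstimateModel

end EstimateModelMoments

/-! ### The broadcast rate in closed form up to a bounded constant. -/

section Broadcast

variable {Ω : Type*} [MeasurableSpace Ω] {P : Measure Ω} {M N : ℕ} {J : Type*}
  {H E : Ω → Matrix (Fin M) J ℂ} {sH sE : J → ℝ} {K : ℝ}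

omit [MeasurableSpace Ω] in
lemma gain_eq (G H : Ω → Matrix (Fin M) (Fin N) ℂ) (i j : Fin N) :
    gain G H i j = fun ω => star ((H ω).col j) ⬝ᵥ (G ω).col i :=
  funext fun _ => dotProduct_comm _ _

lemma complexVar_nonneg (Z : Ω → ℂ) : 0 ≤ complexVar P Z :=
  integral_nonneg fun _ => by positivity

/-- An upper bound, per antenna, for the power of the beamforming uncertainty and of the
inter-user interference in the broadcast phase. -/
def broadcastBound (sX sY eX : Fin N → ℝ) (K : ℝ) (i : Fin N) : ℝ :=
  2 * K + 2 * (sX i * eX i) + sY i * (sX i + eX i) +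
    ∑ j ∈ Finset.univ.erase i, (sY j * (sX i + eX i) + sX j * (sX i + eX i))

/-- The mean gain and the normalization are computed exactly; gain variances and interference are
gathered into `M κ`, of which only a bound independent of `M` matters. The maps `x` and `y` select
the columns of the two sides, so that one statement serves both users of a pair. -/
lemma IsEstimateModel.broadcastRate_eq (h : IsEstimateModel P H E sH sE K) {x y : Fin N → J}
    (hx : Function.Injective x) (hxy : ∀ n n', x n ≠ y n')
    {GX HX HY : Ω → Matrix (Fin M) (Fin N) ℂ}
    (hGX : ∀ ω m n, GX ω m n = (H ω + E ω) m (x n)) (hHX : ∀ ω m n, HX ω m n = H ω m (x n))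
    (hHY : ∀ ω m n, HY ω m n = H ω m (y n)) (hM : 0 < M) {pr : ℝ} (hpr : 0 < pr) (i : Fin N) :
    ∃ κ, 0 ≤ κ ∧ κ ≤ broadcastBound (sH ∘ x) (sH ∘ y) (sE ∘ x) K i ∧
      broadcastRate P pr GX HX HY i = 1 / 2 * Real.logb 2 (1 + (M * sH (x i)) ^ 2 /
        (M * κ + M * (∑ n, (sH (x n) + sH (y n))) / pr)) := by
  have hMr : (0 : ℝ) < M := by exact_mod_cast hM
  have hcX : ∀ j, gain GX HX i j = fun ω =>
      star ((H ω).col (x j)) ⬝ᵥ (H ω + E ω).col (x i) := fun j => by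
    rw [gain_eq]
    funext ω
    congr 1
    · ext m; simp [hHX]
    · ext m; simpa using hGX ω m i
  have hcY : ∀ j, gain GX HY i j = fun ω =>
      star ((H ω).col (y j)) ⬝ᵥ (H ω + E ω).col (x i) := fun j => by
    rw [gain_eq]
    funext ω
    congr 1
    · ext m; simp [hHY]
    · ext m; simpa using hGX ω m i
  have hsX : ∀ j, j ≠ i → ∫ ω, ‖gain GX HX i j ω‖ ^ 2 ∂P =
      M * (sH (x j) * (sH (x i) + sE (x i))) := fun j hj => by
    rw [hcX]
    exact h.integral_absSqH_H_add (hx.ne hj)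
  have hsY : ∀ j, ∫ ω, ‖gain GX HY i j ω‖ ^ 2 ∂P =
      M * (sH (y j) * (sH (x i) + sE (x i))) := fun j => by
    rw [hcY]
    exact h.integral_absSqH_H_add (hxy i j).symm
  set V := complexVar P (gain GX HX i i) + complexVar P (gain GX HY i i) +
    ∑ j ∈ Finset.univ.erase i,
      ((∫ ω, ‖gain GX HY i j ω‖ ^ 2 ∂P) + ∫ ω, ‖gain GX HX i j ω‖ ^ 2 ∂P) with hV
  have hV0 : 0 ≤ V := by
    refine add_nonneg (add_nonneg (complexVar_nonneg _) (complexVar_nonneg _))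
      (Finset.sum_nonneg fun j _ => add_nonneg ?_ ?_) <;>
    exact integral_nonneg fun _ => by positivity
  have hVle : V ≤ M * broadcastBound (sH ∘ x) (sH ∘ y) (sE ∘ x) K i := by
    rw [hV, broadcastBound, mul_add, mul_add, Finset.mul_sum]
    refine add_le_add (add_le_add ?_ ?_) (Finset.sum_le_sum fun j hj => ?_)
    · rw [hcX]; exact h.complexVar_star_dotProduct_add_le (x i)
    · rw [hcY]; exact h.complexVar_star_dotProduct_add_le_of_ne (hxy i i).symm
    · rw [hsX j (Finset.ne_of_mem_erase hj), hsY j, ← mul_add]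
      rfl
  have hnorm : ∫ ω, (∑ m, ∑ n, (‖HY ω m n‖ ^ 2 + ‖HX ω m n‖ ^ 2)) ∂P =
      M * ∑ n, (sH (x n) + sH (y n)) := by
    simp_rw [hHX, hHY]
    have hi : ∀ (m : Fin M) j, Integrable (fun ω => ‖H ω m j‖ ^ 2) P := fun m j =>
      (h.memLp_two_H m j).integrable_norm_pow two_ne_zero
    have hi2 : ∀ (m : Fin M) n, Integrable (fun ω => ‖H ω m (y n)‖ ^ 2 + ‖H ω m (x n)‖ ^ 2) P :=
      fun m n => (hi m _).add (hi m _)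
    rw [integral_finsetSum _ fun m _ => integrable_finsetSum _ fun n _ => hi2 m n]
    simp_rw [integral_finsetSum _ fun n _ => hi2 _ n]
    have : ∀ (m : Fin M) n, ∫ ω, (‖H ω m (y n)‖ ^ 2 + ‖H ω m (x n)‖ ^ 2) ∂P =
        sH (x n) + sH (y n) := fun m n => by
      rw [integral_add (hi m _) (hi m _), h.secondMoment_H, h.secondMoment_H, add_comm]
    simp [this]
  have hrho : 1 / rho P pr HX HY ^ 2 = M * (∑ n, (sH (x n) + sH (y n))) / pr := by
    rw [rho, Real.sq_sqrt, hnorm, one_div_div]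
    exact div_nonneg hpr.le (integral_nonneg fun ω => by positivity)
  have hmean : ‖∫ ω, gain GX HX i i ω ∂P‖ ^ 2 = (M * sH (x i)) ^ 2 := by
    rw [hcX, h.integral_star_dotProduct_add, Complex.norm_real, Real.norm_eq_abs, sq_abs]
  refine ⟨V / M, div_nonneg hV0 hMr.le, ?_, ?_⟩
  · rw [div_le_iff₀ hMr, mul_comm]; exact hVle
  · rw [broadcastRate, hmean, hrho, mul_div_cancel₀ _ hMr.ne']

end Broadcast

/-! ### The impairment power conditioned on the channel estimates. -/

section ConditionalImpairment

variable {Ω : Type*} [MeasurableSpace Ω] {P : Measure Ω} {M N : ℕ}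

/-- Mutual interference of the estimated channels of pair `i` with those of the other pairs. -/
def estimateInterference (HA HB : Matrix (Fin M) (Fin N) ℂ) (i : Fin N) : ℝ :=
  ∑ j ∈ Finset.univ.erase i,
    ((absSqH (HA.col i) (HA.col j) + absSqH (HB.col i) (HA.col j)) +
      (absSqH (HA.col i) (HB.col j) + absSqH (HB.col i) (HB.col j)))

lemma IsWhite.integrable_and_integral_absSqH_add_absSqH [IsProbabilityMeasure P]
    {Y : Ω → Fin M → ℂ} {t : ℝ} (h : IsWhite P Y t) (a b v : Fin M → ℂ) :
    Integrable (fun ω => absSqH a (v + Y ω) + absSqH b (v + Y ω)) P ∧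
      ∫ ω, (absSqH a (v + Y ω) + absSqH b (v + Y ω)) ∂P =
        absSqH a v + absSqH b v + t * (∑ m, ‖a m‖ ^ 2 + ∑ m, ‖b m‖ ^ 2) := by
  have ia := h.integrable_absSqH_add a v
  have ib := h.integrable_absSqH_add b v
  refine ⟨ia.add ib, ?_⟩
  rw [integral_add ia ib, h.integral_absSqH_add, h.integral_absSqH_add]
  ring

/-- Averaging the impairment over white estimation errors. -/
lemma integral_powerImpairment_add [IsProbabilityMeasure P] {EA EB : Ω → Matrix (Fin M) (Fin N) ℂ}
    {eA eB : Fin N → ℝ} (hA : ∀ j, IsWhite P (fun ω => (EA ω).col j) (eA j))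
    (hB : ∀ j, IsWhite P (fun ω => (EB ω).col j) (eB j)) (p : ℝ)
    (HA HB : Matrix (Fin M) (Fin N) ℂ) (i : Fin N) :
    ∫ ω, powerImpairment (fun _ => p) (fun _ => p) (HA + EA ω) (HB + EB ω) HA HB i ∂P =
      (1 + p * ∑ j, (eA j + eB j)) * powerNoise HA HB i + p * estimateInterference HA HB i := by
  let q : (Fin M → ℂ) → ℝ := fun v => absSqH (HA.col i) v + absSqH (HB.col i) v
  have hn : ∑ m, ‖HA.col i m‖ ^ 2 + ∑ m, ‖HB.col i m‖ ^ 2 = powerNoise HA HB i := rfl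
  have hqA : ∀ j v, Integrable (fun ω => q (v + (EA ω).col j)) P ∧
      ∫ ω, q (v + (EA ω).col j) ∂P = q v + eA j * powerNoise HA HB i := fun j v => by
    have := (hA j).integrable_and_integral_absSqH_add_absSqH (HA.col i) (HB.col i) v
    rwa [hn] at this
  have hqB : ∀ j v, Integrable (fun ω => q (v + (EB ω).col j)) P ∧
      ∫ ω, q (v + (EB ω).col j) ∂P = q v + eB j * powerNoise HA HB i := fun j v => by
    have := (hB j).integrable_and_integral_absSqH_add_absSqH (HA.col i) (HB.col i) v
    rwa [hn] at this
  have hq0 : q 0 = 0 := by simp [q, absSqH]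
  -- For the pair `i` only the error enters, so the mean part of the vector is `0`; for the other
  -- pairs the mean part is their estimated channel.
  have e : ∀ ω, powerImpairment (fun _ => p) (fun _ => p) (HA + EA ω) (HB + EB ω) HA HB i =
      (p * q (0 + (EA ω).col i) + p * q (0 + (EB ω).col i) +
        ∑ j ∈ Finset.univ.erase i,
          (p * q (HA.col j + (EA ω).col j) + p * q (HB.col j + (EB ω).col j))) +
      powerNoise HA HB i := fun ω => by
    rw [powerImpairment, powerError, powerInterference, zero_add, zero_add, add_sub_cancel_left,
      add_sub_cancel_left]
    rfl
  simp_rw [e]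
  have i1 : Integrable (fun ω => p * q (0 + (EA ω).col i)) P := (hqA i 0).1.const_mul p
  have i2 : Integrable (fun ω => p * q (0 + (EB ω).col i)) P := (hqB i 0).1.const_mul p
  have i12 : Integrable (fun ω => p * q (0 + (EA ω).col i) + p * q (0 + (EB ω).col i)) P :=
    i1.add i2
  have i3 : ∀ j, Integrable (fun ω => p * q (HA.col j + (EA ω).col j)) P := fun j =>
    (hqA j _).1.const_mul p
  have i4 : ∀ j, Integrable (fun ω => p * q (HB.col j + (EB ω).col j)) P := fun j =>
    (hqB j _).1.const_mul p
  have i34 : ∀ j, Integrable (fun ω => p * q (HA.col j + (EA ω).col j) +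
    p * q (HB.col j + (EB ω).col j)) P := fun j => (i3 j).add (i4 j)
  have i5 : Integrable (fun ω => ∑ j ∈ Finset.univ.erase i,
          (p * q (HA.col j + (EA ω).col j) + p * q (HB.col j + (EB ω).col j))) P :=
    integrable_finsetSum _ fun j _ => i34 j
  have i6 : Integrable (fun ω => p * q (0 + (EA ω).col i) + p * q (0 + (EB ω).col i) +
        ∑ j ∈ Finset.univ.erase i,
          (p * q (HA.col j + (EA ω).col j) + p * q (HB.col j + (EB ω).col j))) P := i12.add i5
  rw [integral_add i6 (integrable_const _), integral_add i12 i5, integral_add i1 i2,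
    integral_finsetSum _ fun j _ => i34 j]
  simp_rw [integral_add (i3 _) (i4 _), integral_const_mul, (hqA _ _).2, (hqB _ _).2]
  -- The term `j = i` of the total error variance comes from the own estimation errors, the others
  -- from the errors inside the interfering channels.
  rw [hq0, ← Finset.add_sum_erase _ _ (Finset.mem_univ i), estimateInterference]
  have e2 : ∑ j ∈ Finset.univ.erase i, (p * (q (HA.col j) + eA j * powerNoise HA HB i) +
      p * (q (HB.col j) + eB j * powerNoise HA HB i)) =
      p * (∑ j ∈ Finset.univ.erase i, (q (HA.col j) + q (HB.col j))) +
      p * (∑ j ∈ Finset.univ.erase i, (eA j + eB j)) * powerNoise HA HB i := by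
    rw [Finset.mul_sum, Finset.mul_sum, Finset.sum_mul, ← Finset.sum_add_distrib]
    exact Finset.sum_congr rfl fun j _ => by ring
  rw [e2]
  simp only [q, integral_const, probReal_univ, one_smul]
  ring

lemma integrable_powerImpairment {GA GB HA HB : Ω → Matrix (Fin M) (Fin N) ℂ}
    (hGA : ∀ m n, MemLp (fun ω => GA ω m n) 4 P) (hGB : ∀ m n, MemLp (fun ω => GB ω m n) 4 P)
    (hHA : ∀ m n, MemLp (fun ω => HA ω m n) 4 P) (hHB : ∀ m n, MemLp (fun ω => HB ω m n) 4 P)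
    [IsFiniteMeasure P] (pA pB : Fin N → ℝ) (i : Fin N) :
    Integrable (fun ω => powerImpairment pA pB (GA ω) (GB ω) (HA ω) (HB ω) i) P := by
  have hq : ∀ (j : Fin N) {x : Ω → Fin M → ℂ} (_ : ∀ m, MemLp (fun ω => x ω m) 4 P) (p : ℝ),
      Integrable (fun ω => p * (absSqH ((HA ω).col i) (x ω) + absSqH ((HB ω).col i) (x ω))) P :=
    fun j x hx p => ((integrable_absSqH (fun m => hHA m i) hx).add
      (integrable_absSqH (fun m => hHB m i) hx)).const_mul p
  have hs : ∀ {H : Ω → Matrix (Fin M) (Fin N) ℂ} (_ : ∀ m n, MemLp (fun ω => H ω m n) 4 P),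
      Integrable (fun ω => ∑ m, ‖H ω m i‖ ^ 2) P := fun hH => integrable_finsetSum _ fun m _ =>
    ((hH m i).mono_exponent (p := 2) (by norm_num)).integrable_norm_pow two_ne_zero
  simp only [powerImpairment, powerError, powerInterference, powerNoise]
  refine Integrable.add (Integrable.add (Integrable.add ?_ ?_) ?_) (Integrable.add ?_ ?_)
  · exact hq i (fun m => (hGA m i).sub (hHA m i)) _
  · exact hq i (fun m => (hGB m i).sub (hHB m i)) _
  · exact integrable_finsetSum _ fun j _ => (hq j (fun m => hGA m j) _).add
      (hq j (fun m => hGB m j) _)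
  · exact hs hHA
  · exact hs hHB

lemma measurable_powerImpairment {μ : Type*} [MeasurableSpace μ]
    {GA GB HA HB : μ → Matrix (Fin M) (Fin N) ℂ}
    (hGA : ∀ m n, Measurable (fun ω => GA ω m n)) (hGB : ∀ m n, Measurable (fun ω => GB ω m n))
    (hHA : ∀ m n, Measurable (fun ω => HA ω m n)) (hHB : ∀ m n, Measurable (fun ω => HB ω m n))
    (pA pB : Fin N → ℝ) (i : Fin N) :
    Measurable (fun ω => powerImpairment pA pB (GA ω) (GB ω) (HA ω) (HB ω) i) := by
  have hq : ∀ {x : μ → Fin M → ℂ} (_ : ∀ m, Measurable (fun ω => x ω m)) (p : ℝ),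
      Measurable (fun ω => p * (absSqH ((HA ω).col i) (x ω) + absSqH ((HB ω).col i) (x ω))) :=
    fun hx p => ((measurable_absSqH (fun m => hHA m i) hx).add
      (measurable_absSqH (fun m => hHB m i) hx)).const_mul p
  have hs : ∀ {H : μ → Matrix (Fin M) (Fin N) ℂ} (_ : ∀ m n, Measurable (fun ω => H ω m n)),
      Measurable (fun ω => ∑ m, ‖H ω m i‖ ^ 2) := fun hH =>
    Finset.measurable_sum _ fun m _ => (hH m i).norm.pow_const 2
  simp only [powerImpairment, powerError, powerInterference, powerNoise]
  refine Measurable.add (Measurable.add (Measurable.add ?_ ?_) ?_) (Measurable.add ?_ ?_)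
  · exact hq (fun m => (hGA m i).sub (hHA m i)) _
  · exact hq (fun m => (hGB m i).sub (hHB m i)) _
  · exact Finset.measurable_sum _ fun j _ => (hq (fun m => hGA m j) _).add
      (hq (fun m => hGB m j) _)
  · exact hs hHA
  · exact hs hHB

/-- The impairment power given the channel estimates. -/
theorem IsEstimateModel.condExp_powerImpairment {GA GB HA HB : Ω → Matrix (Fin M) (Fin N) ℂ}
    {sH : Fin N ⊕ Fin N → ℝ} {eA eB : Fin N → ℝ} {K : ℝ}
    (h : IsEstimateModel P (fun ω => Matrix.fromCols (HA ω) (HB ω))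
      (fun ω => Matrix.fromCols (GA ω) (GB ω) - Matrix.fromCols (HA ω) (HB ω))
      sH (Sum.elim eA eB) K) (p : ℝ) (i : Fin N) :
    P[fun ω => powerImpairment (fun _ => p) (fun _ => p) (GA ω) (GB ω) (HA ω) (HB ω) i |
        estimateSigma HA HB] =ᵐ[P]
      fun ω => (1 + p * ∑ j, (eA j + eB j)) * powerNoise (HA ω) (HB ω) i +
        p * estimateInterference (HA ω) (HB ω) i := by
  have := h.isProbabilityMeasure
  have hHAm : ∀ m n, Measurable fun ω => HA ω m n := fun m n => h.measurable_H m (Sum.inl n)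
  have hHBm : ∀ m n, Measurable fun ω => HB ω m n := fun m n => h.measurable_H m (Sum.inr n)
  have hHA4 : ∀ m n, MemLp (fun ω => HA ω m n) 4 P := fun m n => h.memLp_H m (Sum.inl n)
  have hHB4 : ∀ m n, MemLp (fun ω => HB ω m n) 4 P := fun m n => h.memLp_H m (Sum.inr n)
  have hGA4 : ∀ m n, MemLp (fun ω => GA ω m n) 4 P := fun m n => by
    have := h.memLp_add m (Sum.inl n)
    simpa using this
  have hGB4 : ∀ m n, MemLp (fun ω => GB ω m n) 4 P := fun m n => by
    have := h.memLp_add m (Sum.inr n)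
    simpa using this
  -- `X` collects the estimates and generates `estimateSigma`; `Y` collects the errors, independent
  -- of `X`. Writing the impairment as `F (X, Y)` reduces conditioning to integration over `Y` with
  -- the estimates fixed.
  let X : Ω → (Fin M → Fin N → ℂ) × (Fin M → Fin N → ℂ) := fun ω =>
    (fun m n => HA ω m n, fun m n => HB ω m n)
  let Y : Ω → Fin M × (Fin N ⊕ Fin N) → ℂ := fun ω k =>
    (Matrix.fromCols (GA ω) (GB ω) - Matrix.fromCols (HA ω) (HB ω)) k.1 k.2
  let EA : (Fin M × (Fin N ⊕ Fin N) → ℂ) → Matrix (Fin M) (Fin N) ℂ := fun y =>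
    Matrix.of fun m n => y (m, Sum.inl n)
  let EB : (Fin M × (Fin N ⊕ Fin N) → ℂ) → Matrix (Fin M) (Fin N) ℂ := fun y =>
    Matrix.of fun m n => y (m, Sum.inr n)
  have hX : Measurable X := (measurable_pi_lambda _ fun m => measurable_pi_lambda _ fun n =>
    hHAm m n).prodMk (measurable_pi_lambda _ fun m => measurable_pi_lambda _ fun n => hHBm m n)
  have hY : Measurable Y := measurable_pi_lambda _ fun k => h.measurable_E k.1 k.2
  have hXY : IndepFun X Y P := by
    have := h.indepFun_pi (fun k : Fin M × (Fin N ⊕ Fin N) => (true, k))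
      (fun k : Fin M × (Fin N ⊕ Fin N) => (false, k)) (by simp)
    exact this.comp (φ := fun t : Fin M × (Fin N ⊕ Fin N) → ℂ =>
      ((fun m n => t (m, Sum.inl n), fun m n => t (m, Sum.inr n)) :
        (Fin M → Fin N → ℂ) × (Fin M → Fin N → ℂ))) (ψ := id) (by fun_prop) measurable_id
  let F : ((Fin M → Fin N → ℂ) × (Fin M → Fin N → ℂ)) × (Fin M × (Fin N ⊕ Fin N) → ℂ) → ℝ :=
    fun z => powerImpairment (fun _ => p) (fun _ => p) (Matrix.of z.1.1 + EA z.2)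
      (Matrix.of z.1.2 + EB z.2) (Matrix.of z.1.1) (Matrix.of z.1.2) i
  have hF : Measurable F := by
    refine measurable_powerImpairment (fun m n => ?_) (fun m n => ?_) (fun m n => ?_)
      (fun m n => ?_) _ _ i <;>
    simp only [Matrix.add_apply, Matrix.of_apply, EA, EB] <;> fun_prop
  have hFe : ∀ ω, F (X ω, Y ω) =
      powerImpairment (fun _ => p) (fun _ => p) (GA ω) (GB ω) (HA ω) (HB ω) i := fun ω => by
    have e1 : Matrix.of (X ω).1 + EA (Y ω) = GA ω := by
      ext m n
      simp [X, Y, EA]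
    have e2 : Matrix.of (X ω).2 + EB (Y ω) = GB ω := by
      ext m n
      simp [X, Y, EB]
    simp only [F, e1, e2]
    rfl
  have hint : Integrable (fun ω => F (X ω, Y ω)) P := by
    simp_rw [hFe]
    exact integrable_powerImpairment hGA4 hGB4 hHA4 hHB4 _ _ i
  have hc := condExp_of_indepFun hX hY hXY hF hint
  simp_rw [hFe] at hc
  refine hc.trans (ae_of_all _ fun ω => ?_)
  exact integral_powerImpairment_add (EA := fun ω => EA (Y ω)) (EB := fun ω => EB (Y ω))
    (fun j => h.isWhite_E (Sum.inl j)) (fun j => h.isWhite_E (Sum.inr j)) p (HA ω) (HB ω) i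

end ConditionalImpairment

/-! ### Deterministic stability and lower bounds for the logarithmic rate. -/

section Deterministic

/-- The normalized signal-to-impairment ratio of the first phase, as a function of the squared
norms `a`, `b` of the two estimated channels, of their squared inner product `x`, of the
inter-user interference `t` and of the relative power `d` of the estimation errors. -/
def ratio (u v a b x t d : ℝ) : ℝ := (u * (a ^ 2 + x) + v * (b ^ 2 + x)) / ((1 + d) * (a + b) + t)

lemma ratio_nonneg {u v a b x t d : ℝ} (hu : 0 ≤ u) (hv : 0 ≤ v) (ha : 0 ≤ a) (hb : 0 ≤ b)
    (hx : 0 ≤ x) (ht : 0 ≤ t) (hd : 0 ≤ d) : 0 ≤ ratio u v a b x t d := by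
  unfold ratio; positivity

/-- The Cauchy–Schwarz constraint `x ≤ a * b` gives `a² + b² + 2 x ≤ (a + b)²`. The resulting linear
bound yields integrability and controls the rate where concentration fails. -/
lemma ratio_le {u v a b x t d : ℝ} (hu1 : u ≤ 1) (hv1 : v ≤ 1)
    (ha : 0 ≤ a) (hb : 0 ≤ b) (hx : 0 ≤ x) (hxab : x ≤ a * b) (ht : 0 ≤ t) (hd : 0 ≤ d) :
    ratio u v a b x t d ≤ a + b := by
  refine div_le_of_le_mul₀ (by positivity) (by positivity) ?_
  have h1 : u * (a ^ 2 + x) ≤ a ^ 2 + x := mul_le_of_le_one_left (by positivity) hu1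
  have h2 : v * (b ^ 2 + x) ≤ b ^ 2 + x := mul_le_of_le_one_left (by positivity) hv1
  have h3 : 0 ≤ (a + b) * (d * (a + b) + t) := by positivity
  nlinarith

/-- For `s ≤ r` one has `(1 + q r) / (1 + q s) ≤ r / s`. The bound is uniform in `q`, which is
essential because `q` will be `p * M` and may diverge. -/
lemma log_one_add_mul_sub_le {q r s : ℝ} (hq : 0 ≤ q) (hs : 0 < s) (hsr : s ≤ r) :
    Real.log (1 + q * r) - Real.log (1 + q * s) ≤ Real.log r - Real.log s := by
  have hr : 0 < r := hs.trans_le hsr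
  rw [← Real.log_div (by positivity) (by positivity), ← Real.log_div hr.ne' hs.ne']
  apply Real.log_le_log (by positivity)
  rw [div_le_div_iff₀ (by positivity) hs]
  nlinarith

lemma abs_log_one_add_mul_sub_le {q r s : ℝ} (hq : 0 ≤ q) (hr : 0 < r) (hs : 0 < s) :
    |Real.log (1 + q * r) - Real.log (1 + q * s)| ≤ |Real.log r - Real.log s| := by
  rcases le_total s r with h | h
  · rw [abs_of_nonneg, abs_of_nonneg]
    · exact log_one_add_mul_sub_le hq hs h
    · exact sub_nonneg.2 (Real.log_le_log hs h)
    · exact sub_nonneg.2 (Real.log_le_log (by positivity) (by gcongr))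
  · rw [abs_sub_comm, abs_sub_comm (Real.log r), abs_of_nonneg, abs_of_nonneg]
    · exact log_one_add_mul_sub_le hq hr h
    · exact sub_nonneg.2 (Real.log_le_log hr h)
    · exact sub_nonneg.2 (Real.log_le_log (by positivity) (by gcongr))

/-- From `1 + q r ≤ (1 + q) (1 + r)`: a large `r` costs only an additive `r`, independently of `q`.
-/
lemma log_one_add_mul_le {q r : ℝ} (hq : 0 ≤ q) (hr : 0 ≤ r) :
    Real.log (1 + q * r) ≤ Real.log (1 + q) + r := by
  calc Real.log (1 + q * r) ≤ Real.log ((1 + q) * (1 + r)) :=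
        Real.log_le_log (by positivity) (by nlinarith)
    _ = Real.log (1 + q) + Real.log (1 + r) := Real.log_mul (by positivity) (by positivity)
    _ ≤ Real.log (1 + q) + r := by
        have := Real.log_le_sub_one_of_pos (by positivity : 0 < 1 + r)
        linarith

variable {u v sA sB : ℝ}

/-- The logarithmic rate is stable under perturbations of the normalized channel statistics. -/
lemma exists_abs_log_ratio_sub_le (hu : 0 ≤ u) (hu1 : u ≤ 1) (hv : 0 ≤ v) (hv1 : v ≤ 1)
    (huv : 0 < u + v) (hA : 0 < sA) (hB : 0 < sB) {η : ℝ} (hη : 0 < η) :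
    ∃ C, 0 ≤ C ∧ ∀ a b x t d q : ℝ, 0 ≤ a → 0 ≤ b → 0 ≤ x → x ≤ a * b → 0 ≤ t → 0 ≤ d → 0 ≤ q →
      |Real.log (1 + q * ratio u v a b x t d) - Real.log (1 + q * ratio u v sA sB 0 0 0)| ≤
        η + C * (1 + Real.log (1 + q)) * (|a - sA| + |b - sB| + x + t + d) := by
  have hpos : ∀ a b x t d : ℝ, 0 < a → 0 < b → 0 ≤ x → 0 ≤ t → 0 ≤ d →
      0 < ratio u v a b x t d := fun a b x t d ha hb hx ht hd => by
    have h1 : 0 < u * (a ^ 2 + x) + v * (b ^ 2 + x) := by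
      rcases hu.eq_or_lt with rfl | hu'
      · have : 0 < v := by linarith
        positivity
      · positivity
    unfold ratio
    positivity
  have hr0 := hpos sA sB 0 0 0 hA hB le_rfl le_rfl le_rfl
  have hr0le : ratio u v sA sB 0 0 0 ≤ sA + sB :=
    ratio_le hu1 hv1 hA.le hB.le le_rfl (by positivity) le_rfl le_rfl
  have hcont : ContinuousAt (fun z : ℝ × ℝ × ℝ × ℝ × ℝ =>
      Real.log (ratio u v z.1 z.2.1 z.2.2.1 z.2.2.2.1 z.2.2.2.2)) (sA, sB, 0, 0, 0) := by
    refine ContinuousAt.log ?_ hr0.ne'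
    unfold ratio
    refine ContinuousAt.div (by fun_prop) (by fun_prop) ?_
    simp only [add_zero, one_mul]
    positivity
  obtain ⟨δ₁, hδ₁, hδ₁'⟩ := Metric.continuousAt_iff.1 hcont η hη
  -- Besides continuity, the radius must keep `a` and `b` positive, so that `log (ratio ..)`
  -- compares positive numbers.
  set δ := min δ₁ (min sA sB) with hδ
  have hδ0 : 0 < δ := lt_min hδ₁ (lt_min hA hB)
  -- If the total deviation `W` is at least `δ`, then `W / δ ≥ 1` turns the crude bound `2 log (1 +
  -- q) + 2 (sA + sB)` into a multiple of `W`; the summand `1` absorbs the remaining `W`.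
  refine ⟨(2 + 2 * (sA + sB)) / δ + 1, by positivity, ?_⟩
  intro a b x t d q ha hb hx hxab ht hd hq
  set W := |a - sA| + |b - sB| + x + t + d with hW
  have hW0 : 0 ≤ W := by positivity
  have hl : 0 ≤ Real.log (1 + q) := Real.log_nonneg (by linarith)
  have hCW : 0 ≤ ((2 + 2 * (sA + sB)) / δ + 1) * (1 + Real.log (1 + q)) * W := by positivity
  have habsA := abs_nonneg (a - sA)
  have habsB := abs_nonneg (b - sB)
  rcases lt_or_ge W δ with hlt | hge
  · have ha' : 0 < a := by
      have h1 : |a - sA| < sA := by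
        have : δ ≤ sA := (min_le_right _ _).trans (min_le_left _ _)
        linarith
      linarith [neg_abs_le (a - sA)]
    have hb' : 0 < b := by
      have h1 : |b - sB| < sB := by
        have : δ ≤ sB := (min_le_right _ _).trans (min_le_right _ _)
        linarith
      linarith [neg_abs_le (b - sB)]
    have hd₁ : δ ≤ δ₁ := min_le_left _ _
    have hdist : dist (a, b, x, t, d) (sA, sB, 0, 0, 0) < δ₁ := by
      simp only [Prod.dist_eq, Real.dist_eq, sub_zero, max_lt_iff, abs_of_nonneg hx,
        abs_of_nonneg ht, abs_of_nonneg hd]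
      refine ⟨?_, ?_, ?_, ?_, ?_⟩ <;> linarith
    have h1 := hδ₁' hdist
    rw [Real.dist_eq] at h1
    have h2 := abs_log_one_add_mul_sub_le hq (hpos a b x t d ha' hb' hx ht hd) hr0
    linarith
  · have hr := ratio_nonneg (u := u) (v := v) hu hv ha hb hx ht hd
    have hrle := ratio_le hu1 hv1 ha hb hx hxab ht hd
    have h1 := log_one_add_mul_le hq hr
    have h2 := log_one_add_mul_le hq hr0.le
    have h3 : 0 ≤ Real.log (1 + q * ratio u v a b x t d) :=
      Real.log_nonneg (by nlinarith [mul_nonneg hq hr])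
    have h4 : 0 ≤ Real.log (1 + q * ratio u v sA sB 0 0 0) :=
      Real.log_nonneg (by nlinarith [mul_nonneg hq hr0.le])
    have h5 : a + b ≤ sA + sB + W := by
      linarith [le_abs_self (a - sA), le_abs_self (b - sB)]
    have h6 : |Real.log (1 + q * ratio u v a b x t d) - Real.log (1 + q * ratio u v sA sB 0 0 0)| ≤
        2 * Real.log (1 + q) + 2 * (sA + sB) + W := by
      rw [abs_le]; constructor <;> linarith
    have h7 : 1 ≤ W / δ := (one_le_div hδ0).2 hge
    have h8 : 2 * Real.log (1 + q) + 2 * (sA + sB) ≤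
        (2 + 2 * (sA + sB)) * (1 + Real.log (1 + q)) := by
      have : 0 ≤ (sA + sB) * Real.log (1 + q) := by positivity
      nlinarith
    have h9 : (2 + 2 * (sA + sB)) * (1 + Real.log (1 + q)) ≤
        (2 + 2 * (sA + sB)) * (1 + Real.log (1 + q)) * (W / δ) :=
      le_mul_of_one_le_right (by positivity) h7
    have h10 : ((2 + 2 * (sA + sB)) / δ + 1) * (1 + Real.log (1 + q)) * W =
        (2 + 2 * (sA + sB)) * (1 + Real.log (1 + q)) * (W / δ) + W + Real.log (1 + q) * W := by
      field_simp
      ring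
    have h11 : 0 ≤ Real.log (1 + q) * W := by positivity
    linarith

/-- A lower bound for the logarithmic rate that only needs the norms of the estimated channels to
concentrate. -/
lemma exists_le_log_ratio (hu : 0 ≤ u) (hv : 0 ≤ v) (huv : 0 < u + v) (hA : 0 < sA) (hB : 0 < sB)
    {d : ℝ} (hd : 0 ≤ d) :
    ∃ C, 0 ≤ C ∧ ∀ a b x t q : ℝ, 0 ≤ a → 0 ≤ b → 0 ≤ x → 0 ≤ t → 0 < q →
      Real.log q - C - t - C * Real.log (1 + q) * (|a - sA| + |b - sB|) ≤
        Real.log (1 + q * ratio u v a b x t d) := by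
  -- When `a` and `b` are within `δ` of `sA` and `sB`, they exceed `sA / 2` and `sB / 2`, so the
  -- numerator is at least `U` and the denominator at most `V + t`.
  set U := (u * sA ^ 2 + v * sB ^ 2) / 4 with hU
  have hU0 : 0 < U := by
    rcases hu.eq_or_lt with rfl | hu'
    · have : 0 < v := by linarith
      positivity
    · positivity
  set V := (1 + d) * (2 * (sA + sB)) with hV
  have hV0 : 0 < V := by positivity
  set δ := min sA sB / 2 with hδ
  have hδ0 : 0 < δ := half_pos (lt_min hA hB)
  -- Near the limit, `log (V + t) ≤ V + t - 1` accounts for `V` and for the separate term `t`. Far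
  -- from it, `W / δ ≥ 1` makes the left-hand side nonpositive, since `log q ≤ log (1 + q)`.
  refine ⟨|Real.log U| + V + 1 / δ, by positivity, ?_⟩
  intro a b x t q ha hb hx ht hq
  set W := |a - sA| + |b - sB| with hW
  have hW0 : 0 ≤ W := by positivity
  have hl : 0 ≤ Real.log (1 + q) := Real.log_nonneg (by linarith)
  have hlq : Real.log q ≤ Real.log (1 + q) := Real.log_le_log hq (by linarith)
  have habsA := abs_nonneg (a - sA)
  have habsB := abs_nonneg (b - sB)
  have hr := ratio_nonneg (u := u) (v := v) hu hv ha hb hx ht hd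
  have hU' := abs_nonneg (Real.log U)
  rcases lt_or_ge W δ with hlt | hge
  · have hδA : δ ≤ sA / 2 := by
      have := min_le_left sA sB
      linarith
    have hδB : δ ≤ sB / 2 := by
      have := min_le_right sA sB
      linarith
    have ha' : sA / 2 ≤ a := by linarith [neg_abs_le (a - sA)]
    have hb' : sB / 2 ≤ b := by linarith [neg_abs_le (b - sB)]
    have hab : a + b ≤ 2 * (sA + sB) := by
      linarith [le_abs_self (a - sA), le_abs_self (b - sB)]
    have hnum : U ≤ u * (a ^ 2 + x) + v * (b ^ 2 + x) := by
      have h1 : (sA / 2) ^ 2 ≤ a ^ 2 := pow_le_pow_left₀ (by positivity) ha' 2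
      have h2 : (sB / 2) ^ 2 ≤ b ^ 2 := pow_le_pow_left₀ (by positivity) hb' 2
      have h3 : u * (sA / 2) ^ 2 ≤ u * (a ^ 2 + x) := by gcongr; linarith
      have h4 : v * (sB / 2) ^ 2 ≤ v * (b ^ 2 + x) := by gcongr; linarith
      rw [hU]; linarith
    have hden : (1 + d) * (a + b) + t ≤ V + t := by
      rw [hV]; gcongr
    have hdpos : 0 < (1 + d) * (a + b) + t := by
      have : 0 < a := by linarith
      positivity
    have hr1 : U / (V + t) ≤ ratio u v a b x t d := by
      unfold ratio
      exact div_le_div₀ (hU0.le.trans hnum) hnum hdpos hden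
    have h1 : Real.log (q * (U / (V + t))) ≤ Real.log (1 + q * ratio u v a b x t d) := by
      apply Real.log_le_log (by positivity)
      have := mul_le_mul_of_nonneg_left hr1 hq.le
      linarith
    rw [Real.log_mul hq.ne' (by positivity), Real.log_div hU0.ne' (by positivity)] at h1
    have h2 := Real.log_le_sub_one_of_pos (by positivity : 0 < V + t)
    have h3 := neg_abs_le (Real.log U)
    have h4 : 0 ≤ (|Real.log U| + V + 1 / δ) * Real.log (1 + q) * W := by positivity
    have h5 : 0 ≤ 1 / δ := by positivity
    linarith
  · have h3 : 0 ≤ Real.log (1 + q * ratio u v a b x t d) :=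
      Real.log_nonneg (by nlinarith [mul_nonneg hq.le hr])
    have h7 : 1 ≤ 1 / δ * W := by
      rw [one_div_mul_eq_div]; exact (one_le_div hδ0).2 hge
    have h8 : Real.log (1 + q) ≤ (|Real.log U| + V + 1 / δ) * Real.log (1 + q) * W := by
      have e : (|Real.log U| + V + 1 / δ) * Real.log (1 + q) * W =
        Real.log (1 + q) * (1 / δ * W) + (|Real.log U| + V) * Real.log (1 + q) * W := by ring
      have : 0 ≤ (|Real.log U| + V) * Real.log (1 + q) * W := by positivity
      have : Real.log (1 + q) ≤ Real.log (1 + q) * (1 / δ * W) := le_mul_of_one_le_right hl h7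
      linarith
    have h9 : 0 ≤ |Real.log U| + V + 1 / δ := by positivity
    linarith

end Deterministic

/-! ### Integrating the deterministic bounds over the channel statistics. -/

section PairStatistics

variable {Ω : Type*} [MeasurableSpace Ω] {P : Measure Ω} {M : ℕ} {a b x T : Ω → ℝ}
  {sA sB τ K : ℝ}

/-- Statistics of the estimated channels of a pair for `M` antennas: the squared norms `a`, `b`,
the squared inner product `x` and the interference `T`. -/
structure IsPairStatistics (P : Measure Ω) (M : ℕ) (a b x T : Ω → ℝ) (sA sB τ K : ℝ) : Prop where
  measurable_a : Measurable a
  measurable_b : Measurable b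
  measurable_x : Measurable x
  measurable_T : Measurable T
  a_nonneg : ∀ ω, 0 ≤ a ω
  b_nonneg : ∀ ω, 0 ≤ b ω
  x_nonneg : ∀ ω, 0 ≤ x ω
  T_nonneg : ∀ ω, 0 ≤ T ω
  x_le : ∀ ω, x ω ≤ a ω * b ω
  integrable_a : Integrable a P
  integrable_b : Integrable b P
  integrable_x : Integrable x P
  integrable_T : Integrable T P
  integral_abs_a : ∫ ω, |a ω - M * sA| ∂P ≤ Real.sqrt (M * K)
  integral_abs_b : ∫ ω, |b ω - M * sB| ∂P ≤ Real.sqrt (M * K)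
  integral_x : ∫ ω, x ω ∂P = M * (sA * sB)
  integral_T : ∫ ω, T ω ∂P = M * τ

/-- The ergodic logarithmic rate `E[log(1 + S / D)]` with signal power
`S = p (u (a² + x) + v (b² + x))` and impairment `D = (1 + p c) (a + b) + p T`, in normalized
form. -/
def meanLog (P : Measure Ω) (M : ℕ) (a b x T : Ω → ℝ) (u v p c : ℝ) : ℝ :=
  ∫ ω, Real.log (1 + p * M *
    ratio u v (a ω / M) (b ω / M) (x ω / M ^ 2) (p * T ω / M) (p * c)) ∂P

namespace IsPairStatistics

lemma measurable_log (h : IsPairStatistics P M a b x T sA sB τ K) (u v p c : ℝ) :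
    Measurable fun ω => Real.log (1 + p * M *
      ratio u v (a ω / M) (b ω / M) (x ω / M ^ 2) (p * T ω / M) (p * c)) := by
  have := h.measurable_a
  have := h.measurable_b
  have := h.measurable_x
  have := h.measurable_T
  unfold ratio
  fun_prop

lemma normalized_x_le (h : IsPairStatistics P M a b x T sA sB τ K) (ω : Ω) :
    x ω / M ^ 2 ≤ a ω / M * (b ω / M) := by
  rw [div_mul_div_comm, ← pow_two]
  exact div_le_div_of_nonneg_right (h.x_le ω) (by positivity)

lemma integrable_log (h : IsPairStatistics P M a b x T sA sB τ K) {u v p c : ℝ}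
    (hu : 0 ≤ u) (hu1 : u ≤ 1) (hv : 0 ≤ v) (hv1 : v ≤ 1) (hp : 0 ≤ p) (hc : 0 ≤ c) :
    Integrable (fun ω => Real.log (1 + p * M *
      ratio u v (a ω / M) (b ω / M) (x ω / M ^ 2) (p * T ω / M) (p * c))) P := by
  refine (((h.integrable_a.div_const M).add (h.integrable_b.div_const M)).const_mul
    (p * M)).mono' (h.measurable_log u v p c).aestronglyMeasurable (ae_of_all _ fun ω => ?_)
  have ha := h.a_nonneg ω
  have hb := h.b_nonneg ω
  have hx := h.x_nonneg ω
  have hT := h.T_nonneg ω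
  have hr := ratio_nonneg (u := u) (v := v) (a := a ω / M) (b := b ω / M) (x := x ω / M ^ 2)
    (t := p * T ω / M) (d := p * c) hu hv (by positivity) (by positivity) (by positivity)
    (by positivity) (by positivity)
  have hrle := ratio_le (u := u) (v := v) (a := a ω / M) (b := b ω / M) (x := x ω / M ^ 2)
    (t := p * T ω / M) (d := p * c) hu1 hv1 (by positivity) (by positivity) (by positivity)
    (h.normalized_x_le ω) (by positivity) (by positivity)
  have hq : 0 ≤ p * M := by positivity
  have hqr := mul_nonneg hq hr
  rw [Real.norm_of_nonneg (Real.log_nonneg (by linarith))]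
  have h1 := Real.log_le_sub_one_of_pos (by linarith : 0 < 1 + p * M *
      ratio u v (a ω / M) (b ω / M) (x ω / M ^ 2) (p * T ω / M) (p * c))
  have h2 := mul_le_mul_of_nonneg_left hrle hq
  simp only [Pi.add_apply]
  linarith

lemma integrable_abs_a [IsFiniteMeasure P] (h : IsPairStatistics P M a b x T sA sB τ K) :
    Integrable (fun ω => |a ω / M - sA|) P :=
  ((h.integrable_a.div_const _).sub (integrable_const _)).abs

lemma integrable_abs_b [IsFiniteMeasure P] (h : IsPairStatistics P M a b x T sA sB τ K) :
    Integrable (fun ω => |b ω / M - sB|) P :=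
  ((h.integrable_b.div_const _).sub (integrable_const _)).abs

lemma abs_div_sub_eq (hM : 0 < M) (y s : ℝ) : |y / M - s| = |y - M * s| / M := by
  have hMr : (0 : ℝ) < M := by exact_mod_cast hM
  rw [← abs_of_pos hMr, ← abs_div, abs_of_pos hMr]
  congr 1
  field_simp

lemma sqrt_mul_div (hM : 0 < M) : Real.sqrt (M * K) / M = Real.sqrt K * (M : ℝ) ^ (-(1 / 2) : ℝ) := by
  have hMr : (0 : ℝ) < M := by exact_mod_cast hM
  rw [Real.sqrt_mul hMr.le, Real.rpow_neg hMr.le, ← Real.sqrt_eq_rpow]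
  have h1 : Real.sqrt M ≠ 0 := (Real.sqrt_pos.2 hMr).ne'
  have h2 := Real.mul_self_sqrt hMr.le
  rw [div_eq_iff hMr.ne']
  nth_rewrite 3 [← h2]
  field_simp

lemma integral_abs_a_le (h : IsPairStatistics P M a b x T sA sB τ K) (hM : 0 < M) :
    ∫ ω, |a ω / M - sA| ∂P ≤ Real.sqrt K * (M : ℝ) ^ (-(1 / 2) : ℝ) := by
  simp_rw [abs_div_sub_eq hM]
  rw [integral_div, ← sqrt_mul_div hM]
  exact div_le_div_of_nonneg_right h.integral_abs_a (by positivity)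

lemma integral_abs_b_le (h : IsPairStatistics P M a b x T sA sB τ K) (hM : 0 < M) :
    ∫ ω, |b ω / M - sB| ∂P ≤ Real.sqrt K * (M : ℝ) ^ (-(1 / 2) : ℝ) := by
  simp_rw [abs_div_sub_eq hM]
  rw [integral_div, ← sqrt_mul_div hM]
  exact div_le_div_of_nonneg_right h.integral_abs_b (by positivity)

lemma integral_x_div (h : IsPairStatistics P M a b x T sA sB τ K) (hM : 0 < M) :
    ∫ ω, x ω / M ^ 2 ∂P = sA * sB * (M : ℝ) ^ (-1 : ℝ) := by
  have hMr : (0 : ℝ) < M := by exact_mod_cast hM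
  rw [integral_div, h.integral_x, Real.rpow_neg_one]
  field_simp

lemma integral_T_div (h : IsPairStatistics P M a b x T sA sB τ K) (hM : 0 < M) (p : ℝ) :
    ∫ ω, p * T ω / M ∂P = p * τ := by
  have hMr : (0 : ℝ) < M := by exact_mod_cast hM
  rw [integral_div, integral_const_mul, h.integral_T]
  field_simp

end IsPairStatistics

/-- The deviation bound of `abs_meanLog_sub_le`. -/
def deviation (sA sB τ K : ℝ) (M : ℕ) (p c : ℝ) : ℝ :=
  2 * Real.sqrt K * (M : ℝ) ^ (-(1 / 2) : ℝ) + sA * sB * (M : ℝ) ^ (-1 : ℝ) + p * τ + p * c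

/-- The pointwise bound is linear in the deviations, so its expectation needs only their first
absolute moments, summed in `deviation`; neither independence of the statistics nor tail estimates
are required. -/
lemma abs_meanLog_sub_le [IsProbabilityMeasure P] {u v p c η C : ℝ}
    (h : IsPairStatistics P M a b x T sA sB τ K) (hM : 0 < M)
    (hu : 0 ≤ u) (hu1 : u ≤ 1) (hv : 0 ≤ v) (hv1 : v ≤ 1) (hp : 0 ≤ p) (hc : 0 ≤ c) (hC : 0 ≤ C)
    (hbound : ∀ a b x t d q : ℝ, 0 ≤ a → 0 ≤ b → 0 ≤ x → x ≤ a * b → 0 ≤ t → 0 ≤ d → 0 ≤ q →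
      |Real.log (1 + q * ratio u v a b x t d) - Real.log (1 + q * ratio u v sA sB 0 0 0)| ≤
        η + C * (1 + Real.log (1 + q)) * (|a - sA| + |b - sB| + x + t + d)) :
    |meanLog P M a b x T u v p c - Real.log (1 + p * M * ratio u v sA sB 0 0 0)| ≤
      η + C * (1 + Real.log (1 + p * M)) * deviation sA sB τ K M p c := by
  have hq : 0 ≤ p * M := by positivity
  have hl : 0 ≤ Real.log (1 + p * M) := Real.log_nonneg (by linarith)
  have hint := h.integrable_log hu hu1 hv hv1 hp hc
  have i1 : Integrable (fun ω => |a ω / M - sA| + |b ω / M - sB|) P :=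
    h.integrable_abs_a.add h.integrable_abs_b
  have i2 : Integrable (fun ω => |a ω / M - sA| + |b ω / M - sB| + x ω / M ^ 2) P :=
    i1.add (h.integrable_x.div_const _)
  have hT : Integrable (fun ω => p * T ω / M) P := (h.integrable_T.const_mul p).div_const _
  have i3 : Integrable (fun ω => |a ω / M - sA| + |b ω / M - sB| + x ω / M ^ 2 +
    p * T ω / M) P := i2.add hT
  have i4 : Integrable (fun ω => |a ω / M - sA| + |b ω / M - sB| + x ω / M ^ 2 +
    p * T ω / M + p * c) P := i3.add (integrable_const _)
  have hW : ∫ ω, (|a ω / M - sA| + |b ω / M - sB| + x ω / M ^ 2 + p * T ω / M + p * c) ∂P ≤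
      deviation sA sB τ K M p c := by
    rw [integral_add i3 (integrable_const _), integral_add i2 hT,
      integral_add i1 (h.integrable_x.div_const _),
      integral_add h.integrable_abs_a h.integrable_abs_b, h.integral_x_div hM,
      h.integral_T_div hM, integral_const, probReal_univ, one_smul, deviation]
    linarith [h.integral_abs_a_le hM, h.integral_abs_b_le hM]
  have e : meanLog P M a b x T u v p c - Real.log (1 + p * M * ratio u v sA sB 0 0 0) =
      ∫ ω, (Real.log (1 + p * M *
        ratio u v (a ω / M) (b ω / M) (x ω / M ^ 2) (p * T ω / M) (p * c)) -
        Real.log (1 + p * M * ratio u v sA sB 0 0 0)) ∂P := by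
    rw [integral_sub hint (integrable_const _)]
    simp [meanLog]
  rw [e]
  refine abs_integral_le_integral_abs.trans ?_
  calc _ ≤ ∫ ω, (η + C * (1 + Real.log (1 + p * M)) *
        (|a ω / M - sA| + |b ω / M - sB| + x ω / M ^ 2 + p * T ω / M + p * c)) ∂P := by
        refine integral_mono (hint.sub (integrable_const _)).abs
          ((integrable_const _).add (i4.const_mul _)) fun ω => ?_
        have ha := h.a_nonneg ω
        have hb := h.b_nonneg ω
        have hx := h.x_nonneg ω
        have hT := h.T_nonneg ω
        exact hbound _ _ _ _ _ _ (by positivity) (by positivity) (by positivity)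
          (h.normalized_x_le ω) (by positivity) (by positivity) hq
    _ ≤ _ := by
        rw [integral_add (integrable_const _) (i4.const_mul _), integral_const_mul]
        simp only [integral_const, probReal_univ, one_smul]
        have : 0 ≤ C * (1 + Real.log (1 + p * M)) := by positivity
        have := mul_le_mul_of_nonneg_left hW this
        linarith

/-- Here the interference term averages to `p * τ`, which need not be small: it lowers the bound by
a constant only. This serves constant user power. -/
lemma le_meanLog [IsProbabilityMeasure P] {u v p c C : ℝ}
    (h : IsPairStatistics P M a b x T sA sB τ K) (hM : 0 < M)
    (hu : 0 ≤ u) (hu1 : u ≤ 1) (hv : 0 ≤ v) (hv1 : v ≤ 1) (hp : 0 < p) (hc : 0 ≤ c) (hC : 0 ≤ C)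
    (hbound : ∀ a b x t q : ℝ, 0 ≤ a → 0 ≤ b → 0 ≤ x → 0 ≤ t → 0 < q →
      Real.log q - C - t - C * Real.log (1 + q) * (|a - sA| + |b - sB|) ≤
        Real.log (1 + q * ratio u v a b x t (p * c))) :
    Real.log (p * M) - C - p * τ - C * Real.log (1 + p * M) *
      (2 * Real.sqrt K * (M : ℝ) ^ (-(1 / 2) : ℝ)) ≤ meanLog P M a b x T u v p c := by
  have hMr : (0 : ℝ) < M := by exact_mod_cast hM
  have hq : 0 < p * M := by positivity
  have hl : 0 ≤ Real.log (1 + p * M) := Real.log_nonneg (by linarith)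
  have hint := h.integrable_log hu hu1 hv hv1 hp.le hc
  have i1 : Integrable (fun ω => |a ω / M - sA| + |b ω / M - sB|) P :=
    h.integrable_abs_a.add h.integrable_abs_b
  have hT : Integrable (fun ω => p * T ω / M) P := (h.integrable_T.const_mul p).div_const _
  have i2 : Integrable (fun ω => Real.log (p * M) - C - p * T ω / M) P :=
    (integrable_const _).sub hT
  have i3 : Integrable (fun ω => C * Real.log (1 + p * M) *
    (|a ω / M - sA| + |b ω / M - sB|)) P := i1.const_mul _
  have hmono : ∫ ω, (Real.log (p * M) - C - p * T ω / M - C * Real.log (1 + p * M) *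
      (|a ω / M - sA| + |b ω / M - sB|)) ∂P ≤ meanLog P M a b x T u v p c := by
    refine integral_mono (i2.sub i3) hint fun ω => ?_
    have ha := h.a_nonneg ω
    have hb := h.b_nonneg ω
    have hx := h.x_nonneg ω
    have hT := h.T_nonneg ω
    exact hbound _ _ _ _ _ (by positivity) (by positivity) (by positivity) (by positivity) hq
  refine le_trans ?_ hmono
  rw [integral_sub i2 i3, integral_sub (integrable_const _) hT, integral_const_mul,
    integral_add h.integrable_abs_a h.integrable_abs_b, h.integral_T_div hM]
  simp only [integral_const, probReal_univ, one_smul]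
  have h1 : 0 ≤ C * Real.log (1 + p * M) := by positivity
  have h2 : ∫ ω, |a ω / M - sA| ∂P + ∫ ω, |b ω / M - sB| ∂P ≤
      2 * Real.sqrt K * (M : ℝ) ^ (-(1 / 2) : ℝ) := by
    linarith [h.integral_abs_a_le hM, h.integral_abs_b_le hM]
  have := mul_le_mul_of_nonneg_left h2 h1
  linarith

end PairStatistics

/-! ### Powers of `M` against `log M`. -/

section Growth

lemma tendsto_log_natCast_mul_rpow_neg {s : ℝ} (hs : 0 < s) :
    Tendsto (fun M : ℕ => Real.log M * (M : ℝ) ^ (-s)) atTop (𝓝 0) := by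
  have h := (isLittleO_log_rpow_atTop hs).tendsto_div_nhds_zero.comp tendsto_natCast_atTop_atTop
  refine h.congr fun M => ?_
  simp only [Function.comp_apply]
  rw [Real.rpow_neg (by positivity), div_eq_mul_inv]

lemma tendsto_natCast_rpow_neg {s : ℝ} (hs : 0 < s) :
    Tendsto (fun M : ℕ => (M : ℝ) ^ (-s)) atTop (𝓝 0) :=
  (tendsto_rpow_neg_atTop hs).comp tendsto_natCast_atTop_atTop

lemma tendsto_add_log_mul_rpow_neg (A : ℝ) {s : ℝ} (hs : 0 < s) :
    Tendsto (fun M : ℕ => (A + Real.log M) * (M : ℝ) ^ (-s)) atTop (𝓝 0) := by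
  have := ((tendsto_natCast_rpow_neg hs).const_mul A).add (tendsto_log_natCast_mul_rpow_neg hs)
  simp only [mul_zero, add_zero] at this
  exact this.congr fun M => by ring

lemma log_one_add_div_rpow_mul_le {e α : ℝ} (he : 0 < e) (hα : 0 ≤ α) {M : ℕ} (hM : 0 < M) :
    Real.log (1 + e / (M : ℝ) ^ α * M) ≤ Real.log (1 + e) + Real.log M := by
  have hM1 : (1 : ℝ) ≤ M := by exact_mod_cast hM
  have hMr : (0 : ℝ) < M := by linarith
  rw [← Real.log_mul (by positivity) hMr.ne']
  apply Real.log_le_log (by positivity)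
  have : e / (M : ℝ) ^ α ≤ e := div_le_self he.le (Real.one_le_rpow hM1 hα)
  nlinarith

end Growth

/-! ### Limits and growth of the first-phase rates. -/

section FirstPhaseLimit

variable {Ω : ℕ → Type*} [∀ M, MeasurableSpace (Ω M)] {P : ∀ M, Measure (Ω M)}
  [∀ M, IsProbabilityMeasure (P M)] {a b x T : ∀ M, Ω M → ℝ} {sA sB τ K u v c e α : ℝ}

/-- First-phase rate asymptotics for vanishing user power. -/
theorem tendsto_meanLog_sub (h : ∀ M, IsPairStatistics (P M) M (a M) (b M) (x M) (T M) sA sB τ K)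
    (hu : 0 ≤ u) (hu1 : u ≤ 1) (hv : 0 ≤ v) (hv1 : v ≤ 1) (huv : 0 < u + v) (hA : 0 < sA)
    (hB : 0 < sB) (hτ : 0 ≤ τ) (hc : 0 ≤ c) (he : 0 < e) (hα : 0 < α) :
    Tendsto (fun M : ℕ => meanLog (P M) M (a M) (b M) (x M) (T M) u v (e / (M : ℝ) ^ α) c -
      Real.log (1 + e / (M : ℝ) ^ α * M * ratio u v sA sB 0 0 0)) atTop (𝓝 0) := by
  rw [Metric.tendsto_atTop']
  intro η hη
  obtain ⟨C, hC, hbound⟩ := exists_abs_log_ratio_sub_le hu hu1 hv hv1 huv hA hB (half_pos hη)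
  -- The deviation consists of terms in `M^(-1/2)`, `M^(-1)` and `M^(-α)`, each of which beats the
  -- logarithm. The last one, from interference and estimation errors, is where `α > 0` is needed.
  have hlim : Tendsto (fun M : ℕ => C * ((1 + Real.log (1 + e) + Real.log M) *
      deviation sA sB τ K M (e / (M : ℝ) ^ α) c)) atTop (𝓝 0) := by
    have h1 := (tendsto_add_log_mul_rpow_neg (1 + Real.log (1 + e))
      (one_half_pos (α := ℝ))).const_mul (2 * Real.sqrt K)
    have h2 := (tendsto_add_log_mul_rpow_neg (1 + Real.log (1 + e))
      (one_pos (α := ℝ))).const_mul (sA * sB)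
    have h3 := (tendsto_add_log_mul_rpow_neg (1 + Real.log (1 + e)) hα).const_mul (e * (τ + c))
    have h4 := ((h1.add h2).add h3).const_mul C
    simp only [mul_zero, add_zero] at h4
    refine h4.congr fun M => ?_
    rw [deviation, div_eq_mul_inv e, ← Real.rpow_neg (by positivity)]
    ring
  obtain ⟨M₀, hM₀⟩ := (Metric.tendsto_atTop'.1 hlim) (η / 2) (half_pos hη)
  refine ⟨max M₀ 1, fun M hM => ?_⟩
  have hMpos : 0 < M := lt_of_le_of_lt (Nat.zero_le _) hM
  have hM0 := hM₀ M (lt_of_le_of_lt (le_max_left _ _) hM)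
  rw [Real.dist_eq, sub_zero] at hM0 ⊢
  have hp : 0 ≤ e / (M : ℝ) ^ α := by positivity
  have h1 := abs_meanLog_sub_le (h M) hMpos hu hu1 hv hv1 hp hc hC hbound
  have hdev : 0 ≤ deviation sA sB τ K M (e / (M : ℝ) ^ α) c := by unfold deviation; positivity
  have h2 : C * (1 + Real.log (1 + e / (M : ℝ) ^ α * M)) *
      deviation sA sB τ K M (e / (M : ℝ) ^ α) c ≤
      C * ((1 + Real.log (1 + e) + Real.log M) * deviation sA sB τ K M (e / (M : ℝ) ^ α) c) := by
    rw [mul_assoc]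
    have := log_one_add_div_rpow_mul_le he hα.le hMpos
    exact mul_le_mul_of_nonneg_left (mul_le_mul_of_nonneg_right (by linarith) hdev) hC
  have h3 := le_abs_self (C * ((1 + Real.log (1 + e) + Real.log M) *
    deviation sA sB τ K M (e / (M : ℝ) ^ α) c))
  linarith

/-- For constant user power the first-phase rate grows at least like `log M`. -/
theorem exists_log_sub_le_meanLog
    (h : ∀ M, IsPairStatistics (P M) M (a M) (b M) (x M) (T M) sA sB τ K)
    (hu : 0 ≤ u) (hu1 : u ≤ 1) (hv : 0 ≤ v) (hv1 : v ≤ 1) (huv : 0 < u + v) (hA : 0 < sA)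
    (hB : 0 < sB) (hc : 0 ≤ c) (he : 0 < e) :
    ∃ C, ∀ᶠ M : ℕ in atTop,
      Real.log M - C ≤ meanLog (P M) M (a M) (b M) (x M) (T M) u v e c := by
  obtain ⟨C, hC, hbound⟩ := exists_le_log_ratio hu hv huv hA hB (d := e * c) (by positivity)
  have hlim := (tendsto_add_log_mul_rpow_neg (Real.log (1 + e))
      (one_half_pos (α := ℝ))).const_mul (C * (2 * Real.sqrt K))
  rw [mul_zero] at hlim
  -- The summand `1` covers the concentration term of order `log M * M^(-1/2)`, which is eventually
  -- below `1`.
  refine ⟨-Real.log e + C + e * τ + 1, ?_⟩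
  filter_upwards [hlim.eventually_lt_const one_pos, eventually_gt_atTop 0] with M h1 hM
  have hMr : (0 : ℝ) < M := by exact_mod_cast hM
  refine le_trans ?_ (le_meanLog (h M) hM hu hu1 hv hv1 he hc hC hbound)
  rw [Real.log_mul he.ne' hMr.ne']
  have h2 := log_one_add_div_rpow_mul_le he (le_refl (0 : ℝ)) hM
  rw [Real.rpow_zero, div_one] at h2
  have h3 : C * Real.log (1 + e * M) * (2 * Real.sqrt K * (M : ℝ) ^ (-(1 / 2) : ℝ)) ≤
      C * (2 * Real.sqrt K) * ((Real.log (1 + e) + Real.log M) * (M : ℝ) ^ (-(1 / 2) : ℝ)) := by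
    have : C * Real.log (1 + e * M) * (2 * Real.sqrt K * (M : ℝ) ^ (-(1 / 2) : ℝ)) =
      C * (2 * Real.sqrt K) * (Real.log (1 + e * M) * (M : ℝ) ^ (-(1 / 2) : ℝ)) := by ring
    rw [this]
    gcongr
  linarith

end FirstPhaseLimit

/-! ### Reduction of the first-phase rates to the pair statistics. -/

section FirstPhaseRate

variable {Ω : Type*} [MeasurableSpace Ω] {P : Measure Ω} {M N : ℕ}

lemma absSqH_comm (x y : Fin M → ℂ) : absSqH x y = absSqH y x := by
  have : star y ⬝ᵥ x = star (star x ⬝ᵥ y) := by simp [dotProduct, mul_comm]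
  rw [absSqH, absSqH, this, norm_star]

lemma absSqH_self (x : Fin M → ℂ) : absSqH x x = (∑ m, ‖x m‖ ^ 2) ^ 2 := by
  rw [absSqH, IsEstimateModel.star_dotProduct_self, Complex.norm_real, Real.norm_eq_abs, sq_abs]

lemma absSqH_nonneg (x y : Fin M → ℂ) : 0 ≤ absSqH x y := by unfold absSqH; positivity

lemma absSqH_le (x y : Fin M → ℂ) : absSqH x y ≤ (∑ m, ‖x m‖ ^ 2) * ∑ m, ‖y m‖ ^ 2 := by
  have h1 : ‖star x ⬝ᵥ y‖ ≤ ∑ m, ‖x m‖ * ‖y m‖ := by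
    refine (norm_sum_le _ _).trans_eq (Finset.sum_congr rfl fun m _ => ?_)
    rw [norm_mul, Pi.star_apply, norm_star]
  exact (pow_le_pow_left₀ (norm_nonneg _) h1 2).trans (Finset.sum_mul_sq_le_sq_mul_sq _ _ _)

lemma estimateInterference_nonneg (HA HB : Matrix (Fin M) (Fin N) ℂ) (i : Fin N) :
    0 ≤ estimateInterference HA HB i :=
  Finset.sum_nonneg fun _ _ => add_nonneg (add_nonneg (absSqH_nonneg _ _) (absSqH_nonneg _ _))
    (add_nonneg (absSqH_nonneg _ _) (absSqH_nonneg _ _))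

/-- The mean mutual interference of the estimated channels per antenna. -/
def meanInterference (sA sB : Fin N → ℝ) (i : Fin N) : ℝ :=
  ∑ j ∈ Finset.univ.erase i,
    ((sA i * sA j + sB i * sA j) + (sA i * sB j + sB i * sB j))

lemma IsEstimateModel.isPairStatistics {HA HB : Ω → Matrix (Fin M) (Fin N) ℂ}
    {E : Ω → Matrix (Fin M) (Fin N ⊕ Fin N) ℂ} {sA sB : Fin N → ℝ} {sE : Fin N ⊕ Fin N → ℝ} {K : ℝ}
    (h : IsEstimateModel P (fun ω => Matrix.fromCols (HA ω) (HB ω)) E (Sum.elim sA sB) sE K)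
    (i : Fin N) :
    IsPairStatistics P M (fun ω => ∑ m, ‖HA ω m i‖ ^ 2) (fun ω => ∑ m, ‖HB ω m i‖ ^ 2)
      (fun ω => absSqH ((HA ω).col i) ((HB ω).col i))
      (fun ω => estimateInterference (HA ω) (HB ω) i) (sA i) (sB i)
      (meanInterference sA sB i) K := by
  have := h.isProbabilityMeasure
  have hA : ∀ m n, Measurable fun ω => HA ω m n := fun m n => h.measurable_H m (Sum.inl n)
  have hB : ∀ m n, Measurable fun ω => HB ω m n := fun m n => h.measurable_H m (Sum.inr n)
  have hA4 : ∀ m n, MemLp (fun ω => HA ω m n) 4 P := fun m n => h.memLp_H m (Sum.inl n)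
  have hB4 : ∀ m n, MemLp (fun ω => HB ω m n) 4 P := fun m n => h.memLp_H m (Sum.inr n)
  have iAA : ∀ j, Integrable (fun ω => absSqH ((HA ω).col i) ((HA ω).col j)) P := fun j =>
    integrable_absSqH (fun m => hA4 m i) fun m => hA4 m j
  have iBA : ∀ j, Integrable (fun ω => absSqH ((HB ω).col i) ((HA ω).col j)) P := fun j =>
    integrable_absSqH (fun m => hB4 m i) fun m => hA4 m j
  have iAB : ∀ j, Integrable (fun ω => absSqH ((HA ω).col i) ((HB ω).col j)) P := fun j =>
    integrable_absSqH (fun m => hA4 m i) fun m => hB4 m j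
  have iBB : ∀ j, Integrable (fun ω => absSqH ((HB ω).col i) ((HB ω).col j)) P := fun j =>
    integrable_absSqH (fun m => hB4 m i) fun m => hB4 m j
  have i1 : ∀ j, Integrable (fun ω => absSqH ((HA ω).col i) ((HA ω).col j) +
      absSqH ((HB ω).col i) ((HA ω).col j)) P := fun j => (iAA j).add (iBA j)
  have i2 : ∀ j, Integrable (fun ω => absSqH ((HA ω).col i) ((HB ω).col j) +
      absSqH ((HB ω).col i) ((HB ω).col j)) P := fun j => (iAB j).add (iBB j)
  have i3 : ∀ j, Integrable (fun ω => (absSqH ((HA ω).col i) ((HA ω).col j) +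
      absSqH ((HB ω).col i) ((HA ω).col j)) + (absSqH ((HA ω).col i) ((HB ω).col j) +
      absSqH ((HB ω).col i) ((HB ω).col j))) P := fun j => (i1 j).add (i2 j)
  refine
    { measurable_a := Finset.measurable_sum _ fun m _ => (hA m i).norm.pow_const 2
      measurable_b := Finset.measurable_sum _ fun m _ => (hB m i).norm.pow_const 2
      measurable_x := measurable_absSqH (fun m => hA m i) fun m => hB m i
      measurable_T := ?_
      a_nonneg := fun ω => by positivity
      b_nonneg := fun ω => by positivity
      x_nonneg := fun ω => absSqH_nonneg _ _
      T_nonneg := fun ω => estimateInterference_nonneg _ _ i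
      x_le := fun ω => absSqH_le _ _
      integrable_a := (h.memLp_sum_norm_sq (Sum.inl i)).integrable (by norm_num)
      integrable_b := (h.memLp_sum_norm_sq (Sum.inr i)).integrable (by norm_num)
      integrable_x := iAB i
      integrable_T := integrable_finsetSum _ fun j _ => i3 j
      integral_abs_a := h.integral_abs_sum_norm_sq_sub_le (Sum.inl i)
      integral_abs_b := h.integral_abs_sum_norm_sq_sub_le (Sum.inr i)
      integral_x := h.integral_absSqH_H_H (j := Sum.inl i) (j' := Sum.inr i) (by simp)
      integral_T := ?_ }
  · exact Finset.measurable_sum _ fun j _ =>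
      ((measurable_absSqH (fun m => hA m i) fun m => hA m j).add
        (measurable_absSqH (fun m => hB m i) fun m => hA m j)).add
      ((measurable_absSqH (fun m => hA m i) fun m => hB m j).add
        (measurable_absSqH (fun m => hB m i) fun m => hB m j))
  · simp only [estimateInterference]
    rw [integral_finsetSum _ fun j _ => i3 j, meanInterference, Finset.mul_sum]
    refine Finset.sum_congr rfl fun j hj => ?_
    have hji : i ≠ j := (Finset.ne_of_mem_erase hj).symm
    rw [integral_add (i1 j) (i2 j), integral_add (iAA j) (iBA j), integral_add (iAB j) (iBB j)]
    have e1 := h.integral_absSqH_H_H (j := Sum.inl i) (j' := Sum.inl j) (by simpa using hji)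
    have e2 := h.integral_absSqH_H_H (j := Sum.inr i) (j' := Sum.inl j) (by simp)
    have e3 := h.integral_absSqH_H_H (j := Sum.inl i) (j' := Sum.inr j) (by simp)
    have e4 := h.integral_absSqH_H_H (j := Sum.inr i) (j' := Sum.inr j) (by simpa using hji)
    simp only [Sum.elim_inl, Sum.elim_inr] at e1 e2 e3 e4
    have e1' : ∫ ω, absSqH ((HA ω).col i) ((HA ω).col j) ∂P = M * (sA i * sA j) := e1
    have e2' : ∫ ω, absSqH ((HB ω).col i) ((HA ω).col j) ∂P = M * (sB i * sA j) := e2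
    have e3' : ∫ ω, absSqH ((HA ω).col i) ((HB ω).col j) ∂P = M * (sA i * sB j) := e3
    have e4' : ∫ ω, absSqH ((HB ω).col i) ((HB ω).col j) ∂P = M * (sB i * sB j) := e4
    rw [e1', e2', e3', e4']
    ring

/-- The numerator scales like `M²` and the denominator like `M`; the remaining factor `M` is the
array gain. -/
lemma mul_ratio_normalized (hM : 0 < M) (u v a b x T p c : ℝ) :
    p * M * ratio u v (a / M) (b / M) (x / M ^ 2) (p * T / M) (p * c) =
      p * (u * (a ^ 2 + x) + v * (b ^ 2 + x)) / ((1 + p * c) * (a + b) + p * T) := by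
  have hMr : (M : ℝ) ≠ 0 := by exact_mod_cast hM.ne'
  have e1 : u * ((a / M) ^ 2 + x / M ^ 2) + v * ((b / M) ^ 2 + x / M ^ 2) =
      (u * (a ^ 2 + x) + v * (b ^ 2 + x)) / M ^ 2 := by
    field_simp
  have e2 : (1 + p * c) * (a / M + b / M) + p * T / M =
      ((1 + p * c) * (a + b) + p * T) / M := by
    field_simp
  rw [ratio, e1, e2, div_div_div_eq, ← mul_div_assoc]
  generalize u * (a ^ 2 + x) + v * (b ^ 2 + x) = y
  rw [show p * M * (y * M) = M ^ 2 * (p * y) by ring, mul_div_mul_left _ _ (pow_ne_zero 2 hMr)]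

/-- The first-phase rate in terms of the statistics of the estimated channels. -/
theorem IsEstimateModel.firstPhaseRate_eq {GA GB HA HB : Ω → Matrix (Fin M) (Fin N) ℂ}
    {sH : Fin N ⊕ Fin N → ℝ} {eA eB : Fin N → ℝ} {K : ℝ}
    (h : IsEstimateModel P (fun ω => Matrix.fromCols (HA ω) (HB ω))
      (fun ω => Matrix.fromCols (GA ω) (GB ω) - Matrix.fromCols (HA ω) (HB ω))
      sH (Sum.elim eA eB) K) (hM : 0 < M) (p : ℝ) (i : Fin N) {S : Ω → ℝ} {u v : ℝ}
    (hS : ∀ ω, S ω = p * (u * ((∑ m, ‖HA ω m i‖ ^ 2) ^ 2 +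
      absSqH ((HA ω).col i) ((HB ω).col i)) + v * ((∑ m, ‖HB ω m i‖ ^ 2) ^ 2 +
      absSqH ((HA ω).col i) ((HB ω).col i)))) :
    firstPhaseRate P (fun _ => p) (fun _ => p) GA GB HA HB i S =
      1 / 2 / Real.log 2 * meanLog P M (fun ω => ∑ m, ‖HA ω m i‖ ^ 2)
        (fun ω => ∑ m, ‖HB ω m i‖ ^ 2) (fun ω => absSqH ((HA ω).col i) ((HB ω).col i))
        (fun ω => estimateInterference (HA ω) (HB ω) i) u v p (∑ j, (eA j + eB j)) := by
  have e : ∫ ω, Real.logb 2 (1 + S ω /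
      (P[fun ω' => powerImpairment (fun _ => p) (fun _ => p) (GA ω') (GB ω') (HA ω') (HB ω') i |
        estimateSigma HA HB]) ω) ∂P =
      ∫ ω, Real.log (1 + p * M *
    ratio u v ((∑ m, ‖HA ω m i‖ ^ 2) / M) ((∑ m, ‖HB ω m i‖ ^ 2) / M)
      (absSqH ((HA ω).col i) ((HB ω).col i) / M ^ 2)
      (p * estimateInterference (HA ω) (HB ω) i / M) (p * (∑ j, (eA j + eB j)))) /
      Real.log 2 ∂P := by
    refine integral_congr_ae ?_
    filter_upwards [h.condExp_powerImpairment p i] with ω hω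
    rw [hω, Real.logb, mul_ratio_normalized hM, hS]
    rfl
  rw [firstPhaseRate, e, integral_div, meanLog]
  ring

/-- The weights `(u, v)` are `(1, 0)` for user `A`, `(0, 1)` for user `B` and `(1, 1)` for the sum,
so a single limit theorem covers the three first-phase rates. -/
lemma powerA_eq (p : ℝ) (HA HB : Matrix (Fin M) (Fin N) ℂ) (i : Fin N) :
    powerA (fun _ => p) HA HB i = p * (1 * ((∑ m, ‖HA m i‖ ^ 2) ^ 2 +
      absSqH (HA.col i) (HB.col i)) + 0 * ((∑ m, ‖HB m i‖ ^ 2) ^ 2 +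
      absSqH (HA.col i) (HB.col i))) := by
  rw [powerA, absSqH_self, absSqH_comm (HB.col i)]
  simp only [Matrix.col_apply]
  ring

lemma powerB_eq (p : ℝ) (HA HB : Matrix (Fin M) (Fin N) ℂ) (i : Fin N) :
    powerB (fun _ => p) HA HB i = p * (0 * ((∑ m, ‖HA m i‖ ^ 2) ^ 2 +
      absSqH (HA.col i) (HB.col i)) + 1 * ((∑ m, ‖HB m i‖ ^ 2) ^ 2 +
      absSqH (HA.col i) (HB.col i))) := by
  rw [powerB, absSqH_self]
  simp only [Matrix.col_apply]
  ring

lemma powerA_add_powerB_eq (p : ℝ) (HA HB : Matrix (Fin M) (Fin N) ℂ) (i : Fin N) :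
    powerA (fun _ => p) HA HB i + powerB (fun _ => p) HA HB i =
      p * (1 * ((∑ m, ‖HA m i‖ ^ 2) ^ 2 +
      absSqH (HA.col i) (HB.col i)) + 1 * ((∑ m, ‖HB m i‖ ^ 2) ^ 2 +
      absSqH (HA.col i) (HB.col i))) := by
  rw [powerA_eq, powerB_eq]
  ring

end FirstPhaseRate

/-! ### Estimates for the broadcast rate. -/

section BroadcastLimit

/-- The logarithmic broadcast rate, with signal gain `s`, normalization `S`, power `r` and
impairment `κ` per antenna. -/
def broadcastLog (M : ℕ) (s S r κ : ℝ) : ℝ :=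
  Real.log (1 + (M * s) ^ 2 / (M * κ + M * S / r))

lemma broadcastLog_eq {M : ℕ} (hM : 0 < M) {s S r κ : ℝ} (hr : 0 < r) :
    broadcastLog M s S r κ = Real.log (1 + r * M * (s ^ 2 / (κ * r + S))) := by
  have hMr : (M : ℝ) ≠ 0 := by exact_mod_cast hM.ne'
  have e : (M * κ + M * S / r) = M * (κ * r + S) / r := by field_simp
  rw [broadcastLog, e, div_div_eq_mul_div]
  congr 2
  rw [mul_pow, pow_two (M : ℝ), mul_assoc, mul_assoc, mul_div_mul_left _ _ hMr]
  ring

/-- The two expressions differ only in the denominators `κ r + S` and `S`, so the difference is at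
most `log (1 + κ r / S) ≤ κ r / S`, which vanishes with the relay power `r`. -/
lemma abs_broadcastLog_sub_le {M : ℕ} (hM : 0 < M) {s S r κ L : ℝ} (hs : 0 < s) (hS : 0 < S)
    (hr : 0 < r) (hκ : 0 ≤ κ) (hκL : κ ≤ L) :
    |broadcastLog M s S r κ - Real.log (1 + r * M * (s ^ 2 / S))| ≤ L / S * r := by
  have hd : 0 < κ * r + S := by positivity
  rw [broadcastLog_eq hM hr]
  refine (abs_log_one_add_mul_sub_le (by positivity) (by positivity) (by positivity)).trans ?_
  rw [Real.log_div (by positivity) hd.ne', Real.log_div (by positivity) hS.ne']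
  have e : Real.log (s ^ 2) - Real.log (κ * r + S) - (Real.log (s ^ 2) - Real.log S) =
      -(Real.log ((κ * r + S) / S)) := by
    rw [Real.log_div hd.ne' hS.ne']; ring
  have h1 : 1 ≤ (κ * r + S) / S := (one_le_div hS).2 (by nlinarith [mul_nonneg hκ hr.le])
  rw [e, abs_neg, abs_of_nonneg (Real.log_nonneg h1)]
  have h2 := Real.log_le_sub_one_of_pos (by linarith : 0 < (κ * r + S) / S)
  have h3 : (κ * r + S) / S - 1 = κ / S * r := by field_simp; ring
  have h4 : κ / S * r ≤ L / S * r := by gcongr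
  linarith

/-- No smallness of `r` is involved: at constant relay power the impairment is not negligible, but
the rate still grows at least like `log M`. -/
lemma le_broadcastLog {M : ℕ} (hM : 0 < M) {s S r κ L : ℝ} (hs : 0 < s) (hS : 0 < S)
    (hr : 0 < r) (hκ : 0 ≤ κ) (hκL : κ ≤ L) :
    Real.log M + Real.log (r * (s ^ 2 / (L * r + S))) ≤ broadcastLog M s S r κ := by
  have hMr : (0 : ℝ) < M := by exact_mod_cast hM
  have hL : 0 ≤ L := hκ.trans hκL
  rw [broadcastLog_eq hM hr, ← Real.log_mul hMr.ne' (by positivity)]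
  apply Real.log_le_log (by positivity)
  have h1 : s ^ 2 / (L * r + S) ≤ s ^ 2 / (κ * r + S) := by gcongr
  have h2 := mul_le_mul_of_nonneg_left h1 (by positivity : 0 ≤ r * M)
  linarith

end BroadcastLimit

/-! ### Combining the rates of the two phases through the minima. -/

section Combination

/-- The decode-and-forward combination of the first-phase rates `r`, `aA`, `aB` and of the
broadcast rates `bA`, `bB`. -/
def relayMin (r aA aB bA bB : ℝ) : ℝ := min r (min aA bB + min aB bA)

lemma mul_relayMin {k : ℝ} (hk : 0 ≤ k) (r aA aB bA bB : ℝ) :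
    relayMin (k * r) (k * aA) (k * aB) (k * bA) (k * bB) = k * relayMin r aA aB bA bB := by
  simp only [relayMin, mul_min_of_nonneg _ _ hk, mul_add]

/-- The rates themselves may diverge, so only differences are compared; the minimum is nonexpansive
for the maximum norm. -/
lemma tendsto_min_sub_min {ι : Type*} {l : Filter ι} {a b a' b' : ι → ℝ}
    (ha : Tendsto (fun n => a n - a' n) l (𝓝 0)) (hb : Tendsto (fun n => b n - b' n) l (𝓝 0)) :
    Tendsto (fun n => min (a n) (b n) - min (a' n) (b' n)) l (𝓝 0) := by
  have h := ha.abs.max hb.abs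
  rw [abs_zero, max_self] at h
  exact squeeze_zero_norm (fun n => abs_min_sub_min_le_max _ _ _ _) h

lemma tendsto_add_sub_add {ι : Type*} {l : Filter ι} {a b a' b' : ι → ℝ}
    (ha : Tendsto (fun n => a n - a' n) l (𝓝 0)) (hb : Tendsto (fun n => b n - b' n) l (𝓝 0)) :
    Tendsto (fun n => a n + b n - (a' n + b' n)) l (𝓝 0) := by
  have h := ha.add hb
  rw [add_zero] at h
  exact h.congr fun n => by ring

variable {r aA aB bA bB r' aA' aB' bA' bB' : ℕ → ℝ}

lemma tendsto_relayMin_sub (hr : Tendsto (fun n => r n - r' n) atTop (𝓝 0))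
    (haA : Tendsto (fun n => aA n - aA' n) atTop (𝓝 0))
    (haB : Tendsto (fun n => aB n - aB' n) atTop (𝓝 0))
    (hbA : Tendsto (fun n => bA n - bA' n) atTop (𝓝 0))
    (hbB : Tendsto (fun n => bB n - bB' n) atTop (𝓝 0)) :
    Tendsto (fun n => relayMin (r n) (aA n) (aB n) (bA n) (bB n) -
      relayMin (r' n) (aA' n) (aB' n) (bA' n) (bB' n)) atTop (𝓝 0) :=
  tendsto_min_sub_min hr
    (tendsto_add_sub_add (tendsto_min_sub_min haA hbB) (tendsto_min_sub_min haB hbA))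

/-- `f` grows at most like `γ log`. -/
def LogUpper (γ : ℝ) (f : ℕ → ℝ) : Prop := ∃ C, ∀ᶠ n : ℕ in atTop, f n ≤ γ * Real.log n + C

/-- `f` grows at least like `γ log`. -/
def LogLower (γ : ℝ) (f : ℕ → ℝ) : Prop := ∃ C, ∀ᶠ n : ℕ in atTop, γ * Real.log n - C ≤ f n

lemma LogUpper.add {γ δ : ℝ} {f g : ℕ → ℝ} (hf : LogUpper γ f) (hg : LogUpper δ g) :
    LogUpper (γ + δ) fun n => f n + g n := by
  obtain ⟨C, hC⟩ := hf
  obtain ⟨D, hD⟩ := hg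
  exact ⟨C + D, by filter_upwards [hC, hD] with n h1 h2; linarith⟩

lemma LogUpper.of_tendsto_sub {γ : ℝ} {f g : ℕ → ℝ} (hg : LogUpper γ g)
    (h : Tendsto (fun n => f n - g n) atTop (𝓝 0)) : LogUpper γ f := by
  obtain ⟨C, hC⟩ := hg
  exact ⟨C + 1, by filter_upwards [hC, h.eventually_lt_const one_pos] with n h1 h2; linarith⟩

lemma LogUpper.eventually_le {γ δ : ℝ} {f g : ℕ → ℝ} (hf : LogUpper γ f) (hg : LogLower δ g)
    (h : γ < δ) : ∀ᶠ n in atTop, f n ≤ g n := by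
  obtain ⟨C, hC⟩ := hf
  obtain ⟨D, hD⟩ := hg
  have hlog : Tendsto (fun n : ℕ => (δ - γ) * Real.log n) atTop atTop :=
    (Real.tendsto_log_atTop.comp tendsto_natCast_atTop_atTop).const_mul_atTop (sub_pos.2 h)
  filter_upwards [hC, hD, hlog.eventually_ge_atTop (C + D)] with n h1 h2 h3
  linarith

/-- If the broadcast phase is the bottleneck, only the broadcast rates have to converge. -/
lemma tendsto_relayMin_sub_of_broadcast {γ : ℝ} (hγ : 2 * γ < 1)
    (hr : LogLower 1 r) (haA : LogLower 1 aA) (haB : LogLower 1 aB)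
    (hr' : LogLower 1 r') (haA' : LogLower 1 aA') (haB' : LogLower 1 aB')
    (hbA' : LogUpper γ bA') (hbB' : LogUpper γ bB')
    (hbA : Tendsto (fun n => bA n - bA' n) atTop (𝓝 0))
    (hbB : Tendsto (fun n => bB n - bB' n) atTop (𝓝 0)) :
    Tendsto (fun n => relayMin (r n) (aA n) (aB n) (bA n) (bB n) -
      relayMin (r' n) (aA' n) (aB' n) (bA' n) (bB' n)) atTop (𝓝 0) := by
  have huA := hbA'.of_tendsto_sub hbA
  have huB := hbB'.of_tendsto_sub hbB
  -- The outer minimum compares `r` with the sum of two broadcast rates, each at most `γ log` up to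
  -- a constant.
  have h2 : γ + γ < 1 := by linarith
  have h1 : γ < 1 := by linarith
  refine (tendsto_add_sub_add hbB hbA).congr' ?_
  filter_upwards [huB.eventually_le haA h1, huA.eventually_le haB h1,
    (huB.add huA).eventually_le hr h2, hbB'.eventually_le haA' h1, hbA'.eventually_le haB' h1,
    (hbB'.add hbA').eventually_le hr' h2] with n e1 e2 e3 e4 e5 e6
  rw [relayMin, relayMin, min_eq_right e1, min_eq_right e2, min_eq_right e3, min_eq_right e4,
    min_eq_right e5, min_eq_right e6]

/-- If the first phase is the bottleneck, only the first-phase rates have to converge. -/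
lemma tendsto_relayMin_sub_of_firstPhase {γ : ℝ} (hγ : γ < 1)
    (hr : Tendsto (fun n => r n - r' n) atTop (𝓝 0))
    (haA : Tendsto (fun n => aA n - aA' n) atTop (𝓝 0))
    (haB : Tendsto (fun n => aB n - aB' n) atTop (𝓝 0))
    (haA' : LogUpper γ aA') (haB' : LogUpper γ aB')
    (hbA : LogLower 1 bA) (hbB : LogLower 1 bB) (hbA' : LogLower 1 bA') (hbB' : LogLower 1 bB') :
    Tendsto (fun n => relayMin (r n) (aA n) (aB n) (bA n) (bB n) -
      relayMin (r' n) (aA' n) (aB' n) (bA' n) (bB' n)) atTop (𝓝 0) := by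
  have huA := haA'.of_tendsto_sub haA
  have huB := haB'.of_tendsto_sub haB
  -- The outer minimum need not be resolved, since both of its arguments converge in difference;
  -- only the inner minima are decided.
  refine (tendsto_min_sub_min hr (tendsto_add_sub_add haA haB)).congr' ?_
  filter_upwards [huA.eventually_le hbB hγ, huB.eventually_le hbA hγ, haA'.eventually_le hbB' hγ,
    haB'.eventually_le hbA' hγ] with n e1 e2 e3 e4
  rw [relayMin, relayMin, min_eq_left e1, min_eq_left e2, min_eq_left e3, min_eq_left e4]

/-- The maximum with `0` handles `α > 1`: the argument of the logarithm still contains the summand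
`1`, so the rate stays bounded but has no negative growth. -/
lemma logUpper_log_one_add {e s α : ℝ} (he : 0 < e) (hs : 0 < s) :
    LogUpper (max (1 - α) 0) fun M : ℕ => Real.log (1 + e / (M : ℝ) ^ α * M * s) := by
  refine ⟨Real.log (1 + e * s), ?_⟩
  filter_upwards [eventually_gt_atTop 0] with M hM
  have hM1 : (1 : ℝ) ≤ M := by exact_mod_cast hM
  have hMr : (0 : ℝ) < M := by linarith
  rw [← Real.log_rpow hMr, ← Real.log_mul (by positivity) (by positivity)]
  apply Real.log_le_log (by positivity)
  have e1 : e / (M : ℝ) ^ α * M * s = (M : ℝ) ^ (1 - α) * (e * s) := by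
    rw [Real.rpow_sub hMr, Real.rpow_one]; ring
  have h1 : (M : ℝ) ^ (1 - α) ≤ (M : ℝ) ^ max (1 - α) 0 :=
    Real.rpow_le_rpow_of_exponent_le hM1 (le_max_left _ _)
  have h2 : 1 ≤ (M : ℝ) ^ max (1 - α) 0 := Real.one_le_rpow hM1 (le_max_right _ _)
  have h3 : (M : ℝ) ^ (1 - α) * (e * s) ≤ (M : ℝ) ^ max (1 - α) 0 * (e * s) := by gcongr
  rw [e1]
  linarith

lemma logLower_log_one_add {e s : ℝ} (he : 0 < e) (hs : 0 < s) :
    LogLower 1 fun M : ℕ => Real.log (1 + e / (M : ℝ) ^ (0 : ℝ) * M * s) := by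
  refine ⟨-Real.log (e * s), ?_⟩
  filter_upwards [eventually_gt_atTop 0] with M hM
  have hMr : (0 : ℝ) < M := by exact_mod_cast hM
  rw [one_mul, sub_neg_eq_add, ← Real.log_mul hMr.ne' (by positivity), Real.rpow_zero, div_one]
  apply Real.log_le_log (by positivity)
  linarith

lemma tendsto_broadcastLog_sub {B : ℕ → ℝ} {s S e β L : ℝ} (hs : 0 < s) (hS : 0 < S) (he : 0 < e)
    (hβ : 0 < β) (hB : ∀ M : ℕ, 0 < M → ∃ κ, 0 ≤ κ ∧ κ ≤ L ∧
      B M = broadcastLog M s S (e / (M : ℝ) ^ β) κ) :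
    Tendsto (fun M : ℕ => B M - Real.log (1 + e / (M : ℝ) ^ β * M * (s ^ 2 / S))) atTop (𝓝 0) := by
  have hlim := (tendsto_natCast_rpow_neg hβ).const_mul (L / S * e)
  rw [mul_zero] at hlim
  refine squeeze_zero_norm' ?_ hlim
  filter_upwards [eventually_gt_atTop 0] with M hM
  have hMr : (0 : ℝ) < M := by exact_mod_cast hM
  obtain ⟨κ, h0, h1, h2⟩ := hB M hM
  rw [h2]
  refine (abs_broadcastLog_sub_le hM hs hS (by positivity) h0 h1).trans_eq ?_
  rw [Real.rpow_neg hMr.le]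
  ring

lemma logLower_broadcastLog {B : ℕ → ℝ} {s S e L : ℝ} (hs : 0 < s) (hS : 0 < S) (he : 0 < e)
    (hB : ∀ M : ℕ, 0 < M → ∃ κ, 0 ≤ κ ∧ κ ≤ L ∧
      B M = broadcastLog M s S (e / (M : ℝ) ^ (0 : ℝ)) κ) : LogLower 1 B := by
  refine ⟨-Real.log (e * (s ^ 2 / (L * e + S))), ?_⟩
  filter_upwards [eventually_gt_atTop 0] with M hM
  obtain ⟨κ, h0, h1, h2⟩ := hB M hM
  rw [h2, Real.rpow_zero, div_one, one_mul, sub_neg_eq_add]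
  exact le_broadcastLog hM hs hS he h0 h1

end Combination

/-! ### Assembly of the asymptotics. -/

lemma sigmaSq_pos {τp : ℕ} {pp b : ℝ} (h : 0 < τp * pp) (hb : 0 < b) : 0 < sigmaSq τp pp b := by
  unfold sigmaSq; positivity

lemma errorSq_nonneg {τp : ℕ} {pp b : ℝ} (h : 0 < τp * pp) (hb : 0 < b) :
    0 ≤ errorSq τp pp b := by
  have : errorSq τp pp b = b / (1 + τp * pp * b) := by
    have : (1 + τp * pp * b) ≠ 0 := by positivity
    rw [errorSq, sigmaSq, eq_div_iff this, sub_mul, div_mul_cancel₀ _ this]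
    ring
  rw [this]; positivity

lemma meanInterference_nonneg {N : ℕ} {sA sB : Fin N → ℝ} (hA : ∀ n, 0 < sA n)
    (hB : ∀ n, 0 < sB n) (i : Fin N) : 0 ≤ meanInterference sA sB i :=
  Finset.sum_nonneg fun j _ => by
    have := hA i; have := hA j; have := hB i; have := hB j; positivity

lemma half_logb_eq (y : ℝ) : 1 / 2 * Real.logb 2 y = 1 / 2 / Real.log 2 * Real.log y := by
  rw [Real.logb]; ring

lemma div_rpow_sub_one {M : ℕ} (hM : 0 < M) (e α : ℝ) :
    e / (M : ℝ) ^ (α - 1) = e / (M : ℝ) ^ α * M := by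
  have hMr : (0 : ℝ) < M := by exact_mod_cast hM
  rw [Real.rpow_sub_one hMr.ne', div_div_eq_mul_div, div_mul_eq_mul_div]

/-- Asymptotics of the rate of a pair for estimate models whose parameters do not depend on the
number of antennas. -/
theorem tendsto_pairRate_sub {N : ℕ} (i : Fin N) {sA sB eA eB : Fin N → ℝ} {K : ℝ}
    (hsA : ∀ n, 0 < sA n) (hsB : ∀ n, 0 < sB n) (heA : ∀ n, 0 ≤ eA n) (heB : ∀ n, 0 ≤ eB n)
    {Eu Er α β : ℝ} (hEu : 0 < Eu) (hEr : 0 < Er) (hα : 0 ≤ α) (hβ : 0 ≤ β)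
    (hαβ : 0 < α ∨ 1 / 2 < β) {Ω : ℕ → Type*} [∀ M, MeasurableSpace (Ω M)]
    (P : ∀ M, Measure (Ω M)) [∀ M, IsProbabilityMeasure (P M)]
    (GA GB HA HB : ∀ M, Ω M → Matrix (Fin M) (Fin N) ℂ)
    (h : ∀ M, IsEstimateModel (P M) (fun ω => Matrix.fromCols (HA M ω) (HB M ω))
      (fun ω => Matrix.fromCols (GA M ω) (GB M ω) - Matrix.fromCols (HA M ω) (HB M ω))
      (Sum.elim sA sB) (Sum.elim eA eB) K) :
    Tendsto
      (fun M : ℕ =>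
        pairRate (P M) (fun _ => Eu / (M : ℝ) ^ α) (fun _ => Eu / (M : ℝ) ^ α) (Er / (M : ℝ) ^ β)
            (GA M) (GB M) (HA M) (HB M) i -
          min (barR1 Eu α sA sB i M) (barR2 Eu Er α β sA sB i M)) atTop (𝓝 0) := by
  -- All rates carry the factor `k`, which turns half a binary logarithm into natural logarithms; it
  -- is positive, hence passes through the minima, and the argument continues with natural
  -- logarithms.
  set k : ℝ := 1 / 2 / Real.log 2 with hk
  have hk0 : 0 < k := by have := Real.log_pos one_lt_two; positivity
  set c := ∑ j, (eA j + eB j) with hc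
  have hc0 : 0 ≤ c := Finset.sum_nonneg fun j _ => add_nonneg (heA j) (heB j)
  set S := ∑ j, (sA j + sB j) with hS
  have hS0 : 0 < S := Finset.sum_pos (fun j _ => add_pos (hsA j) (hsB j)) ⟨i, Finset.mem_univ i⟩
  have hS' : ∑ j, (sB j + sA j) = S := Finset.sum_congr rfl fun j _ => add_comm _ _
  have hstat := fun M => (h M).isPairStatistics i
  let L : ℝ → ℝ → ℕ → ℝ := fun u v M => meanLog (P M) M (fun ω => ∑ m, ‖HA M ω m i‖ ^ 2)
    (fun ω => ∑ m, ‖HB M ω m i‖ ^ 2) (fun ω => absSqH ((HA M ω).col i) ((HB M ω).col i))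
    (fun ω => estimateInterference (HA M ω) (HB M ω) i) u v (Eu / (M : ℝ) ^ α) c
  let L' : ℝ → ℝ → ℕ → ℝ := fun u v M =>
    Real.log (1 + Eu / (M : ℝ) ^ α * M * ratio u v (sA i) (sB i) 0 0 0)
  let BA : ℕ → ℝ := fun M => k⁻¹ * broadcastRate (P M) (Er / (M : ℝ) ^ β) (GA M) (HA M) (HB M) i
  let BB : ℕ → ℝ := fun M => k⁻¹ * broadcastRate (P M) (Er / (M : ℝ) ^ β) (GB M) (HB M) (HA M) i
  let B' : ℝ → ℕ → ℝ := fun s M => Real.log (1 + Er / (M : ℝ) ^ β * M * (s ^ 2 / S))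
  have hBA : ∀ M : ℕ, 0 < M → ∃ κ, 0 ≤ κ ∧ κ ≤ broadcastBound sA sB eA K i ∧
      BA M = broadcastLog M (sA i) S (Er / (M : ℝ) ^ β) κ := fun M hM => by
    have hMr : (0 : ℝ) < M := by exact_mod_cast hM
    obtain ⟨κ, h0, h1, h2⟩ := (h M).broadcastRate_eq (x := Sum.inl) (y := Sum.inr)
      Sum.inl_injective (by simp) (GX := GA M) (HX := HA M) (HY := HB M) (by simp) (by simp)
      (by simp) hM (pr := Er / (M : ℝ) ^ β) (by positivity) i
    refine ⟨κ, h0, h1, ?_⟩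
    simp only [BA]
    rw [h2, half_logb_eq, inv_mul_cancel_left₀ hk0.ne']
    rfl
  have hBB : ∀ M : ℕ, 0 < M → ∃ κ, 0 ≤ κ ∧ κ ≤ broadcastBound sB sA eB K i ∧
      BB M = broadcastLog M (sB i) S (Er / (M : ℝ) ^ β) κ := fun M hM => by
    have hMr : (0 : ℝ) < M := by exact_mod_cast hM
    obtain ⟨κ, h0, h1, h2⟩ := (h M).broadcastRate_eq (x := Sum.inr) (y := Sum.inl)
      Sum.inr_injective (by simp) (GX := GB M) (HX := HB M) (HY := HA M) (by simp) (by simp)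
      (by simp) hM (pr := Er / (M : ℝ) ^ β) (by positivity) i
    refine ⟨κ, h0, h1, ?_⟩
    simp only [BB]
    rw [h2, half_logb_eq, inv_mul_cancel_left₀ hk0.ne']
    simp only [Sum.elim_inl, Sum.elim_inr, hS']
    rfl
  suffices hlog : Tendsto (fun M : ℕ => relayMin (L 1 1 M) (L 1 0 M) (L 0 1 M) (BA M) (BB M) -
      relayMin (L' 1 1 M) (L' 1 0 M) (L' 0 1 M) (B' (sA i) M) (B' (sB i) M)) atTop (𝓝 0) by
    have hlim := hlog.const_mul k
    rw [mul_zero] at hlim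
    refine hlim.congr' ?_
    filter_upwards [eventually_gt_atTop 0] with M hM
    rw [mul_sub, ← mul_relayMin hk0.le, ← mul_relayMin hk0.le]
    congr 1
    · have e1 := (h M).firstPhaseRate_eq hM (Eu / (M : ℝ) ^ α) i
        (fun ω => powerA_add_powerB_eq (Eu / (M : ℝ) ^ α) (HA M ω) (HB M ω) i)
      have e2 := (h M).firstPhaseRate_eq hM (Eu / (M : ℝ) ^ α) i
        (fun ω => powerA_eq (Eu / (M : ℝ) ^ α) (HA M ω) (HB M ω) i)
      have e3 := (h M).firstPhaseRate_eq hM (Eu / (M : ℝ) ^ α) i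
        (fun ω => powerB_eq (Eu / (M : ℝ) ^ α) (HA M ω) (HB M ω) i)
      rw [pairRate, e1, e2, e3]
      simp only [BA, BB, mul_inv_cancel_left₀ hk0.ne']
      rfl
    · have r1 : ratio 1 1 (sA i) (sB i) 0 0 0 = (sA i ^ 2 + sB i ^ 2) / (sA i + sB i) := by
        simp [ratio]
      have r2 : ratio 1 0 (sA i) (sB i) 0 0 0 = sA i ^ 2 / (sA i + sB i) := by simp [ratio]
      have r3 : ratio 0 1 (sA i) (sB i) 0 0 0 = sB i ^ 2 / (sB i + sA i) := by
        simp [ratio, add_comm]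
      simp only [barR1, barR2, barRAR, barRBR, barRRA, barRRB, half_logb_eq,
        div_rpow_sub_one hM, relayMin, L', B', r1, r2, r3, hS', ← hS, ← hk]
  have hr : ∀ u v, 0 ≤ u → 0 ≤ v → 0 < u + v → 0 < ratio u v (sA i) (sB i) 0 0 0 := by
    intro u v hu hv huv
    have h1 := hsA i
    have h2 := hsB i
    have h3 : 0 < u * (sA i ^ 2 + 0) + v * (sB i ^ 2 + 0) := by
      rcases hu.eq_or_lt with rfl | hu'
      · have : 0 < v := by linarith
        positivity
      · positivity
    unfold ratio
    positivity
  have hτ := meanInterference_nonneg hsA hsB i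
  have hsA2 : 0 < sA i ^ 2 / S := div_pos (pow_pos (hsA i) 2) hS0
  have hsB2 : 0 < sB i ^ 2 / S := div_pos (pow_pos (hsB i) 2) hS0
  rcases hα.eq_or_lt with rfl | hα'
  -- At constant user power the interference among estimates persists and the first-phase rates need
  -- not approach their formulas; it suffices that both grow fast enough not to be the minimum.
  · have hβ' : 1 / 2 < β := hαβ.resolve_left (lt_irrefl 0)
    have hL : ∀ u v, 0 ≤ u → u ≤ 1 → 0 ≤ v → v ≤ 1 → 0 < u + v → LogLower 1 (L u v) := by
      intro u v hu hu1 hv hv1 huv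
      obtain ⟨C, hC⟩ := exists_log_sub_le_meanLog hstat hu hu1 hv hv1 huv (hsA i) (hsB i) hc0 hEu
      refine ⟨C, hC.mono fun M hM => ?_⟩
      simp only [L, Real.rpow_zero, div_one, one_mul]
      exact hM
    have hL' : ∀ u v, 0 ≤ u → 0 ≤ v → 0 < u + v → LogLower 1 (L' u v) := fun u v hu hv huv =>
      logLower_log_one_add hEu (hr u v hu hv huv)
    -- This is the use of `β > 1/2`: the sum of the two broadcast rates must grow more slowly than
    -- `log M`.
    have hγ : 2 * max (1 - β) 0 < 1 := by
      rcases max_cases (1 - β) 0 with ⟨e, _⟩ | ⟨e, _⟩ <;> rw [e] <;> linarith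
    have hβ0 : 0 < β := by linarith
    exact tendsto_relayMin_sub_of_broadcast hγ
      (hL 1 1 (by simp) (by simp) (by simp) (by simp) (by simp))
      (hL 1 0 (by simp) (by simp) (by simp) (by simp) (by simp))
      (hL 0 1 (by simp) (by simp) (by simp) (by simp) (by simp))
      (hL' 1 1 (by simp) (by simp) (by simp)) (hL' 1 0 (by simp) (by simp) (by simp))
      (hL' 0 1 (by simp) (by simp) (by simp))
      (logUpper_log_one_add hEr hsA2) (logUpper_log_one_add hEr hsB2)
      (tendsto_broadcastLog_sub (hsA i) hS0 hEr hβ0 hBA)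
      (tendsto_broadcastLog_sub (hsB i) hS0 hEr hβ0 hBB)
  · have hL : ∀ u v, 0 ≤ u → u ≤ 1 → 0 ≤ v → v ≤ 1 → 0 < u + v →
        Tendsto (fun M => L u v M - L' u v M) atTop (𝓝 0) := fun u v hu hu1 hv hv1 huv =>
      tendsto_meanLog_sub hstat hu hu1 hv hv1 huv (hsA i) (hsB i) hτ hc0 hEu hα'
    have h1 := hL 1 1 (by simp) (by simp) (by simp) (by simp) (by simp)
    have h2 := hL 1 0 (by simp) (by simp) (by simp) (by simp) (by simp)
    have h3 := hL 0 1 (by simp) (by simp) (by simp) (by simp) (by simp)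
    rcases hβ.eq_or_lt with rfl | hβ'
    -- At constant relay power the broadcast rates are not approximated, but they grow at least like
    -- `log M`, whereas `α > 0` keeps the individual first-phase rates below `γ log M` up to a
    -- constant, with `γ < 1`.
    · exact tendsto_relayMin_sub_of_firstPhase
        (γ := max (1 - α) 0) (max_lt (by linarith) one_pos) h1 h2 h3
        (logUpper_log_one_add hEu (hr 1 0 (by simp) (by simp) (by simp)))
        (logUpper_log_one_add hEu (hr 0 1 (by simp) (by simp) (by simp)))
        (logLower_broadcastLog (hsA i) hS0 hEr hBA) (logLower_broadcastLog (hsB i) hS0 hEr hBB)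
        (logLower_log_one_add hEr hsA2) (logLower_log_one_add hEr hsB2)
    · exact tendsto_relayMin_sub h1 h2 h3
        (tendsto_broadcastLog_sub (hsA i) hS0 hEr hβ' hBA)
        (tendsto_broadcastLog_sub (hsB i) hS0 hEr hβ' hBB)

end TwoWayRelay

end

theorem theorem8 {N τp : ℕ} (i : Fin N) (bA bB : Fin N → ℝ)
    (hbA : ∀ n, 0 < bA n) (hbB : ∀ n, 0 < bB n)
    (ΦA ΦB : Matrix (Fin τp) (Fin N) ℂ) (hΦ : TwoWayRelay.IsPilot ΦA ΦB)
    (pp Eu Er α β : ℝ) (hpp : 0 < pp) (hEu : 0 < Eu) (hEr : 0 < Er)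
    (hα : 0 ≤ α) (hβ : 0 ≤ β) (hαβ : 0 < α ∨ 1 / 2 < β)
    {Ω : ℕ → Type*} [∀ M, MeasurableSpace (Ω M)]
    (P : ∀ M, Measure (Ω M)) [∀ M, IsProbabilityMeasure (P M)]
    (GA GB : ∀ M, Ω M → Matrix (Fin M) (Fin N) ℂ)
    (Np : ∀ M, Ω M → Matrix (Fin M) (Fin τp) ℂ)
    (hmodel : ∀ M, TwoWayRelay.IsChannelModel (P M) bA bB (GA M) (GB M) (Np M)) :
    Tendsto
      (fun M : ℕ =>
        TwoWayRelay.spectralEfficiencyDF (P M) bA bB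
            (fun _ => Eu / (M : ℝ) ^ α) (fun _ => Eu / (M : ℝ) ^ α) (Er / (M : ℝ) ^ β) pp
            ΦA ΦB (GA M) (GB M) (Np M) i -
          min
            (TwoWayRelay.barR1 Eu α (fun n => TwoWayRelay.sigmaSq τp pp (bA n))
              (fun n => TwoWayRelay.sigmaSq τp pp (bB n)) i M)
            (TwoWayRelay.barR2 Eu Er α β (fun n => TwoWayRelay.sigmaSq τp pp (bA n))
              (fun n => TwoWayRelay.sigmaSq τp pp (bB n)) i M))
      atTop (𝓝 0) := by
  have hτ : (0 : ℝ) < τp * pp := mul_pos (by exact_mod_cast hΦ.pos i) hpp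
  refine TwoWayRelay.tendsto_pairRate_sub i
    (eA := fun n => TwoWayRelay.errorSq τp pp (bA n))
    (eB := fun n => TwoWayRelay.errorSq τp pp (bB n))
    (K := ∑ j, 4 * ∫ x, x ^ 4 ∂gaussianReal 0
      (TwoWayRelay.sigmaSq τp pp (Sum.elim bA bB j) / 2).toNNReal)
    (fun n => TwoWayRelay.sigmaSq_pos hτ (hbA n)) (fun n => TwoWayRelay.sigmaSq_pos hτ (hbB n))
    (fun n => TwoWayRelay.errorSq_nonneg hτ (hbA n))
    (fun n => TwoWayRelay.errorSq_nonneg hτ (hbB n)) hEu hEr hα hβ hαβ P GA GB _ _ fun M => ?_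
  have h := (hmodel M).isEstimateModel hbA hbB hΦ hτ fun ω => rfl
  convert h using 1
  · funext j
    rcases j with j | j <;> rfl
  · funext j
    rcases j with j | j <;> rfl
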